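/- Let $n\ge 1$ and let $a^{(1)},\dots,a^{(N)}\in\mathbb Z^n$ be lattice points which generate $\mathbb Z^n$ as an abelian group; write $A=\{a^{(1)},\dots,a^{(N)}\}$. Let $\mathbb C[\lambda]=\mathbb C[\lambda_1,\dots,\lambda_N]$, let $\mathcal D=\mathbb C\langle\lambda_1,\dots,\lambda_N,\partial_1,\dots,\partial_N\rangle$ be the ring of differential operators in the $\lambda_j$ ($\partial_j=\partial/\partial\lambda_j$), let $R'=\mathbb C[\lambda][x_1^{\pm1},\dots,x_n^{\pm1}]$ and put $f=\sum_{j=1}^N\lambda_jx^{a^{(j)}}\in R'$. Let $\alpha=(\alpha_1,\dots,\alpha_n)\in\mathbb C^n$. Let $C(A)\subseteq\mathbb R^n$ be the real cone generated by $A$, and let $\ell_1,\dots,\ell_s$ be the homogeneous linear forms with relatively prime integer coefficients which are nonnegative on $C(A)$ and define its codimension-one faces $\{u\in C(A):\ell_i(u)=0\}$. Call $\alpha$ nonresonant for $A$ if $\ell_i(\alpha)\notin\mathbb Z$ for all $i$. On the relative de Rham modules $\Omega^k_{R'/\mathbb C[\lambda]}$, which are free over $R'$ on the products of $k$ of the forms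 $dx_i/x_i$, put $$\nabla_\alpha(\omega)=d\omega+\sum_{i=1}^n\alpha_i\frac{dx_i}{x_i}\wedge\omega+df\wedge\omega ,$$ and let $\partial_j$ act by $\partial_j+\partial_j(f)$, where $\partial_j$ is applied to coefficients with respect to this basis and to the coefficients of Laurent polynomials in $x$. This makes $(\Omega^\bullet_{R'/\mathbb C[\lambda]},\nabla_\alpha)$ a complex of $\mathcal D$-modules. Suppose that $f=x_n\,g(x_1,\dots,x_{n-1})$ with $g\in\mathbb C[\lambda][x_1^{\pm1},\dots,x_{n-1}^{\pm1}]$. Let $U$ be the open subset $g\ne0$ of the $(n-1)$-torus over $\mathbb C[\lambda]$ with coordinates $x_1,\dots,x_{n-1}$, so that its ring of functions is $\mathbb C[\lambda][x_1^{\pm1},\dots,x_{n-1}^{\pm1}][1/g]$. On the relative forms $\Omega^k_{U/\mathbb C[\lambda]}$ put $$\widetilde\nabla_\alpha(\omega)=d\omega+\sum_{i=1}^{n-1}\alpha_i\frac{dx_i}{x_i}\wedge\omega-\alpha_n\frac{dg}{g}\wedge\omega ,$$ and let $\partial_j$ act by $\partial_j-\alpha_n\,\partial_j(g)/g$, with $\partial_j$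 applied to coefficients with respect to the basis of products of the $dx_i/x_i$, $1\le i\le n-1$, and with $\partial_j(x_i)=0$. This makes $(\Omega^\bullet_{U/\mathbb C[\lambda]},\widetilde\nabla_\alpha)$ a complex of $\mathcal D$-modules. Theorem. If $\alpha$ is nonresonant for $A$, then for every $i$ there is an isomorphism of $\mathcal D$-modules $$H^i(\Omega^\bullet_{R'/\mathbb C[\lambda]},\nabla_\alpha)\cong H^{i-1}(\Omega^\bullet_{U/\mathbb C[\lambda]},\widetilde\nabla_\alpha).$$ (For $i=0$ the right-hand side is $0$, so the claim is that $H^0(\Omega^\bullet_{R'/\mathbb C[\lambda]},\nabla_\alpha)=0$.) -/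

import Mathlib

open scoped KaehlerDifferential

noncomputable section

/-! ### The Weyl algebra -/

/-- The polynomial ring `ℂ[λ] = ℂ[λ₁, …, λ_N]`. -/
abbrev LambdaRing (N : ℕ) : Type := MvPolynomial (Fin N) ℂ

/-- The defining relations of the Weyl algebra; `Sum.inl j` stands for `λ_j` and `Sum.inr j` for
`∂_j = ∂/∂λ_j`. -/
inductive WeylRel (N : ℕ) :
    FreeAlgebra ℂ (Fin N ⊕ Fin N) → FreeAlgebra ℂ (Fin N ⊕ Fin N) → Prop
  | coord_comm (i j : Fin N) : WeylRel N
      (FreeAlgebra.ι ℂ (Sum.inl i) * FreeAlgebra.ι ℂ (Sum.inl j))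
      (FreeAlgebra.ι ℂ (Sum.inl j) * FreeAlgebra.ι ℂ (Sum.inl i))
  | partial_comm (i j : Fin N) : WeylRel N
      (FreeAlgebra.ι ℂ (Sum.inr i) * FreeAlgebra.ι ℂ (Sum.inr j))
      (FreeAlgebra.ι ℂ (Sum.inr j) * FreeAlgebra.ι ℂ (Sum.inr i))
  | partial_coord (i j : Fin N) : WeylRel N
      (FreeAlgebra.ι ℂ (Sum.inr i) * FreeAlgebra.ι ℂ (Sum.inl j))
      (FreeAlgebra.ι ℂ (Sum.inl j) * FreeAlgebra.ι ℂ (Sum.inr i) + if i = j then 1 else 0)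

/-- The ring `𝓓 = ℂ⟨λ₁, …, λ_N, ∂₁, …, ∂_N⟩` of differential operators in the `λ_j`, i.e. the
`N`-th Weyl algebra. -/
def Weyl (N : ℕ) : Type := RingQuot (WeylRel N)

namespace Weyl

variable {N : ℕ}

instance : Ring (Weyl N) := inferInstanceAs (Ring (RingQuot (WeylRel N)))
instance : Algebra ℂ (Weyl N) := inferInstanceAs (Algebra ℂ (RingQuot (WeylRel N)))

/-- The element `λ_j` of the Weyl algebra. -/
def coord (j : Fin N) : Weyl N :=
  RingQuot.mkAlgHom ℂ (WeylRel N) (FreeAlgebra.ι ℂ (Sum.inl j))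

/-- The element `∂_j` of the Weyl algebra. -/
def del (j : Fin N) : Weyl N :=
  RingQuot.mkAlgHom ℂ (WeylRel N) (FreeAlgebra.ι ℂ (Sum.inr j))

/-- Operators `l_j`, `p_j` satisfying the Weyl relations define a representation of the Weyl
algebra. -/
def lift {A : Type*} [Ring A] [Algebra ℂ A] (l p : Fin N → A)
    (hl : ∀ i j, l i * l j = l j * l i) (hp : ∀ i j, p i * p j = p j * p i)
    (hpl : ∀ i j, p i * l j = l j * p i + if i = j then 1 else 0) : Weyl N →ₐ[ℂ] A :=
  RingQuot.liftAlgHom ℂ ⟨FreeAlgebra.lift ℂ (Sum.elim l p), by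
    intro x y h
    cases h with
    | coord_comm i j => simpa using hl i j
    | partial_comm i j => simpa using hp i j
    | partial_coord i j =>
      have := hpl i j
      split_ifs at this ⊢ <;> simpa using this⟩

section lift

variable {A : Type*} [Ring A] [Algebra ℂ A] (l p : Fin N → A)
    (hl : ∀ i j, l i * l j = l j * l i) (hp : ∀ i j, p i * p j = p j * p i)
    (hpl : ∀ i j, p i * l j = l j * p i + if i = j then 1 else 0)

theorem lift_coord (j : Fin N) : lift l p hl hp hpl (coord j) = l j := by
  unfold lift coord
  exact (RingQuot.liftAlgHom_mkAlgHom_apply ℂ _ _ _).trans (by simp)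

theorem lift_del (j : Fin N) : lift l p hl hp hpl (del j) = p j := by
  unfold lift del
  exact (RingQuot.liftAlgHom_mkAlgHom_apply ℂ _ _ _).trans (by simp)

end lift

/-- To be closed under the Weyl algebra it suffices to be closed under its generators. -/
theorem induction {P : Weyl N → Prop} (hc : ∀ c : ℂ, P (algebraMap ℂ _ c))
    (hl : ∀ j, P (coord j)) (hp : ∀ j, P (del j)) (hadd : ∀ a b, P a → P b → P (a + b))
    (hmul : ∀ a b, P a → P b → P (a * b)) (w : Weyl N) : P w := by
  obtain ⟨x, rfl⟩ := RingQuot.mkAlgHom_surjective ℂ (WeylRel N) w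
  induction x using FreeAlgebra.induction with
  | grade0 c => rw [AlgHom.commutes]; exact hc c
  | grade1 x =>
    cases x with
    | inl j => exact hl j
    | inr j => exact hp j
  | mul a b ha hb => rw [map_mul]; exact hmul _ _ ha hb
  | add a b ha hb => rw [map_add]; exact hadd _ _ ha hb

end Weyl

/-! ### Exterior powers -/

section Exterior

variable {B M : Type} [CommRing B] [AddCommGroup M] [Module B M]

/-- The map `x ↦ η ∧ x` for a vector `η`. -/
def wedge (k : ℕ) (η : M) : ⋀[B]^k M →ₗ[B] ⋀[B]^(k + 1) M :=
  (LinearMap.mulLeft B (ExteriorAlgebra.ι B η)).restrict fun x hx => by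
    rw [LinearMap.mulLeft_apply, ExteriorAlgebra.exteriorPower, pow_succ']
    exact Submodule.mul_mem_mul (LinearMap.mem_range_self _ _) hx

theorem coe_wedge (k : ℕ) (η : M) (x : ⋀[B]^k M) :
    (wedge k η x : ExteriorAlgebra B M) = ExteriorAlgebra.ι B η * x := rfl

theorem wedge_add (k : ℕ) (η ζ : M) (x : ⋀[B]^k M) :
    wedge k (η + ζ) x = wedge k η x + wedge k ζ x := by
  ext; simp [coe_wedge, add_mul]

theorem wedge_smul (k : ℕ) (c : B) (η : M) (x : ⋀[B]^k M) :
    wedge k (c • η) x = c • wedge k η x := by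
  ext; simp [coe_wedge]

theorem wedge_sum {ι : Type*} (s : Finset ι) (k : ℕ) (η : ι → M) (x : ⋀[B]^k M) :
    wedge k (∑ i ∈ s, η i) x = ∑ i ∈ s, wedge k (η i) x := by
  ext; simp [coe_wedge, Finset.sum_mul]

theorem wedge_wedge_self (k : ℕ) (η : M) (x : ⋀[B]^k M) :
    wedge (k + 1) η (wedge k η x) = 0 := by
  ext; simp [coe_wedge, ← mul_assoc]

theorem wedge_wedge_swap (k : ℕ) (η ζ : M) (x : ⋀[B]^k M) :
    wedge (k + 1) η (wedge k ζ x) = -wedge (k + 1) ζ (wedge k η x) := by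
  have h := wedge_wedge_self k (η + ζ) x
  simp only [wedge_add, map_add, wedge_wedge_self, zero_add, add_zero] at h
  exact eq_neg_of_add_eq_zero_right h

theorem wedge_ιMulti (k : ℕ) (η : M) (v : Fin k → M) :
    wedge k η (exteriorPower.ιMulti B k v) = exteriorPower.ιMulti B (k + 1) (Fin.cons η v) := by
  ext
  simp [coe_wedge, ExteriorAlgebra.ιMulti_succ_apply, Matrix.vecTail, Function.comp_def]

variable {n : ℕ} (b : Module.Basis (Fin n) B M)

/-- An additive operator `φ` on `B` acts on the coefficients of an element of `⋀^k M` with respect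
to the basis `b_{i₁} ∧ ⋯ ∧ b_{i_k}`, `i₁ < ⋯ < i_k`. -/
def coeffMap (k : ℕ) (φ : B → B) (x : ⋀[B]^k M) : ⋀[B]^k M :=
  ∑ I, φ ((b.exteriorPower k).repr x I) • b.exteriorPower k I

theorem coeffMap_basis (k : ℕ) (φ : B →+ B) (c : B) (I) :
    coeffMap b k φ (c • b.exteriorPower k I) = φ c • b.exteriorPower k I := by
  unfold coeffMap
  rw [Finset.sum_eq_single I]
  · simp only [map_smul, Module.Basis.repr_self, Finsupp.smul_apply, Finsupp.single_eq_same,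
      smul_eq_mul, mul_one]
  · intro J _ h
    simp only [map_smul, Module.Basis.repr_self, Finsupp.smul_apply, Finsupp.single_eq_of_ne h,
      smul_zero, map_zero, zero_smul]
  · simp

theorem coeffMap_add (k : ℕ) (φ : B →+ B) (x y : ⋀[B]^k M) :
    coeffMap b k φ (x + y) = coeffMap b k φ x + coeffMap b k φ y := by
  simp only [coeffMap, map_add, Finsupp.add_apply, add_smul, Finset.sum_add_distrib]

theorem repr_coeffMap (k : ℕ) (φ : B → B) (x : ⋀[B]^k M) (I) :
    (b.exteriorPower k).repr (coeffMap b k φ x) I = φ ((b.exteriorPower k).repr x I) := by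
  unfold coeffMap
  rw [Module.Basis.repr_sum_self]

theorem coeffMap_coeffMap (k : ℕ) (φ ψ : B → B) (x : ⋀[B]^k M) :
    coeffMap b k φ (coeffMap b k ψ x) = coeffMap b k (fun c => φ (ψ c)) x := by
  simp only [coeffMap, Module.Basis.repr_sum_self]

/-- Coefficientwise operators are computed correctly on all wedge products of basis vectors, in
whatever order. -/
theorem coeffMap_ιMulti (k : ℕ) (φ : B →+ B) (c : B) (v : Fin k → Fin n) :
    coeffMap b k φ (c • exteriorPower.ιMulti B k (b ∘ v)) =
      φ c • exteriorPower.ιMulti B k (b ∘ v) := by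
  by_cases hv : Function.Injective v; swap
  · rw [AlternatingMap.map_eq_zero_of_not_injective _ _ (fun h => hv (.of_comp h))]
    simp [coeffMap]
  have hcard : (Finset.image v Finset.univ).card = k :=
    (Finset.card_image_of_injective _ hv).trans (Finset.card_fin k)
  let I : Set.powersetCard (Fin n) k := ⟨Finset.image v Finset.univ, hcard⟩
  let σ : Equiv.Perm (Fin k) := (Finset.orderIsoOfFin _ hcard).toEquiv.trans
    ((Equiv.setCongr Fintype.coe_image_univ).trans (Equiv.ofInjective v hv).symm)
  have hI : b.exteriorPower k I = exteriorPower.ιMulti B k ((b ∘ v) ∘ σ) := by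
    rw [exteriorPower.basis_apply, exteriorPower.ιMulti_family, Function.comp_assoc]
    congr 2
    ext i
    simp [σ, Equiv.apply_ofInjective_symm]
    rfl
  rw [AlternatingMap.map_perm] at hI
  have hs : exteriorPower.ιMulti B k (b ∘ v) = Equiv.Perm.sign σ • b.exteriorPower k I := by
    rw [hI, smul_smul, Int.units_mul_self, one_smul]
  rw [hs]
  rcases Int.units_eq_one_or (Equiv.Perm.sign σ) with h | h <;> rw [h]
  · simp only [one_smul]
    exact coeffMap_basis b k φ c I
  · simp only [Units.neg_smul, one_smul, smul_neg, ← neg_smul]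
    rw [coeffMap_basis, map_neg]

theorem coeffMap_wedge_basis (k : ℕ) (φ : B →+ B) (i : Fin n) (x : ⋀[B]^k M) :
    coeffMap b (k + 1) φ (wedge k (b i) x) = wedge k (b i) (coeffMap b k φ x) := by
  rw [← (b.exteriorPower k).sum_repr x]
  generalize (b.exteriorPower k).repr x = c
  let Φ (k : ℕ) : ⋀[B]^k M →+ ⋀[B]^k M := AddMonoidHom.mk' (coeffMap b k φ) (coeffMap_add b k φ)
  change Φ (k + 1) _ = wedge k (b i) (Φ k _)
  simp only [map_sum, map_smul]
  refine Finset.sum_congr rfl fun I _ => ?_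
  change coeffMap b (k + 1) φ _ = wedge k (b i) (coeffMap b k φ _)
  rw [coeffMap_basis, map_smul]
  rw [exteriorPower.basis_apply, exteriorPower.ιMulti_family, wedge_ιMulti]
  have : (Fin.cons (b i) (b ∘ Set.powersetCard.ofFinEmbEquiv.symm I) : Fin (k + 1) → M) =
      b ∘ (Fin.cons i (Set.powersetCard.ofFinEmbEquiv.symm I) : Fin (k + 1) → Fin n) := by
    funext j
    refine Fin.cases ?_ (fun j => ?_) j <;> simp
  rw [this]
  exact coeffMap_ιMulti b (k + 1) φ _ _

end Exterior

/-! ### Relative de Rham complexes with a twisted connection -/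

/-- Data over `ℂ[λ]` from which a twisted relative de Rham complex of `𝓓`-modules is formed:
a `ℂ[λ]`-algebra `B`, a basis of the module `Ω¹_{B/ℂ[λ]}` of Kähler differentials consisting of
closed forms, lifts `δ_j` of `∂/∂λ_j` to `B` which annihilate this basis, a closed relative one-form
`η`, and elements `m_j` of `B` which describe the action of `∂_j`.  In terms of the derivations
`θ_i` of `B/ℂ[λ]` dual to the basis, the fields `theta_comm`, …, `delta_pot` express that the
basis is closed, that `η` is closed and that the operators `δ_j + m_j` commute with one another
and with `d + η ∧ `. -/
structure TwistedData (N : ℕ) where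
  B : Type
  [commRing : CommRing B]
  [algebraC : Algebra ℂ B]
  [algebra : Algebra (LambdaRing N) B]
  [tower : IsScalarTower ℂ (LambdaRing N) B]
  rk : ℕ
  frame : Module.Basis (Fin rk) B (Ω[B⁄LambdaRing N])
  delta : Fin N → Derivation ℂ B B
  delta_coeff : ∀ j s, delta j (algebraMap (LambdaRing N) B s) =
    algebraMap (LambdaRing N) B (MvPolynomial.pderiv j s)
  eta : Ω[B⁄LambdaRing N]
  pot : Fin N → B
  theta_comm : ∀ i k c, frame.coord i (KaehlerDifferential.D (LambdaRing N) B
    (frame.coord k (KaehlerDifferential.D (LambdaRing N) B c))) =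
    frame.coord k (KaehlerDifferential.D (LambdaRing N) B (frame.coord i (KaehlerDifferential.D (LambdaRing N) B c)))
  delta_theta : ∀ j i c, delta j (frame.coord i (KaehlerDifferential.D (LambdaRing N) B c)) =
    frame.coord i (KaehlerDifferential.D (LambdaRing N) B (delta j c))
  delta_comm : ∀ j l c, delta j (delta l c) = delta l (delta j c)
  theta_eta : ∀ i k, frame.coord i (KaehlerDifferential.D (LambdaRing N) B (frame.coord k eta)) =
    frame.coord k (KaehlerDifferential.D (LambdaRing N) B (frame.coord i eta))
  delta_eta : ∀ j i, delta j (frame.coord i eta) =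
    frame.coord i (KaehlerDifferential.D (LambdaRing N) B (pot j))
  delta_pot : ∀ j l, delta j (pot l) = delta l (pot j)

namespace TwistedData

attribute [instance] commRing algebraC algebra tower

variable {N : ℕ} (S : TwistedData N)

/-- The module `Ω^k_{B/ℂ[λ]}` of relative `k`-forms. -/
def Form (k : ℕ) : Type := ⋀[S.B]^k (Ω[S.B⁄LambdaRing N])

instance (k : ℕ) : AddCommGroup (S.Form k) :=
  inferInstanceAs (AddCommGroup (⋀[S.B]^k (Ω[S.B⁄LambdaRing N])))
instance (k : ℕ) : Module S.B (S.Form k) :=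
  inferInstanceAs (Module S.B (⋀[S.B]^k (Ω[S.B⁄LambdaRing N])))
instance (k : ℕ) : Module ℂ (S.Form k) :=
  inferInstanceAs (Module ℂ (⋀[S.B]^k (Ω[S.B⁄LambdaRing N])))
instance (k : ℕ) : IsScalarTower ℂ S.B (S.Form k) :=
  inferInstanceAs (IsScalarTower ℂ S.B (⋀[S.B]^k (Ω[S.B⁄LambdaRing N])))

/-- The basis `b_{i₁} ∧ ⋯ ∧ b_{i_k}`, `i₁ < ⋯ < i_k`, of the module of `k`-forms. -/
def formBasis (k : ℕ) : Module.Basis (Set.powersetCard (Fin S.rk) k) S.B (S.Form k) :=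
  S.frame.exteriorPower k

/-- Exterior multiplication by a relative one-form. -/
def wedgeForm (k : ℕ) (η : Ω[S.B⁄LambdaRing N]) : S.Form k →ₗ[S.B] S.Form (k + 1) := wedge k η

/-- The relative exterior derivative `d(∑_I ξ_I b_I) = ∑_I dξ_I ∧ b_I`; the `b_I` are closed. -/
def extDeriv (k : ℕ) (x : S.Form k) : S.Form (k + 1) :=
  ∑ I, S.wedgeForm k (KaehlerDifferential.D (LambdaRing N) S.B ((S.formBasis k).repr x I))
    (S.formBasis k I)

/-- The derivation `θ_i` of `B/ℂ[λ]` dual to `b_i`. -/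
def theta (i : Fin S.rk) : S.B →+ S.B :=
  AddMonoidHom.mk' (fun c => S.frame.coord i (KaehlerDifferential.D (LambdaRing N) S.B c))
    (fun a b => by simp only [map_add])

theorem wedgeForm_eq (k : ℕ) (ζ : Ω[S.B⁄LambdaRing N]) (y : S.Form k) :
    S.wedgeForm k ζ y = ∑ i, S.frame.coord i ζ • S.wedgeForm k (S.frame i) y := by
  conv_lhs => rw [← S.frame.sum_repr ζ]
  refine (wedge_sum _ _ _ _).trans (Finset.sum_congr rfl fun i _ => ?_)
  exact wedge_smul _ _ _ _

theorem extDeriv_smul (k : ℕ) (c : S.B) (x : S.Form k) : S.extDeriv k (c • x) =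
    S.wedgeForm k (KaehlerDifferential.D (LambdaRing N) S.B c) x + c • S.extDeriv k x := by
  have h : S.wedgeForm k (KaehlerDifferential.D (LambdaRing N) S.B c) x =
      ∑ I, (S.formBasis k).repr x I •
        S.wedgeForm k (KaehlerDifferential.D (LambdaRing N) S.B c) (S.formBasis k I) := by
    conv_lhs => rw [← (S.formBasis k).sum_repr x]
    simp only [map_sum, map_smul]
  unfold extDeriv
  rw [h, Finset.smul_sum, ← Finset.sum_add_distrib]
  refine Finset.sum_congr rfl fun I _ => ?_
  rw [map_smul, Finsupp.smul_apply, smul_eq_mul, Derivation.leibniz]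
  refine (wedge_add _ _ _ _).trans ((add_comm _ _).trans ?_)
  exact congrArg₂ _ (wedge_smul _ _ _ _) (wedge_smul _ _ _ _)

theorem extDeriv_add (k : ℕ) (x y : S.Form k) :
    S.extDeriv k (x + y) = S.extDeriv k x + S.extDeriv k y := by
  unfold extDeriv
  rw [← Finset.sum_add_distrib]
  refine Finset.sum_congr rfl fun I _ => ?_
  rw [map_add, Finsupp.add_apply, map_add]
  exact wedge_add _ _ _ _

theorem extDeriv_eq (k : ℕ) (x : S.Form k) : S.extDeriv k x =
    ∑ i, S.wedgeForm k (S.frame i) (coeffMap S.frame k (S.theta i) x) := by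
  have h (i : Fin S.rk) : S.wedgeForm k (S.frame i) (coeffMap S.frame k (S.theta i) x) =
      ∑ I, S.theta i ((S.formBasis k).repr x I) • S.wedgeForm k (S.frame i) (S.formBasis k I) := by
    refine (map_sum (S.wedgeForm k (S.frame i)) _ _).trans (Finset.sum_congr rfl fun I _ => ?_)
    exact map_smul _ _ _
  simp only [h]
  rw [Finset.sum_comm]
  exact Finset.sum_congr rfl fun I _ => S.wedgeForm_eq k _ _

theorem extDeriv_wedge_frame (k : ℕ) (l : Fin S.rk) (x : S.Form k) :
    S.extDeriv (k + 1) (S.wedgeForm k (S.frame l) x) =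
      -S.wedgeForm (k + 1) (S.frame l) (S.extDeriv k x) := by
  rw [extDeriv_eq, extDeriv_eq, map_sum, ← Finset.sum_neg_distrib]
  refine Finset.sum_congr rfl fun i _ => ?_
  refine Eq.trans ?_ (wedge_wedge_swap k (S.frame i) (S.frame l) _)
  exact congrArg (wedge (k + 1) (S.frame i)) (coeffMap_wedge_basis S.frame k (S.theta i) l x)

theorem extDeriv_wedge_D (k : ℕ) (r : S.B) (x : S.Form k) :
    S.extDeriv (k + 1) (S.wedgeForm k (KaehlerDifferential.D (LambdaRing N) S.B r) x) =
      -S.wedgeForm (k + 1) (KaehlerDifferential.D (LambdaRing N) S.B r) (S.extDeriv k x) := by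
  let δ : S.Form (k + 1) →+ S.Form (k + 1 + 1) := AddMonoidHom.mk' _ (S.extDeriv_add (k + 1))
  have hδ (y) : S.extDeriv (k + 1) y = δ y := rfl
  rw [S.wedgeForm_eq k, S.wedgeForm_eq (k + 1), hδ, map_sum]
  simp only [← hδ, extDeriv_smul, extDeriv_wedge_frame, Finset.sum_add_distrib, smul_neg,
    Finset.sum_neg_distrib]
  refine add_eq_right.mpr ?_
  set T := ∑ i, S.wedgeForm (k + 1) (KaehlerDifferential.D (LambdaRing N) S.B
    (S.frame.coord i (KaehlerDifferential.D (LambdaRing N) S.B r))) (S.wedgeForm k (S.frame i) x)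
    with hT
  have h1 : T = ∑ i, ∑ l, S.theta l (S.theta i r) •
      S.wedgeForm (k + 1) (S.frame l) (S.wedgeForm k (S.frame i) x) :=
    Finset.sum_congr rfl fun i _ => S.wedgeForm_eq _ _ _
  have h2 : T = -T := by
    conv_rhs => rw [h1, Finset.sum_comm]
    rw [h1]
    simp only [← Finset.sum_neg_distrib]
    refine Finset.sum_congr rfl fun i _ => Finset.sum_congr rfl fun l _ => ?_
    rw [← smul_neg]
    exact congrArg₂ _ (S.theta_comm l i r) (wedge_wedge_swap _ _ _ _)
  have h3 : (2 : ℂ) • T = 0 := by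
    rw [two_smul]
    nth_rewrite 1 [h2]
    exact neg_add_cancel _
  exact (smul_eq_zero_iff_right two_ne_zero).mp h3

/-- The form `ω₁ ∧ ⋯ ∧ ω_k`. -/
def wedgeProd (k : ℕ) (ω : Fin k → Ω[S.B⁄LambdaRing N]) : S.Form k :=
  exteriorPower.ιMulti S.B k ω

/-- `extDeriv` is the usual relative exterior derivative:
`d(ξ dr₁ ∧ ⋯ ∧ dr_k) = dξ ∧ dr₁ ∧ ⋯ ∧ dr_k`. -/
theorem extDeriv_eq_usual (k : ℕ) (c : S.B) (r : Fin k → S.B) :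
    S.extDeriv k (c • S.wedgeProd k fun i => KaehlerDifferential.D (LambdaRing N) S.B (r i)) =
      S.wedgeProd (k + 1) (Fin.cons (KaehlerDifferential.D (LambdaRing N) S.B c)
        fun i => KaehlerDifferential.D (LambdaRing N) S.B (r i)) := by
  have h0 : S.extDeriv k
      (S.wedgeProd k fun i => KaehlerDifferential.D (LambdaRing N) S.B (r i)) = 0 := by
    clear c
    induction k with
    | zero =>
      unfold extDeriv
      refine Finset.sum_eq_zero fun I _ => ?_
      have hI : S.wedgeProd 0 (fun i => KaehlerDifferential.D (LambdaRing N) S.B (r i)) =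
          S.formBasis 0 I := by
        refine Eq.trans ?_ (exteriorPower.basis_apply S.B 0 S.frame I).symm
        exact congrArg (exteriorPower.ιMulti S.B 0) (Subsingleton.elim _ _)
      rw [hI, Module.Basis.repr_self, Finsupp.single_eq_same, Derivation.map_one_eq_zero]
      exact Subtype.ext ((coe_wedge _ _ _).trans (by rw [map_zero, zero_mul]; rfl))
    | succ k ih =>
      have hr : S.wedgeProd (k + 1) (fun i => KaehlerDifferential.D (LambdaRing N) S.B (r i)) =
          S.wedgeForm k (KaehlerDifferential.D (LambdaRing N) S.B (r 0))
            (S.wedgeProd k fun i => KaehlerDifferential.D (LambdaRing N) S.B (r i.succ)) := by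
        refine Eq.trans (congrArg (exteriorPower.ιMulti S.B (k + 1)) ?_)
          (wedge_ιMulti k _ _).symm
        funext i
        refine Fin.cases ?_ (fun i => ?_) i <;> rfl
      rw [hr, extDeriv_wedge_D, ih, map_zero, neg_zero]
  rw [extDeriv_smul, h0, smul_zero, add_zero]
  exact wedge_ιMulti k _ _

/-- The twisted connection `∇ ω = dω + η ∧ ω`, as a plain function. -/
def nablaFun (k : ℕ) (x : S.Form k) : S.Form (k + 1) := S.extDeriv k x + S.wedgeForm k S.eta x

/-- The operator `δ_j + m_j` on `k`-forms, where `δ_j` acts on the coefficients with respect to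
the basis. -/
def delFun (k : ℕ) (j : Fin N) (x : S.Form k) : S.Form k :=
  ∑ I, S.delta j ((S.formBasis k).repr x I) • S.formBasis k I + S.pot j • x

/-- The derivation `θ_i` plus multiplication by the `i`-th coefficient of `η`. -/
def thetaEta (i : Fin S.rk) : S.B →+ S.B :=
  AddMonoidHom.mk' (fun c => S.frame.coord i (KaehlerDifferential.D (LambdaRing N) S.B c) +
    S.frame.coord i S.eta * c) (fun a b => by simp only [map_add]; ring)

/-- The operator `δ_j + m_j` on `B`. -/
def deltaPot (j : Fin N) : S.B →+ S.B :=
  AddMonoidHom.mk' (fun c => S.delta j c + S.pot j * c) (fun a b => by simp only [map_add]; ring)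

theorem thetaEta_apply (i : Fin S.rk) (c : S.B) : S.thetaEta i c =
    S.frame.coord i (KaehlerDifferential.D (LambdaRing N) S.B c) + S.frame.coord i S.eta * c := rfl

theorem deltaPot_apply (j : Fin N) (c : S.B) : S.deltaPot j c = S.delta j c + S.pot j * c := rfl

theorem thetaEta_comm (i k : Fin S.rk) (c : S.B) :
    S.thetaEta i (S.thetaEta k c) = S.thetaEta k (S.thetaEta i c) := by
  simp only [thetaEta_apply, map_add, Derivation.leibniz, map_smul, smul_eq_mul]
  rw [S.theta_comm i k c, S.theta_eta i k]
  ring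

theorem deltaPot_thetaEta (j : Fin N) (i : Fin S.rk) (c : S.B) :
    S.deltaPot j (S.thetaEta i c) = S.thetaEta i (S.deltaPot j c) := by
  simp only [thetaEta_apply, deltaPot_apply, map_add, Derivation.leibniz, map_smul, smul_eq_mul]
  rw [S.delta_theta j i c, S.delta_eta j i]
  ring

theorem deltaPot_comm (j l : Fin N) (c : S.B) :
    S.deltaPot j (S.deltaPot l c) = S.deltaPot l (S.deltaPot j c) := by
  simp only [deltaPot_apply, map_add, Derivation.leibniz, smul_eq_mul]
  rw [S.delta_comm j l c, S.delta_pot j l]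
  ring

theorem delFun_eq (k : ℕ) (j : Fin N) (x : S.Form k) :
    S.delFun k j x = coeffMap S.frame k (S.deltaPot j) x := by
  have h : S.pot j • x = ∑ I, (S.pot j * (S.formBasis k).repr x I) • S.formBasis k I := by
    conv_lhs => rw [← (S.formBasis k).sum_repr x]
    simp only [Finset.smul_sum, smul_smul]
  unfold delFun
  rw [h, ← Finset.sum_add_distrib]
  simp only [← add_smul]
  rfl

theorem repr_delFun (k : ℕ) (j : Fin N) (x : S.Form k) (I) :
    (S.formBasis k).repr (S.delFun k j x) I = S.deltaPot j ((S.formBasis k).repr x I) := by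
  rw [delFun_eq]
  exact repr_coeffMap _ _ _ _ _

theorem delFun_smul (k : ℕ) (j : Fin N) (c : S.B) (x : S.Form k) :
    S.delFun k j (c • x) = c • S.delFun k j x + S.delta j c • x := by
  refine (S.formBasis k).ext_elem fun I => ?_
  simp only [map_add, map_smul, Finsupp.add_apply, Finsupp.smul_apply, repr_delFun, smul_eq_mul,
    deltaPot_apply, Derivation.leibniz]
  ring

/-- Coefficientwise action of `θ_i + η_i` followed by exterior multiplication by `b_i`. -/
def nablaTerm (k : ℕ) (i : Fin S.rk) : S.Form k →+ S.Form (k + 1) :=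
  AddMonoidHom.mk' (fun x => wedge k (S.frame i) (coeffMap S.frame k (S.thetaEta i) x))
    fun _ _ => (congrArg _ (coeffMap_add _ _ _ _ _)).trans (map_add _ _ _)

theorem nablaTerm_apply (k : ℕ) (i : Fin S.rk) (x : S.Form k) : S.nablaTerm k i x =
    ∑ I, S.thetaEta i ((S.formBasis k).repr x I) • S.wedgeForm k (S.frame i) (S.formBasis k I) := by
  refine (map_sum (S.wedgeForm k (S.frame i)) _ _).trans (Finset.sum_congr rfl fun I _ => ?_)
  exact map_smul _ _ _

theorem nablaFun_eq (k : ℕ) (x : S.Form k) : S.nablaFun k x = ∑ i, S.nablaTerm k i x := by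
  have h : S.wedgeForm k S.eta x =
      ∑ I, (S.formBasis k).repr x I • S.wedgeForm k S.eta (S.formBasis k I) := by
    conv_lhs => rw [← (S.formBasis k).sum_repr x]
    simp only [map_sum, map_smul]
  unfold nablaFun extDeriv
  rw [h, ← Finset.sum_add_distrib]
  simp only [nablaTerm_apply]
  rw [Finset.sum_comm]
  refine Finset.sum_congr rfl fun I _ => ?_
  rw [S.wedgeForm_eq k (KaehlerDifferential.D _ _ _), S.wedgeForm_eq k S.eta, Finset.smul_sum,
    ← Finset.sum_add_distrib]
  refine Finset.sum_congr rfl fun i _ => ?_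
  rw [smul_smul, ← add_smul, thetaEta_apply, mul_comm (S.frame.coord i S.eta)]

/-- `∂_j` acts on `k`-forms by the operator `δ_j + m_j`. -/
def delOp (k : ℕ) (j : Fin N) : Module.End ℂ (S.Form k) where
  toFun := S.delFun k j
  map_add' x y := by simp only [delFun_eq]; exact coeffMap_add _ _ _ _ _
  map_smul' c x := by
    unfold delFun
    rw [RingHom.id_apply, smul_add, Finset.smul_sum, smul_comm c]
    congr 1
    refine Finset.sum_congr rfl fun I _ => ?_
    rw [← algebraMap_smul S.B c x, map_smul, Finsupp.smul_apply, smul_eq_mul,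
      ← Algebra.smul_def, Derivation.map_smul, smul_assoc]

/-- `λ_j` acts on `k`-forms by multiplication. -/
def coordOp (k : ℕ) (j : Fin N) : Module.End ℂ (S.Form k) where
  toFun x := algebraMap (LambdaRing N) S.B (MvPolynomial.X j) • x
  map_add' := smul_add _
  map_smul' c x := by rw [RingHom.id_apply, smul_comm]

/-- The action of the Weyl algebra on the relative `k`-forms. -/
def weylAction (k : ℕ) : Weyl N →ₐ[ℂ] Module.End ℂ (S.Form k) :=
  Weyl.lift (S.coordOp k) (S.delOp k)
    (fun i j => LinearMap.ext fun x => smul_comm (algebraMap (LambdaRing N) S.B (MvPolynomial.X i))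
      (algebraMap (LambdaRing N) S.B (MvPolynomial.X j)) x)
    (fun i j => LinearMap.ext fun x => (S.formBasis k).ext_elem fun I => by
      change (S.formBasis k).repr (S.delFun k i (S.delFun k j x)) I =
        (S.formBasis k).repr (S.delFun k j (S.delFun k i x)) I
      simp only [repr_delFun, deltaPot_comm S i j])
    (fun i j => LinearMap.ext fun x => by
      have h : (if i = j then 1 else 0 : Module.End ℂ (S.Form k)) x =
          S.delta i (algebraMap (LambdaRing N) S.B (MvPolynomial.X j)) • x := by
        rw [S.delta_coeff, MvPolynomial.pderiv_X]
        by_cases hij : i = j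
        · subst hij; simp
        · simp [hij, Ne.symm hij]
      rw [LinearMap.add_apply, h]
      exact S.delFun_smul k i _ x)

instance (k : ℕ) : Module (Weyl N) (S.Form k) :=
  Module.compHom (S.Form k) (S.weylAction k).toRingHom

theorem weyl_smul_def (k : ℕ) (w : Weyl N) (x : S.Form k) : w • x = S.weylAction k w x := rfl

theorem coord_smul (k : ℕ) (j : Fin N) (x : S.Form k) :
    Weyl.coord j • x = algebraMap (LambdaRing N) S.B (MvPolynomial.X j) • x := by
  rw [weyl_smul_def, weylAction, Weyl.lift_coord]; rfl

theorem del_smul (k : ℕ) (j : Fin N) (x : S.Form k) :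
    Weyl.del j • x = S.delFun k j x := by
  rw [weyl_smul_def, weylAction, Weyl.lift_del]; rfl

theorem algebraMap_weyl_smul (k : ℕ) (c : ℂ) (x : S.Form k) :
    algebraMap ℂ (Weyl N) c • x = c • x := by
  rw [weyl_smul_def, AlgHom.commutes, Module.algebraMap_end_apply]

theorem nablaFun_add (k : ℕ) (x y : S.Form k) :
    S.nablaFun k (x + y) = S.nablaFun k x + S.nablaFun k y := by
  simp only [nablaFun_eq, map_add, Finset.sum_add_distrib]

theorem nablaTerm_smul (k : ℕ) (i : Fin S.rk) (s : LambdaRing N) (x : S.Form k) :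
    S.nablaTerm k i (algebraMap _ S.B s • x) = algebraMap _ S.B s • S.nablaTerm k i x := by
  simp only [nablaTerm_apply, Finset.smul_sum, smul_smul, map_smul, Finsupp.smul_apply]
  refine Finset.sum_congr rfl fun I _ => ?_
  congr 1
  rw [thetaEta_apply, thetaEta_apply, smul_eq_mul, Derivation.leibniz, Derivation.map_algebraMap]
  simp only [smul_zero, add_zero, map_smul, smul_eq_mul]
  ring

theorem nablaFun_smul (k : ℕ) (s : LambdaRing N) (x : S.Form k) :
    S.nablaFun k (algebraMap _ S.B s • x) = algebraMap _ S.B s • S.nablaFun k x := by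
  simp only [nablaFun_eq, nablaTerm_smul, Finset.smul_sum]

theorem nablaTerm_delFun (k : ℕ) (i : Fin S.rk) (j : Fin N) (x : S.Form k) :
    S.nablaTerm k i (S.delFun k j x) = S.delFun (k + 1) j (S.nablaTerm k i x) := by
  rw [delFun_eq, delFun_eq]
  refine Eq.trans ?_ (coeffMap_wedge_basis S.frame k (S.deltaPot j) i _).symm
  refine congrArg (wedge k (S.frame i)) ?_
  refine (coeffMap_coeffMap _ _ _ _ _).trans (Eq.trans ?_ (coeffMap_coeffMap _ _ _ _ _).symm)
  simp only [deltaPot_thetaEta]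

theorem nablaFun_delFun (k : ℕ) (j : Fin N) (x : S.Form k) :
    S.nablaFun k (S.delFun k j x) = S.delFun (k + 1) j (S.nablaFun k x) := by
  simp only [nablaFun_eq, nablaTerm_delFun]
  exact (map_sum (S.delOp (k + 1) j) _ _).symm

theorem nablaFun_weyl (k : ℕ) (w : Weyl N) (x : S.Form k) :
    S.nablaFun k (w • x) = w • S.nablaFun k x := by
  induction w using Weyl.induction generalizing x with
  | hc c =>
    rw [algebraMap_weyl_smul, algebraMap_weyl_smul, ← algebraMap_smul S.B c,
      ← algebraMap_smul S.B c, IsScalarTower.algebraMap_apply ℂ (LambdaRing N) S.B, nablaFun_smul]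
  | hl j => rw [coord_smul, coord_smul, nablaFun_smul]
  | hp j => rw [del_smul, del_smul, nablaFun_delFun]
  | hadd a b ha hb => rw [add_smul, add_smul, nablaFun_add, ha, hb]
  | hmul a b ha hb => rw [mul_smul, mul_smul, ha, hb]

theorem nablaTerm_nablaTerm (k : ℕ) (i l : Fin S.rk) (x : S.Form k) :
    S.nablaTerm (k + 1) i (S.nablaTerm k l x) = -S.nablaTerm (k + 1) l (S.nablaTerm k i x) := by
  have h (i l : Fin S.rk) : S.nablaTerm (k + 1) i (S.nablaTerm k l x) =
      wedge (k + 1) (S.frame i) (wedge k (S.frame l)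
        (coeffMap S.frame k (fun c => S.thetaEta i (S.thetaEta l c)) x)) := by
    refine congrArg (wedge (k + 1) (S.frame i)) ?_
    refine (coeffMap_wedge_basis S.frame k (S.thetaEta i) l _).trans ?_
    exact congrArg (wedge k (S.frame l)) (coeffMap_coeffMap _ _ _ _ _)
  rw [h, h]
  simp only [S.thetaEta_comm i l]
  exact wedge_wedge_swap _ _ _ _

/-- The twisted connection `∇ ω = dω + η ∧ ω` as a map of `𝓓`-modules. -/
def nabla (k : ℕ) : S.Form k →ₗ[Weyl N] S.Form (k + 1) where
  toFun := S.nablaFun k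
  map_add' := S.nablaFun_add k
  map_smul' := S.nablaFun_weyl k

theorem nabla_nabla (k : ℕ) (x : S.Form k) : S.nabla (k + 1) (S.nabla k x) = 0 := by
  change S.nablaFun (k + 1) (S.nablaFun k x) = 0
  have h : S.nablaFun (k + 1) (S.nablaFun k x) =
      ∑ i, ∑ l, S.nablaTerm (k + 1) i (S.nablaTerm k l x) := by
    simp only [nablaFun_eq, map_sum]
  have h2 : S.nablaFun (k + 1) (S.nablaFun k x) = -S.nablaFun (k + 1) (S.nablaFun k x) := by
    conv_rhs => rw [h, Finset.sum_comm]
    rw [h]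
    simp only [← Finset.sum_neg_distrib]
    exact Finset.sum_congr rfl fun i _ => Finset.sum_congr rfl fun l _ =>
      S.nablaTerm_nablaTerm k i l x
  have h3 : (2 : ℂ) • S.nablaFun (k + 1) (S.nablaFun k x) = 0 := by
    rw [two_smul]
    nth_rewrite 1 [h2]
    exact neg_add_cancel _
  exact (smul_eq_zero_iff_right two_ne_zero).mp h3

/-- The `k`-coboundaries, the image of `∇` in degree `k`. -/
def boundaries : (k : ℕ) → Submodule (Weyl N) (S.Form k)
  | 0 => ⊥
  | k + 1 => LinearMap.range (S.nabla k)

/-- The cohomology `H^k(Ω^•_{B/ℂ[λ]}, ∇)`, a `𝓓`-module. -/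
abbrev H (k : ℕ) : Type :=
  LinearMap.ker (S.nabla k) ⧸ (S.boundaries k).submoduleOf (LinearMap.ker (S.nabla k))

end TwistedData

/-! ### The torus and the complement of a hypersurface in it -/

/-- The ring `ℂ[λ][x₁^{±1}, …, x_n^{±1}]` of Laurent polynomials over `ℂ[λ]`, the coordinate ring
of the `n`-torus over `ℂ[λ]`. -/
def Laurent (N n : ℕ) : Type := AddMonoidAlgebra (LambdaRing N) (Fin n → ℤ)

namespace Laurent

variable {N n : ℕ}

instance : CommRing (Laurent N n) :=
  inferInstanceAs (CommRing (AddMonoidAlgebra (LambdaRing N) (Fin n → ℤ)))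
instance : Algebra ℂ (Laurent N n) :=
  inferInstanceAs (Algebra ℂ (AddMonoidAlgebra (LambdaRing N) (Fin n → ℤ)))
instance : Algebra (LambdaRing N) (Laurent N n) :=
  inferInstanceAs (Algebra (LambdaRing N) (AddMonoidAlgebra (LambdaRing N) (Fin n → ℤ)))
instance : IsScalarTower ℂ (LambdaRing N) (Laurent N n) :=
  inferInstanceAs (IsScalarTower ℂ (LambdaRing N) (AddMonoidAlgebra (LambdaRing N) (Fin n → ℤ)))

/-- The term `c x^u`. -/
def single (u : Fin n → ℤ) (c : LambdaRing N) : Laurent N n := AddMonoidAlgebra.single u c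

theorem single_add (u : Fin n → ℤ) (c d : LambdaRing N) :
    single u (c + d) = single u c + single u d := AddMonoidAlgebra.single_add _ _ _

theorem single_mul_single (u v : Fin n → ℤ) (c d : LambdaRing N) :
    single u c * single v d = single (u + v) (c * d) := AddMonoidAlgebra.single_mul_single _ _ _ _

theorem smul_single (u : Fin n → ℤ) (c d : LambdaRing N) : c • single u d = single u (c * d) :=
  AddMonoidAlgebra.smul_single _ _ _

theorem algebraMap_eq (c : LambdaRing N) :
    algebraMap (LambdaRing N) (Laurent N n) c = single 0 c := rfl

theorem single_induction {P : Laurent N n → Prop} (p : Laurent N n) (zero : P 0)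
    (add : ∀ p q, P p → P q → P (p + q)) (single : ∀ u c, P (single u c)) : P p :=
  AddMonoidAlgebra.induction_linear p zero add single

/-- The Laurent monomial `x^u`. -/
def mono (u : Fin n → ℤ) : Laurent N n := single u 1

/-- The coordinate `x_i`. -/
def var (i : Fin n) : Laurent N n := mono (Pi.single i 1)

/-- The inverse of the coordinate `x_i`. -/
def varInv (i : Fin n) : Laurent N n := mono (-Pi.single i 1)

theorem mono_add (u v : Fin n → ℤ) : (mono (u + v) : Laurent N n) = mono u * mono v := by
  simp [mono, single_mul_single]

theorem mono_zero : (mono 0 : Laurent N n) = 1 := rfl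

theorem mono_mul_mono_neg (u : Fin n → ℤ) : (mono u * mono (-u) : Laurent N n) = 1 := by
  rw [← mono_add, add_neg_cancel, mono_zero]

/-- The derivation `x_i ∂/∂x_i` as a linear map, `c x^u ↦ u_i c x^u`. -/
def thetaLin (i : Fin n) : Laurent N n →ₗ[LambdaRing N] Laurent N n :=
  (Finsupp.lsum (LambdaRing N) fun u : Fin n → ℤ =>
    u i • AddMonoidAlgebra.lsingle (R := LambdaRing N) (S := LambdaRing N) u) ∘ₗ
    (AddMonoidAlgebra.coeffLinearEquiv (LambdaRing N)).toLinearMap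

theorem thetaLin_single (i : Fin n) (u : Fin n → ℤ) (c : LambdaRing N) :
    thetaLin i (single u c) = u i • single u c := by
  change Finsupp.lsum (LambdaRing N) (fun u : Fin n → ℤ =>
    u i • AddMonoidAlgebra.lsingle (R := LambdaRing N) (S := LambdaRing N) u)
      (Finsupp.single u c) = _
  rw [Finsupp.lsum_single]
  rfl

/-- The derivation `x_i ∂/∂x_i`. -/
def theta (i : Fin n) : Derivation (LambdaRing N) (Laurent N n) (Laurent N n) :=
  Derivation.mk' (thetaLin i) fun p q => by
    induction p using Laurent.single_induction with
    | zero => simp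
    | add p₁ p₂ h₁ h₂ => simp only [add_mul, map_add, h₁, h₂, smul_add, add_smul]; abel
    | single u c =>
      induction q using Laurent.single_induction with
      | zero => simp
      | add p₁ p₂ h₁ h₂ => simp only [mul_add, map_add, h₁, h₂, smul_add, add_smul]; abel
      | single v d =>
        rw [single_mul_single]
        simp only [thetaLin_single, smul_eq_mul, mul_smul_comm,
          single_mul_single, Pi.add_apply, add_smul]
        rw [add_comm v u, mul_comm d c, add_comm]

theorem theta_single (i : Fin n) (u : Fin n → ℤ) (c : LambdaRing N) :
    theta i (single u c) = u i • single u c :=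
  thetaLin_single i u c

/-- The operator which applies `∂/∂λ_j` to the coefficients of a Laurent polynomial, as a linear
map. -/
def deltaLin (j : Fin N) : Laurent N n →ₗ[ℂ] Laurent N n :=
  (Finsupp.lsum ℂ fun u : Fin n → ℤ =>
    AddMonoidAlgebra.lsingle (R := ℂ) (S := LambdaRing N) u ∘ₗ
      ((MvPolynomial.pderiv j : Derivation ℂ (LambdaRing N) (LambdaRing N)) :
        LambdaRing N →ₗ[ℂ] LambdaRing N)) ∘ₗ
    (AddMonoidAlgebra.coeffLinearEquiv ℂ).toLinearMap

theorem deltaLin_single (j : Fin N) (u : Fin n → ℤ) (c : LambdaRing N) :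
    deltaLin j (single u c) =
      single u (MvPolynomial.pderiv j c) := by
  change Finsupp.lsum ℂ (fun u : Fin n → ℤ =>
    AddMonoidAlgebra.lsingle (R := ℂ) (S := LambdaRing N) u ∘ₗ
      ((MvPolynomial.pderiv j : Derivation ℂ (LambdaRing N) (LambdaRing N)) :
        LambdaRing N →ₗ[ℂ] LambdaRing N)) (Finsupp.single u c) = _
  rw [Finsupp.lsum_single]
  rfl

/-- The derivation of `ℂ[λ][x^{±1}]` which applies `∂/∂λ_j` to the coefficients. -/
def delta (j : Fin N) : Derivation ℂ (Laurent N n) (Laurent N n) :=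
  Derivation.mk' (deltaLin j) fun p q => by
    induction p using Laurent.single_induction with
    | zero => simp
    | add p₁ p₂ h₁ h₂ => simp only [add_mul, map_add, h₁, h₂, smul_add, add_smul]; abel
    | single u c =>
      induction q using Laurent.single_induction with
      | zero => simp
      | add p₁ p₂ h₁ h₂ => simp only [mul_add, map_add, h₁, h₂, smul_add, add_smul]; abel
      | single v d =>
        rw [single_mul_single]
        simp only [deltaLin_single, smul_eq_mul, single_mul_single,
          Derivation.leibniz, single_add]
        rw [add_comm v u]

theorem delta_single (j : Fin N) (u : Fin n → ℤ) (c : LambdaRing N) :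
    delta j (single u c) =
      single u (MvPolynomial.pderiv j c) := deltaLin_single j u c

theorem delta_coeff (j : Fin N) (s : LambdaRing N) :
    delta j (algebraMap (LambdaRing N) (Laurent N n) s) =
      algebraMap (LambdaRing N) (Laurent N n) (MvPolynomial.pderiv j s) :=
  delta_single j 0 s

theorem theta_comm (i k : Fin n) (p : Laurent N n) : theta i (theta k p) = theta k (theta i p) := by
  induction p using Laurent.single_induction with
  | zero => simp
  | add p q hp hq => simp only [map_add, hp, hq]
  | single u c => simp only [theta_single, map_zsmul, smul_comm (u i)]

theorem delta_theta (j : Fin N) (i : Fin n) (p : Laurent N n) :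
    delta j (theta i p) = theta i (delta j p) := by
  induction p using Laurent.single_induction with
  | zero => simp
  | add p q hp hq => simp only [map_add, hp, hq]
  | single u c => simp only [theta_single, delta_single, map_zsmul]

theorem pderiv_comm (j l : Fin N) (c : LambdaRing N) :
    MvPolynomial.pderiv j (MvPolynomial.pderiv l c) =
      MvPolynomial.pderiv l (MvPolynomial.pderiv j c) := by
  have h : ⁅(MvPolynomial.pderiv j : Derivation ℂ (LambdaRing N) (LambdaRing N)),
      (MvPolynomial.pderiv l : Derivation ℂ (LambdaRing N) (LambdaRing N))⁆ = 0 := by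
    refine MvPolynomial.derivation_ext fun i => ?_
    rw [Derivation.commutator_apply, MvPolynomial.pderiv_X, MvPolynomial.pderiv_X]
    simp only [Pi.single_apply, apply_ite (MvPolynomial.pderiv _), map_zero,
      Derivation.map_one_eq_zero, ite_self, sub_zero, Derivation.zero_apply]
  have := congrArg (fun D => D c) h
  simpa [Derivation.commutator_apply, sub_eq_zero] using this

theorem delta_comm (j l : Fin N) (p : Laurent N n) : delta j (delta l p) = delta l (delta j p) := by
  induction p using Laurent.single_induction with
  | zero => simp
  | add p q hp hq => simp only [map_add, hp, hq]
  | single u c =>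
    simp only [delta_single, pderiv_comm j l]

/-- The logarithmic differential `dx_i / x_i`. -/
def dlog (i : Fin n) : Ω[Laurent N n⁄LambdaRing N] :=
  varInv (N := N) i • KaehlerDifferential.D (LambdaRing N) (Laurent N n) (var i)

/-- `u ↦ dx^u / x^u` is additive. -/
def dlogHom : (Fin n → ℤ) →+ Ω[Laurent N n⁄LambdaRing N] :=
  AddMonoidHom.mk'
    (fun u => (mono (-u) : Laurent N n) • KaehlerDifferential.D (LambdaRing N) (Laurent N n) (mono u))
    fun u v => by
      have hu := mono_mul_mono_neg (N := N) u
      have hv := mono_mul_mono_neg (N := N) v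
      rw [mono_add u v, Derivation.leibniz, smul_add (mono _), smul_smul, smul_smul, neg_add,
        mono_add, add_comm]
      congr 2
      · linear_combination mono (-u) * hv
      · linear_combination mono (-v) * hu

theorem D_mono (u : Fin n → ℤ) : KaehlerDifferential.D (LambdaRing N) (Laurent N n) (mono u) =
    mono (N := N) u • ∑ i, u i • dlog i := by
  have h : dlogHom (N := N) u = ∑ i, u i • dlog i := by
    have hu : u = ∑ i, u i • (Pi.single i 1 : Fin n → ℤ) := by
      simpa [Pi.single_apply] using pi_eq_sum_univ' u
    conv_lhs => rw [hu]
    rw [map_sum]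
    refine Finset.sum_congr rfl fun i _ => ?_
    rw [map_zsmul]
    rfl
  rw [← h]
  change _ = (mono u : Laurent N n) • (mono (-u) : Laurent N n) •
    KaehlerDifferential.D (LambdaRing N) (Laurent N n) (mono u)
  rw [smul_smul, mono_mul_mono_neg, one_smul]

theorem span_dlog : Submodule.span (Laurent N n) (Set.range (dlog (N := N) (n := n))) = ⊤ := by
  rw [eq_top_iff, ← KaehlerDifferential.span_range_derivation, Submodule.span_le]
  rintro _ ⟨p, rfl⟩
  induction p using Laurent.single_induction with
  | zero => simp
  | add p q hp hq => rw [map_add]; exact Submodule.add_mem _ hp hq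
  | single u c =>
    have : (single u c : Laurent N n) = c • mono u := by
      rw [mono, smul_single, mul_one]
    rw [this, Derivation.map_smul, D_mono, SetLike.mem_coe,
      ← algebraMap_smul (Laurent N n) c]
    refine Submodule.smul_mem _ _ (Submodule.smul_mem _ _ (Submodule.sum_mem _ fun i _ => ?_))
    exact zsmul_mem (Submodule.subset_span (Set.mem_range_self i)) _

theorem lift_theta_dlog (i k : Fin n) :
    (theta i).liftKaehlerDifferential (dlog (N := N) k) = if k = i then 1 else 0 := by
  rw [dlog, map_smul, Derivation.liftKaehlerDifferential_comp_D, var, mono, theta_single]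
  split_ifs with h
  · subst h
    rw [Pi.single_eq_same, one_smul, smul_eq_mul, mul_comm]
    exact mono_mul_mono_neg _
  · rw [Pi.single_eq_of_ne (Ne.symm h), zero_smul, smul_zero]

/-- The basis `dx₁/x₁, …, dx_n/x_n` of the relative one-forms on the torus. -/
def frame : Module.Basis (Fin n) (Laurent N n) (Ω[Laurent N n⁄LambdaRing N]) :=
  Module.Basis.mk (v := dlog) (by
    rw [Fintype.linearIndependent_iff]
    intro c hc i
    have := congrArg (theta i).liftKaehlerDifferential hc
    simpa [lift_theta_dlog] using this) span_dlog.ge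

theorem frame_apply (i : Fin n) : frame (N := N) i = dlog i := Module.Basis.mk_apply _ _ i

theorem frame_coord (i : Fin n) : (frame (N := N)).coord i = (theta i).liftKaehlerDifferential := by
  refine frame.ext fun k => ?_
  rw [Module.Basis.coord_apply, Module.Basis.repr_self, frame_apply, lift_theta_dlog,
    Finsupp.single_apply]

theorem frame_coord_D (i : Fin n) (p : Laurent N n) :
    frame.coord i (KaehlerDifferential.D (LambdaRing N) (Laurent N n) p) = theta i p := by
  rw [frame_coord, Derivation.liftKaehlerDifferential_comp_D]

theorem frame_coord_eta (f : Laurent N n) (α : Fin n → ℂ) (i : Fin n) :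
    frame.coord i (∑ i, α i • dlog i + KaehlerDifferential.D (LambdaRing N) (Laurent N n) f) =
      algebraMap ℂ (Laurent N n) (α i) + theta i f := by
  have h (k : Fin n) : frame.coord i (α k • dlog (N := N) k) =
      if k = i then algebraMap ℂ (Laurent N n) (α k) else 0 := by
    rw [← algebraMap_smul (Laurent N n) (α k) (dlog k), map_smul, frame_coord, lift_theta_dlog,
      smul_eq_mul, mul_ite, mul_one, mul_zero]
  rw [map_add, frame_coord_D, map_sum]
  simp only [h, Finset.sum_ite_eq', Finset.mem_univ, if_true]

theorem theta_algebraMapC (i : Fin n) (c : ℂ) :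
    theta (N := N) i (algebraMap ℂ (Laurent N n) c) = 0 := by
  rw [IsScalarTower.algebraMap_apply ℂ (LambdaRing N) (Laurent N n), Derivation.map_algebraMap]

end Laurent

open Laurent in
/-- The twisted relative de Rham complex of the `n`-torus over `ℂ[λ]` with
`∇_α ω = dω + ∑ α_i dx_i/x_i ∧ ω + df ∧ ω`; here `∂_j` acts by `∂_j + f^{∂_j}`, where `f^{∂_j}` is
obtained from `f` by applying `∂_j` to the coefficients. -/
def torusData {N n : ℕ} (f : Laurent N n) (α : Fin n → ℂ) : TwistedData N where
  B := Laurent N n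
  rk := n
  frame := Laurent.frame
  delta := Laurent.delta
  delta_coeff := Laurent.delta_coeff
  eta := ∑ i, α i • dlog i + KaehlerDifferential.D (LambdaRing N) (Laurent N n) f
  pot j := Laurent.delta j f
  theta_comm i k c := by simp only [frame_coord_D, Laurent.theta_comm i k]
  delta_theta j i c := by simp only [frame_coord_D, Laurent.delta_theta]
  delta_comm := Laurent.delta_comm
  theta_eta i k := by
    rw [frame_coord_eta, frame_coord_eta, frame_coord_D, frame_coord_D]
    simp only [map_add, zero_add, theta_algebraMapC]
    exact Laurent.theta_comm _ _ _
  delta_eta j i := by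
    rw [frame_coord_eta, frame_coord_D]
    simp only [map_add, Derivation.map_algebraMap, zero_add]
    exact Laurent.delta_theta _ _ _
  delta_pot j l := Laurent.delta_comm j l f

/-! The hypersurface complement. -/

section Localization

variable {A : Type} [CommRing A] [Algebra ℂ A] (g : A)

/-- A derivation of `A` extends to the localization `A[1/g]`. -/
def extendAway (δ : Derivation ℂ A A) :
    Derivation ℂ (Localization.Away g) (Localization.Away g) :=
  LinearMap.compDer
    (LinearMap.extendScalarsOfIsLocalization (Submonoid.powers g) (Localization.Away g)
      (IsLocalizedModule.lift (Submonoid.powers g)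
        (KaehlerDifferential.map ℂ ℂ A (Localization.Away g))
        ((Algebra.linearMap A (Localization.Away g)).compDer δ).liftKaehlerDifferential
        (IsLocalizedModule.map_units (S := Submonoid.powers g)
          (Algebra.linearMap A (Localization.Away g)))))
    (KaehlerDifferential.D ℂ (Localization.Away g))

theorem extendAway_algebraMap (δ : Derivation ℂ A A) (a : A) :
    extendAway g δ (algebraMap A (Localization.Away g) a) =
      algebraMap A (Localization.Away g) (δ a) := by
  change IsLocalizedModule.lift (Submonoid.powers g)
    (KaehlerDifferential.map ℂ ℂ A (Localization.Away g))
    ((Algebra.linearMap A (Localization.Away g)).compDer δ).liftKaehlerDifferential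
    (IsLocalizedModule.map_units (S := Submonoid.powers g)
      (Algebra.linearMap A (Localization.Away g)))
    (KaehlerDifferential.D ℂ (Localization.Away g) (algebraMap A (Localization.Away g) a)) = _
  rw [← KaehlerDifferential.map_D ℂ ℂ A, IsLocalizedModule.lift_apply,
    Derivation.liftKaehlerDifferential_comp_D]
  rfl

/-- Derivations of `A[1/g]` are determined by their values on `A`. -/
theorem derivation_ext_away {D₁ D₂ : Derivation ℂ (Localization.Away g) (Localization.Away g)}
    (h : ∀ a, D₁ (algebraMap A (Localization.Away g) a) =
      D₂ (algebraMap A (Localization.Away g) a)) : D₁ = D₂ := by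
  ext x
  obtain ⟨a, s, rfl⟩ := IsLocalization.exists_mk'_eq (Submonoid.powers g) x
  have hs := IsLocalization.map_units (Localization.Away g) s
  have key (D : Derivation ℂ (Localization.Away g) (Localization.Away g)) :
      algebraMap A (Localization.Away g) s * D (IsLocalization.mk' _ a s) =
        D (algebraMap A (Localization.Away g) a) -
          IsLocalization.mk' _ a s * D (algebraMap A (Localization.Away g) s) := by
    rw [eq_sub_iff_add_eq, ← smul_eq_mul, ← smul_eq_mul, ← Derivation.leibniz, mul_comm,
      IsLocalization.mk'_spec]
  refine hs.mul_left_cancel ?_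
  rw [key, key, h, h]

end Localization

section Complement

variable {N m : ℕ} (g : Laurent N m)

/-- The logarithmic differential `dx_i / x_i` on the open set `g ≠ 0` of the torus. -/
def awayDlog (i : Fin m) : Ω[Localization.Away g⁄LambdaRing N] :=
  algebraMap (Laurent N m) (Localization.Away g) (Laurent.varInv i) •
    KaehlerDifferential.D (LambdaRing N) (Localization.Away g)
      (algebraMap (Laurent N m) (Localization.Away g) (Laurent.var i))

/-- The basis `dx₁/x₁, …, dx_m/x_m` of the relative one-forms on the open set `g ≠ 0` of the
torus. -/
def awayFrame :
    Module.Basis (Fin m) (Localization.Away g) (Ω[Localization.Away g⁄LambdaRing N]) :=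
  Laurent.frame.ofIsLocalizedModule (Localization.Away g) (Submonoid.powers g)
    (KaehlerDifferential.map (LambdaRing N) (LambdaRing N) (Laurent N m) (Localization.Away g))

theorem awayFrame_apply (i : Fin m) : awayFrame g i = awayDlog g i := by
  rw [awayFrame, Module.Basis.ofIsLocalizedModule_apply, Laurent.frame_apply, Laurent.dlog,
    map_smul, KaehlerDifferential.map_D, ← algebraMap_smul (Localization.Away g)]
  rfl

/-- The derivation `x_i ∂/∂x_i` on the open set `g ≠ 0` of the torus. -/
def awayTheta (i : Fin m) : Derivation ℂ (Localization.Away g) (Localization.Away g) :=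
  (((awayFrame g).coord i).compDer
    (KaehlerDifferential.D (LambdaRing N) (Localization.Away g))).restrictScalars ℂ

theorem awayTheta_apply (i : Fin m) (c : Localization.Away g) : awayTheta g i c =
    (awayFrame g).coord i (KaehlerDifferential.D (LambdaRing N) (Localization.Away g) c) := rfl

theorem awayTheta_algebraMap (i : Fin m) (a : Laurent N m) :
    awayTheta g i (algebraMap (Laurent N m) (Localization.Away g) a) =
      algebraMap (Laurent N m) (Localization.Away g) (Laurent.theta i a) := by
  rw [awayTheta_apply, ← KaehlerDifferential.map_D (LambdaRing N) (LambdaRing N) (Laurent N m),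
    ← Laurent.frame_coord_D, Module.Basis.coord_apply, awayFrame,
    Module.Basis.ofIsLocalizedModule_repr_apply]
  rfl

/-- The derivation of the coordinate ring of the open set `g ≠ 0` which extends
`Laurent.delta j`. -/
def awayDelta (j : Fin N) : Derivation ℂ (Localization.Away g) (Localization.Away g) :=
  extendAway g (Laurent.delta j)

theorem awayDelta_algebraMap (j : Fin N) (a : Laurent N m) :
    awayDelta g j (algebraMap (Laurent N m) (Localization.Away g) a) =
      algebraMap (Laurent N m) (Localization.Away g) (Laurent.delta j a) :=
  extendAway_algebraMap g _ a

/-- Derivations of `A[1/g]` commute if they commute on `A`. -/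
theorem comm_away {D₁ D₂ : Derivation ℂ (Localization.Away g) (Localization.Away g)}
    (h : ∀ a, D₁ (D₂ (algebraMap (Laurent N m) (Localization.Away g) a)) =
      D₂ (D₁ (algebraMap (Laurent N m) (Localization.Away g) a))) (c : Localization.Away g) :
    D₁ (D₂ c) = D₂ (D₁ c) := by
  have h0 : ⁅D₁, D₂⁆ = 0 := derivation_ext_away g fun a => by
    rw [Derivation.commutator_apply, h, sub_self, Derivation.zero_apply]
  have := congrArg (fun D => D c) h0
  simpa [Derivation.commutator_apply, sub_eq_zero] using this

theorem awayTheta_comm (i k : Fin m) (c : Localization.Away g) :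
    awayTheta g i (awayTheta g k c) = awayTheta g k (awayTheta g i c) :=
  comm_away g (fun a => by simp only [awayTheta_algebraMap, Laurent.theta_comm i k]) c

theorem awayDelta_theta (j : Fin N) (i : Fin m) (c : Localization.Away g) :
    awayDelta g j (awayTheta g i c) = awayTheta g i (awayDelta g j c) :=
  comm_away g (fun a => by
    simp only [awayTheta_algebraMap, awayDelta_algebraMap, Laurent.delta_theta]) c

theorem awayDelta_comm (j l : Fin N) (c : Localization.Away g) :
    awayDelta g j (awayDelta g l c) = awayDelta g l (awayDelta g j c) :=
  comm_away g (fun a => by simp only [awayDelta_algebraMap, Laurent.delta_comm j l]) c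

/-- The function `1/g` on the open set `g ≠ 0`. -/
def awayInv : Localization.Away g := IsLocalization.Away.invSelf g

/-- The function `g` on the open set `g ≠ 0`. -/
def awaySelf : Localization.Away g := algebraMap (Laurent N m) (Localization.Away g) g

theorem awayInv_mul_awaySelf : awayInv g * awaySelf g = 1 := by
  rw [mul_comm]; exact IsLocalization.Away.mul_invSelf g

/-- Logarithmic derivatives of `g` with respect to commuting derivations are compatible. -/
theorem away_log_deriv (D₁ D₂ : Derivation ℂ (Localization.Away g) (Localization.Away g))
    (h : ∀ c, D₁ (D₂ c) = D₂ (D₁ c)) (c : ℂ) :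
    D₁ (c • (awayInv g * D₂ (awaySelf g))) = D₂ (c • (awayInv g * D₁ (awaySelf g))) := by
  simp only [Derivation.map_smul, Derivation.leibniz, smul_eq_mul,
    Derivation.leibniz_of_mul_eq_one _ (awayInv_mul_awaySelf g), h]
  congr 1
  ring

theorem awayFrame_coord_eta (α : Fin (m + 1) → ℂ) (i : Fin m) :
    (awayFrame g).coord i (∑ i : Fin m, α i.castSucc • awayDlog g i - α (Fin.last m) •
      (awayInv g • KaehlerDifferential.D (LambdaRing N) (Localization.Away g) (awaySelf g))) =
      algebraMap ℂ (Localization.Away g) (α i.castSucc) -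
        α (Fin.last m) • (awayInv g * awayTheta g i (awaySelf g)) := by
  have h (k : Fin m) : (awayFrame g).coord i (α k.castSucc • awayDlog g k) =
      if k = i then algebraMap ℂ (Localization.Away g) (α k.castSucc) else 0 := by
    rw [← algebraMap_smul (Localization.Away g) (α k.castSucc) (awayDlog g k), map_smul,
      ← awayFrame_apply, Module.Basis.coord_apply, Module.Basis.repr_self, Finsupp.single_apply,
      smul_eq_mul, mul_ite, mul_one, mul_zero]
  rw [map_sub, map_sum]
  simp only [h, Finset.sum_ite_eq', Finset.mem_univ, if_true]
  rw [← algebraMap_smul (Localization.Away g) (α (Fin.last m)), map_smul, map_smul,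
    awayTheta_apply, smul_eq_mul, smul_eq_mul, Algebra.smul_def]

/-- The twisted relative de Rham complex of the open set `U` of the `m`-torus over `ℂ[λ]` where `g`
does not vanish, with `∇ ω = dω + ∑_{i ≤ m} α_i dx_i/x_i ∧ ω - α_{m+1} dg/g ∧ ω`; here `∂_j` acts
by `∂_j - α_{m+1} g^{∂_j}/g`, where `g^{∂_j}` is obtained from `g` by applying `∂_j` to the
coefficients. -/
def complementData (α : Fin (m + 1) → ℂ) : TwistedData N where
  B := Localization.Away g
  rk := m
  frame := awayFrame g
  delta := awayDelta g
  delta_coeff j s := by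
    rw [IsScalarTower.algebraMap_apply (LambdaRing N) (Laurent N m) (Localization.Away g),
      IsScalarTower.algebraMap_apply (LambdaRing N) (Laurent N m) (Localization.Away g),
      awayDelta_algebraMap, Laurent.delta_coeff]
  eta := ∑ i : Fin m, α i.castSucc • awayDlog g i - α (Fin.last m) •
    (awayInv g • KaehlerDifferential.D (LambdaRing N) (Localization.Away g) (awaySelf g))
  pot j := -(α (Fin.last m) • (awayInv g * awayDelta g j (awaySelf g)))
  theta_comm i k c := awayTheta_comm g i k c
  delta_theta j i c := awayDelta_theta g j i c
  delta_comm j l c := awayDelta_comm g j l c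
  theta_eta i k := by
    rw [awayFrame_coord_eta, awayFrame_coord_eta, ← awayTheta_apply, ← awayTheta_apply, map_sub,
      map_sub, Derivation.map_algebraMap, Derivation.map_algebraMap,
      away_log_deriv g _ _ (awayTheta_comm g i k)]
  delta_eta j i := by
    rw [awayFrame_coord_eta, ← awayTheta_apply, map_sub, Derivation.map_algebraMap, map_neg,
      zero_sub, away_log_deriv g _ _ (awayDelta_theta g j i)]
  delta_pot j l := by
    rw [map_neg, map_neg, away_log_deriv g _ _ (awayDelta_comm g j l)]

end Complement

/-! ### `A`-hypergeometric data -/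

/-- The Laurent polynomial `f = ∑_j λ_j x^{a^{(j)}}`. -/
def genericLaurent {N n : ℕ} (A : Fin N → Fin n → ℤ) : Laurent N n :=
  ∑ j, Laurent.single (A j) (MvPolynomial.X j)

/-- The inclusion `ℂ[λ][x₁^{±1}, …, x_m^{±1}] → ℂ[λ][x₁^{±1}, …, x_{m+1}^{±1}]`. -/
def Laurent.incl {N m : ℕ} : Laurent N m →ₐ[LambdaRing N] Laurent N (m + 1) :=
  AddMonoidAlgebra.mapDomainAlgHom (LambdaRing N) (LambdaRing N)
    (AddMonoidHom.mk' (fun u : Fin m → ℤ => (Fin.snoc u 0 : Fin (m + 1) → ℤ)) fun u v => by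
      funext i
      refine Fin.lastCases ?_ (fun i => ?_) i <;> simp)

/-- The real cone `C(A) ⊆ ℝⁿ` generated by `A`. -/
def realCone {N n : ℕ} (A : Fin N → Fin n → ℤ) : PointedCone ℝ (Fin n → ℝ) :=
  PointedCone.hull ℝ (Set.range fun j i => (A j i : ℝ))

/-- `c` is the coefficient vector of a normalized linear form `ℓ` defining a codimension-one face of
`C(A)`: the coefficients are relatively prime, `ℓ ≥ 0` on `C(A)`, and the face `{ℓ = 0}` of `C(A)`
spans a space of dimension `n - 1`. -/
def IsFacetForm {N n : ℕ} (A : Fin N → Fin n → ℤ) (c : Fin n → ℤ) : Prop :=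
  Finset.univ.gcd c = 1 ∧
  (∀ u ∈ realCone A, 0 ≤ ∑ i, (c i : ℝ) * u i) ∧
  Module.finrank ℝ (Submodule.span ℝ {u | u ∈ realCone A ∧ ∑ i, (c i : ℝ) * u i = 0}) + 1 = n

/-- `α` is nonresonant for `A`: `ℓ(α) ∉ ℤ` for each normalized linear form `ℓ` defining a
codimension-one face of `C(A)`. -/
def IsNonresonant {N n : ℕ} (A : Fin N → Fin n → ℤ) (α : Fin n → ℂ) : Prop :=
  ∀ c, IsFacetForm A c → ∀ z : ℤ, ∑ i, (c i : ℂ) * α i ≠ z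

end

/-! Both complexes are Koszul complexes of commuting additive operators. On the torus these are `T_i
= θ_i + α_i + θ_i(f)` with `θ_i = x_i ∂/∂x_i`. On `U` they are `θ_i + α_i - α_n θ_i(g)/g` for `i <
n`. Since `f = x_n g`, every `T_i` has the form `θ_i + α_i + x_n h_i` with `h_i` free of `x_n`. It
is a diagonal operator plus one that raises the degree in `x_n` by one.

Nonresonance enters only through one non-integral coordinate. All exponents have last coordinate 1,
so `u_n` is a nonzero form that is nonnegative on `C(A)`. Tilting it until its zero set spans a
hyperplane gives a facet form `c`. If every `α_i` were an integer, then `c · α` would be one too, so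
some `α_{i₀}` is not an integer (`exists_isFacetForm`, `exists_not_int_of_isNonresonant`).

For any `K`, the operator `T_{i₀}` is bijective modulo Laurent polynomials of degree at least `K` in
`x_n`: its diagonal part `u_{i₀} + α_{i₀}` never vanishes, and the rest is nilpotent on each element
of the quotient. A Koszul complex with a bijective operator is acyclic (`koszul_exact_mod`), so the
subcomplex of forms of degree at least `K` computes the cohomology of the torus complex.

Take `K` so large that `k + α_n ≠ 0` for all `k ≥ K`. In degrees at least `K`, the operator `T_n =
θ_n + α_n + x_n g` is injective, because it acts on the lowest term by a nonzero scalar. In its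
cokernel `(k + α_n) x_n^k η = -x_n^{k+1} g η`. Hence `x_n^k η ↦ c_k η/g^k`, with `c_{k+1} = -(k +
α_n) c_k`, identifies the cokernel with the functions on `U` (`powerMap`, `isCokernelOfLast`). The
other `T_i` and the `∂_j` induce there exactly the twisted operators on `U`. A Koszul complex with
one injective operator is the Koszul complex of the remaining operators on the cokernel, shifted by
one. The residue, which contracts with the last basis vector and then applies `powerMap`, realizes
this shift.

The residue is `𝓓`-linear on forms of high degree. The isomorphism is read off from a roof: the
closed high forms map onto both cohomology modules with the same kernel (`nonempty_H_equiv`). -/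

noncomputable section

/-! ### Contraction of exterior powers with a coordinate form. -/

section Contraction

variable {B M : Type} [CommRing B] [AddCommGroup M] [Module B M]

theorem contractLeft_mem_exteriorPower (d : Module.Dual B M) (k : ℕ) (x : ExteriorAlgebra B M)
    (hx : x ∈ ⋀[B]^(k + 1) M) :
    CliffordAlgebra.contractLeft (Q := (0 : QuadraticForm B M)) d x ∈ ⋀[B]^k M := by
  induction k generalizing x with
  | zero =>
    rw [ExteriorAlgebra.exteriorPower, zero_add, pow_one] at hx
    obtain ⟨v, rfl⟩ := hx
    rw [CliffordAlgebra.contractLeft_ι, ExteriorAlgebra.exteriorPower, pow_zero]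
    exact Submodule.algebraMap_mem _
  | succ k ih =>
    rw [ExteriorAlgebra.exteriorPower, pow_succ'] at hx
    induction hx using Submodule.mul_induction_on' with
    | add x _ y _ hx hy => rw [map_add]; exact Submodule.add_mem _ hx hy
    | mem_mul_mem a ha y hy =>
      obtain ⟨v, rfl⟩ := ha
      rw [CliffordAlgebra.contractLeft_ι_mul]
      refine Submodule.sub_mem _ (Submodule.smul_mem _ _ hy) ?_
      rw [ExteriorAlgebra.exteriorPower, pow_succ']
      exact Submodule.mul_mem_mul (LinearMap.mem_range_self _ _) (ih y hy)

/-- Contraction of exterior powers with a linear form. -/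
def contr (d : Module.Dual B M) (k : ℕ) : ⋀[B]^(k + 1) M →ₗ[B] ⋀[B]^k M :=
  (CliffordAlgebra.contractLeft (Q := (0 : QuadraticForm B M)) d).restrict
    (contractLeft_mem_exteriorPower d k)

theorem coe_contr (d : Module.Dual B M) (k : ℕ) (x : ⋀[B]^(k + 1) M) :
    (contr d k x : ExteriorAlgebra B M) =
      CliffordAlgebra.contractLeft (Q := (0 : QuadraticForm B M)) d x := rfl

theorem contr_wedge_zero (d : Module.Dual B M) (v : M) (x : ⋀[B]^0 M) :
    contr d 0 (wedge 0 v x) = d v • x := by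
  obtain ⟨x, hx⟩ := x
  ext
  rw [coe_contr, coe_wedge]
  refine (CliffordAlgebra.contractLeft_ι_mul (Q := (0 : QuadraticForm B M)) d v _).trans ?_
  rw [ExteriorAlgebra.exteriorPower, pow_zero, Submodule.mem_one] at hx
  obtain ⟨r, rfl⟩ := hx
  rw [CliffordAlgebra.contractLeft_algebraMap, mul_zero, sub_zero]
  rfl

theorem contr_wedge (d : Module.Dual B M) (k : ℕ) (v : M) (x : ⋀[B]^(k + 1) M) :
    contr d (k + 1) (wedge (k + 1) v x) = d v • x - wedge k v (contr d k x) := by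
  ext
  exact CliffordAlgebra.contractLeft_ι_mul (Q := (0 : QuadraticForm B M)) d v _

theorem contr_contr (d : Module.Dual B M) (k : ℕ) (x : ⋀[B]^(k + 1 + 1) M) :
    contr d k (contr d (k + 1) x) = 0 := by
  ext
  exact CliffordAlgebra.contractLeft_contractLeft (Q := (0 : QuadraticForm B M)) d _

variable {n : ℕ} (b : Module.Basis (Fin n) B M)

/-- Forms of positive degree are sums of products with basis vectors. -/
theorem exteriorPower_succ_induction (k : ℕ) {P : ⋀[B]^(k + 1) M → Prop}
    (hadd : ∀ x y, P x → P y → P (x + y)) (hwedge : ∀ i x, P (wedge k (b i) x))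
    (x : ⋀[B]^(k + 1) M) (h0 : P 0) : P x := by
  rw [← (b.exteriorPower (k + 1)).sum_repr x]
  refine Finset.sum_induction _ P hadd h0 fun I _ => ?_
  have : b.exteriorPower (k + 1) I = wedge k (b (Set.powersetCard.ofFinEmbEquiv.symm I 0))
      (exteriorPower.ιMulti B k fun j => b (Set.powersetCard.ofFinEmbEquiv.symm I j.succ)) := by
    rw [wedge_ιMulti, exteriorPower.basis_apply, exteriorPower.ιMulti_family]
    congr 1
    funext j
    refine Fin.cases ?_ (fun j => ?_) j <;> rfl
  rw [this, ← map_smul]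
  exact hwedge _ _

theorem coeffMap_zero (k : ℕ) (φ : B →+ B) : coeffMap b k φ 0 = 0 := by
  simp [coeffMap]

theorem coeffMap_neg (k : ℕ) (φ : B →+ B) (x : ⋀[B]^k M) :
    coeffMap b k φ (-x) = -coeffMap b k φ x :=
  (AddMonoidHom.mk' (coeffMap b k φ) (coeffMap_add b k φ)).map_neg x

theorem coeffMap_sub (k : ℕ) (φ : B →+ B) (x y : ⋀[B]^k M) :
    coeffMap b k φ (x - y) = coeffMap b k φ x - coeffMap b k φ y :=
  (AddMonoidHom.mk' (coeffMap b k φ) (coeffMap_add b k φ)).map_sub x y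

theorem coeffMap_sum {ι : Type*} (s : Finset ι) (k : ℕ) (φ : B →+ B) (x : ι → ⋀[B]^k M) :
    coeffMap b k φ (∑ i ∈ s, x i) = ∑ i ∈ s, coeffMap b k φ (x i) :=
  map_sum (AddMonoidHom.mk' (coeffMap b k φ) (coeffMap_add b k φ)) x s

theorem coeffMap_eq_zero_iff (k : ℕ) (φ : B → B) (x : ⋀[B]^k M) :
    coeffMap b k φ x = 0 ↔ ∀ I, φ ((b.exteriorPower k).repr x I) = 0 := by
  refine ⟨fun h I => ?_, fun h => ?_⟩
  · rw [← repr_coeffMap b k φ x I, h, map_zero, Finsupp.zero_apply]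
  · refine (b.exteriorPower k).ext_elem fun I => ?_
    rw [repr_coeffMap, h, map_zero, Finsupp.zero_apply]

/-- Contraction with a coordinate form has entries `0, ±1` in the standard bases, so it commutes
with coefficientwise operators that are merely additive. -/
theorem coeffMap_contr (i : Fin n) (k : ℕ) (φ : B →+ B) (x : ⋀[B]^(k + 1) M) :
    coeffMap b k φ (contr (b.coord i) k x) =
      contr (b.coord i) k (coeffMap b (k + 1) φ x) := by
  have hc (j : Fin n) : b.coord i (b j) = if j = i then 1 else 0 := by
    rw [Module.Basis.coord_apply, Module.Basis.repr_self, Finsupp.single_apply]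
  induction k with
  | zero =>
    induction x using exteriorPower_succ_induction b with
    | hadd x y hx hy => simp only [map_add, coeffMap_add, hx, hy]
    | h0 => simp only [map_zero, coeffMap_zero]
    | hwedge j x =>
      rw [coeffMap_wedge_basis, contr_wedge_zero, contr_wedge_zero, hc]
      split_ifs <;> simp only [one_smul, zero_smul, coeffMap_zero]
  | succ k ih =>
    induction x using exteriorPower_succ_induction b with
    | hadd x y hx hy => simp only [map_add, coeffMap_add, hx, hy]
    | h0 => simp only [map_zero, coeffMap_zero]
    | hwedge j x =>
      rw [coeffMap_wedge_basis, contr_wedge, contr_wedge, hc, coeffMap_sub, coeffMap_wedge_basis,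
        ih]
      split_ifs <;> simp only [one_smul, zero_smul, coeffMap_zero]

/-- The projection of a form to its part which does not involve `b i`. -/
def avoidPart (i : Fin n) (k : ℕ) : ⋀[B]^k M →ₗ[B] ⋀[B]^k M :=
  contr (b.coord i) k ∘ₗ wedge k (b i)

theorem avoidPart_apply (i : Fin n) (k : ℕ) (x : ⋀[B]^k M) :
    avoidPart b i k x = contr (b.coord i) k (wedge k (b i) x) := rfl

theorem coord_self (i : Fin n) : b.coord i (b i) = 1 := by
  rw [Module.Basis.coord_apply, Module.Basis.repr_self, Finsupp.single_eq_same]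

theorem avoidPart_zero (i : Fin n) (x : ⋀[B]^0 M) : avoidPart b i 0 x = x := by
  rw [avoidPart_apply, contr_wedge_zero, coord_self, one_smul]

theorem avoidPart_succ (i : Fin n) (k : ℕ) (x : ⋀[B]^(k + 1) M) :
    avoidPart b i (k + 1) x = x - wedge k (b i) (contr (b.coord i) k x) := by
  rw [avoidPart_apply, contr_wedge, coord_self, one_smul]

theorem contr_avoidPart (i : Fin n) (k : ℕ) (x : ⋀[B]^(k + 1) M) :
    contr (b.coord i) k (avoidPart b i (k + 1) x) = 0 := contr_contr _ _ _

theorem avoidPart_contr (i : Fin n) (k : ℕ) (x : ⋀[B]^(k + 1) M) :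
    avoidPart b i k (contr (b.coord i) k x) = contr (b.coord i) k x := by
  cases k with
  | zero => exact avoidPart_zero b i _
  | succ k => rw [avoidPart_succ, contr_contr, map_zero, sub_zero]

theorem avoidPart_avoidPart (i : Fin n) (k : ℕ) (x : ⋀[B]^k M) :
    avoidPart b i k (avoidPart b i k x) = avoidPart b i k x := avoidPart_contr b i k _

theorem coeffMap_avoidPart (i : Fin n) (k : ℕ) (φ : B →+ B) (x : ⋀[B]^k M) :
    coeffMap b k φ (avoidPart b i k x) = avoidPart b i k (coeffMap b k φ x) := by
  rw [avoidPart_apply, coeffMap_contr, coeffMap_wedge_basis, avoidPart_apply]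

theorem wedge_exteriorPower_basis_of_mem (i : Fin n) (k : ℕ) (I : Set.powersetCard (Fin n) k)
    (hi : i ∈ I.1) : wedge k (b i) (b.exteriorPower k I) = 0 := by
  obtain ⟨j, hj⟩ := (Set.powersetCard.mem_range_ofFinEmbEquiv_symm_iff_mem I i).mpr hi
  rw [exteriorPower.basis_apply, exteriorPower.ιMulti_family, wedge_ιMulti]
  refine AlternatingMap.map_eq_zero_of_eq _ _ (i := 0) (j := j.succ) ?_ (Fin.succ_ne_zero j).symm
  rw [Fin.cons_zero, Fin.cons_succ, Function.comp_apply, ← hj]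

end Contraction

/-! ### Koszul complexes of additive operators, and acyclicity modulo a subgroup. -/

section Koszul

variable {B M : Type} [CommRing B] [AddCommGroup M] [Module B M] {n : ℕ}
  (b : Module.Basis (Fin n) B M) (T : Fin n → B →+ B)

/-- The differential of the Koszul complex of commuting additive operators `T₁, …, T_n` on `B`,
realized on the exterior powers of a free `B`-module. -/
def koszul (k : ℕ) (x : ⋀[B]^k M) : ⋀[B]^(k + 1) M :=
  ∑ i, wedge k (b i) (coeffMap b k (T i) x)

theorem koszul_add (k : ℕ) (x y : ⋀[B]^k M) :
    koszul b T k (x + y) = koszul b T k x + koszul b T k y := by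
  simp only [koszul, coeffMap_add, map_add, Finset.sum_add_distrib]

theorem koszul_sub (k : ℕ) (x y : ⋀[B]^k M) :
    koszul b T k (x - y) = koszul b T k x - koszul b T k y :=
  (AddMonoidHom.mk' (koszul b T k) (koszul_add b T k)).map_sub x y

theorem koszul_neg (k : ℕ) (x : ⋀[B]^k M) : koszul b T k (-x) = -koszul b T k x :=
  (AddMonoidHom.mk' (koszul b T k) (koszul_add b T k)).map_neg x

theorem koszul_zero (k : ℕ) : koszul b T k 0 = 0 :=
  (AddMonoidHom.mk' (koszul b T k) (koszul_add b T k)).map_zero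

theorem contr_koszul_zero (i : Fin n) (x : ⋀[B]^0 M) :
    contr (b.coord i) 0 (koszul b T 0 x) = coeffMap b 0 (T i) x := by
  simp only [koszul, map_sum, contr_wedge_zero, Module.Basis.coord_apply, Module.Basis.repr_self,
    Finsupp.single_apply, ite_smul, one_smul, zero_smul, Finset.sum_ite_eq', Finset.mem_univ,
    if_true]

/-- Cartan's formula: contraction is a homotopy between `T_i` and zero. All exactness arguments
below rest on it. -/
theorem contr_koszul (i : Fin n) (k : ℕ) (x : ⋀[B]^(k + 1) M) :
    contr (b.coord i) (k + 1) (koszul b T (k + 1) x) =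
      coeffMap b (k + 1) (T i) x - koszul b T k (contr (b.coord i) k x) := by
  simp only [koszul, map_sum, contr_wedge, Module.Basis.coord_apply, Module.Basis.repr_self,
    Finsupp.single_apply, ite_smul, one_smul, zero_smul, Finset.sum_ite_eq', Finset.mem_univ,
    if_true, Finset.sum_sub_distrib, coeffMap_contr]

/-- On a form without `b i` the contraction vanishes, so only the `T_i` term of Cartan's formula
survives. -/
theorem contr_koszul_avoidPart (i : Fin n) (k : ℕ) (x : ⋀[B]^k M) :
    contr (b.coord i) k (koszul b T k (avoidPart b i k x)) =
      coeffMap b k (T i) (avoidPart b i k x) := by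
  cases k with
  | zero => rw [contr_koszul_zero]
  | succ k => rw [contr_koszul, contr_avoidPart, koszul_zero, sub_zero]

variable {T} {q : B →+ B}

theorem coeffMap_coeffMap_eq_zero {k : ℕ} {φ : B →+ B} (h : ∀ c, q c = 0 → q (φ c) = 0)
    {x : ⋀[B]^k M} (hx : coeffMap b k q x = 0) : coeffMap b k q (coeffMap b k φ x) = 0 := by
  rw [coeffMap_eq_zero_iff] at hx ⊢
  intro I
  rw [repr_coeffMap]
  exact h _ (hx I)

theorem coeffMap_koszul_eq_zero (hT : ∀ i c, q c = 0 → q (T i c) = 0) {k : ℕ} {x : ⋀[B]^k M}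
    (hx : coeffMap b k q x = 0) : coeffMap b (k + 1) q (koszul b T k x) = 0 := by
  rw [koszul, coeffMap_sum]
  refine Finset.sum_eq_zero fun i _ => ?_
  rw [coeffMap_wedge_basis, coeffMap_coeffMap_eq_zero b (hT i) hx, map_zero]

/-- If one of the operators is injective modulo `ker q`, the Koszul complex modulo `ker q` has no
cohomology in degree zero. -/
theorem koszul_zero_mod (i : Fin n) (hinj : ∀ c, q (T i c) = 0 → q c = 0) (x : ⋀[B]^0 M)
    (hx : coeffMap b 1 q (koszul b T 0 x) = 0) : coeffMap b 0 q x = 0 := by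
  have h := coeffMap_contr b i 0 q (koszul b T 0 x)
  rw [hx, map_zero, contr_koszul_zero, coeffMap_eq_zero_iff] at h
  rw [coeffMap_eq_zero_iff]
  intro I
  have := h I
  rw [repr_coeffMap] at this
  exact hinj _ this

/-- If one of the operators is bijective modulo `ker q`, the Koszul complex modulo `ker q` is
acyclic. -/
theorem koszul_exact_mod (i : Fin n) (hT : ∀ i c, q c = 0 → q (T i c) = 0)
    (hTT : ∀ k x, koszul b T (k + 1) (koszul b T k x) = 0)
    (hinj : ∀ c, q (T i c) = 0 → q c = 0) (hsurj : ∀ c, ∃ c', q (T i c' - c) = 0) (k : ℕ)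
    (x : ⋀[B]^(k + 1) M) (hx : coeffMap b (k + 2) q (koszul b T (k + 1) x) = 0) :
    ∃ y, coeffMap b (k + 1) q (x - koszul b T k y) = 0 := by
  choose s hs using hsurj
  -- The section `s` is just a function, not additive; `coeffMap` accepts it because only its values
  -- on coefficients matter.
  let y₀ := coeffMap b k s (contr (b.coord i) k x)
  have hy₀ : coeffMap b k q (coeffMap b k (T i) y₀ - contr (b.coord i) k x) = 0 := by
    rw [coeffMap_eq_zero_iff]
    intro I
    rw [map_sub, Finsupp.sub_apply, repr_coeffMap, repr_coeffMap]
    exact hs _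
  -- Removing the terms with `b i` makes the contraction of the differential equal to `T_i` of the
  -- form. Subtracting this differential from `x` therefore kills the contraction of `x` modulo `ker
  -- q`.
  refine ⟨avoidPart b i k y₀, ?_⟩
  set z := x - koszul b T k (avoidPart b i k y₀) with hz
  have h1 : coeffMap b k q (contr (b.coord i) k z) = 0 := by
    rw [hz, map_sub, contr_koszul_avoidPart, coeffMap_avoidPart, ← avoidPart_contr, ← map_sub,
      coeffMap_avoidPart, ← neg_sub, coeffMap_neg, hy₀, neg_zero, map_zero]
  have h2 : koszul b T (k + 1) z = koszul b T (k + 1) x := by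
    rw [hz, koszul_sub, hTT, sub_zero]
  -- By Cartan's formula `T_i z` is now zero modulo `ker q`, and injectivity of `T_i` finishes.
  have h3 := coeffMap_contr b i (k + 1) q (koszul b T (k + 1) z)
  rw [h2, hx, map_zero, ← h2, contr_koszul, coeffMap_sub, coeffMap_koszul_eq_zero b hT h1,
    sub_zero, coeffMap_eq_zero_iff] at h3
  rw [coeffMap_eq_zero_iff]
  intro I
  have := h3 I
  rw [repr_coeffMap] at this
  exact hinj _ this

end Koszul

/-! ### Passing to the cokernel of the last operator: restriction of forms and residue. -/

section Restrict

variable {B M B' M' : Type} [CommRing B] [AddCommGroup M] [Module B M] [CommRing B']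
  [AddCommGroup M'] [Module B' M'] {m : ℕ} (b : Module.Basis (Fin (m + 1)) B M)
  (b' : Module.Basis (Fin m) B' M')

/-- A subset of `Fin m` considered as a subset of `Fin (m + 1)`. -/
def powersetCardCastSucc {k : ℕ} (J : Set.powersetCard (Fin m) k) :
    Set.powersetCard (Fin (m + 1)) k :=
  ⟨J.1.map Fin.castSuccEmb, (Finset.card_map _).trans J.2⟩

theorem last_notMem_powersetCardCastSucc {k : ℕ} (J : Set.powersetCard (Fin m) k) :
    Fin.last m ∉ (powersetCardCastSucc J).1 := by
  intro h
  obtain ⟨j, -, hj⟩ := Finset.mem_map.mp h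
  exact (Fin.castSucc_lt_last j).ne hj

theorem powersetCardCastSucc_injective {k : ℕ} :
    Function.Injective (powersetCardCastSucc (m := m) (k := k)) := fun _ _ h =>
  Subtype.ext (Finset.map_injective _ (congrArg Subtype.val h))

theorem exists_powersetCardCastSucc {k : ℕ} (I : Set.powersetCard (Fin (m + 1)) k)
    (hI : Fin.last m ∉ I.1) : ∃ J, powersetCardCastSucc J = I := by
  have h : (I.1.preimage Fin.castSucc (Fin.castSucc_injective m).injOn).map Fin.castSuccEmb =
      I.1 := by
    ext i
    simp only [Finset.mem_map, Finset.mem_preimage]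
    refine ⟨?_, fun hi => ?_⟩
    · rintro ⟨j, hj, rfl⟩
      exact hj
    · have hne : i ≠ Fin.last m := fun h => hI (h ▸ hi)
      exact ⟨i.castPred hne, by simpa using hi, by simp⟩
  exact ⟨⟨_, (Finset.card_map Fin.castSuccEmb).symm.trans ((congrArg _ h).trans I.2)⟩,
    Subtype.ext h⟩

theorem powersetCardCastSucc_symm {k : ℕ} (J : Set.powersetCard (Fin m) k) :
    (Set.powersetCard.ofFinEmbEquiv.symm (powersetCardCastSucc J) : Fin k → Fin (m + 1)) =
      Fin.castSucc ∘ Set.powersetCard.ofFinEmbEquiv.symm J := by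
  rw [Set.powersetCard.ofFinEmbEquiv_symm_apply, Set.powersetCard.ofFinEmbEquiv_symm_apply]
  refine (Finset.orderEmbOfFin_unique _ (fun x => ?_) ?_).symm
  · exact Finset.mem_map_of_mem Fin.castSuccEmb (Finset.orderEmbOfFin_mem _ _ x)
  · exact (Fin.strictMono_castSucc).comp (OrderEmbedding.strictMono _)

/-- The additive map of forms which applies `φ` to the coefficients and kills the last basis
vector. -/
def restrictForm (φ : B →+ B') (k : ℕ) : ⋀[B]^k M →+ ⋀[B']^k M' :=
  AddMonoidHom.mk' (fun x => ∑ J, φ ((b.exteriorPower k).repr x (powersetCardCastSucc J)) •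
    b'.exteriorPower k J) fun x y => by
      simp only [map_add, Finsupp.add_apply, add_smul, Finset.sum_add_distrib]

theorem repr_restrictForm (φ : B →+ B') (k : ℕ) (x : ⋀[B]^k M) (J) :
    (b'.exteriorPower k).repr (restrictForm b b' φ k x) J =
      φ ((b.exteriorPower k).repr x (powersetCardCastSucc J)) := by
  change (b'.exteriorPower k).repr (∑ J, φ ((b.exteriorPower k).repr x (powersetCardCastSucc J)) •
    b'.exteriorPower k J) J = _
  rw [Module.Basis.repr_sum_self]

theorem restrictForm_basis_castSucc (φ : B →+ B') (k : ℕ) (c : B) (J) :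
    restrictForm b b' φ k (c • b.exteriorPower k (powersetCardCastSucc J)) =
      φ c • b'.exteriorPower k J := by
  refine (b'.exteriorPower k).ext_elem fun J' => ?_
  rw [repr_restrictForm, map_smul, map_smul, Module.Basis.repr_self, Module.Basis.repr_self,
    Finsupp.smul_apply, Finsupp.smul_apply, Finsupp.single_apply, Finsupp.single_apply]
  by_cases h : J = J'
  · simp [h]
  · rw [if_neg (powersetCardCastSucc_injective.ne h), if_neg h]
    simp

theorem restrictForm_basis_of_mem (φ : B →+ B') (k : ℕ) (c : B) (I) (hI : Fin.last m ∈ I.1) :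
    restrictForm b b' φ k (c • b.exteriorPower k I) = 0 := by
  refine (b'.exteriorPower k).ext_elem fun J => ?_
  rw [repr_restrictForm, map_smul, Module.Basis.repr_self, Finsupp.smul_apply,
    Finsupp.single_apply, if_neg, smul_zero, map_zero, map_zero, Finsupp.zero_apply]
  rintro rfl
  exact last_notMem_powersetCardCastSucc J hI

/-- Wedging `b_j` with a basis form gives indices out of increasing order. Sorting costs only a
sign, which every additive coefficient map respects. -/
theorem exists_eq_ofFinEmbEquiv_symm_comp_perm {n k : ℕ} (v : Fin k → Fin n)
    (hv : Function.Injective v) : ∃ (I : Set.powersetCard (Fin n) k) (σ : Equiv.Perm (Fin k)),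
      v = Set.powersetCard.ofFinEmbEquiv.symm I ∘ σ := by
  have hcard : (Finset.image v Finset.univ).card = k :=
    (Finset.card_image_of_injective _ hv).trans (Finset.card_fin k)
  let σ : Equiv.Perm (Fin k) := (Equiv.ofInjective v hv).trans
    ((Equiv.setCongr Fintype.coe_image_univ.symm).trans
      (Finset.orderIsoOfFin _ hcard).symm.toEquiv)
  have hσ (i : Fin k) : v i = Finset.orderEmbOfFin _ hcard (σ i) := by
    rw [← Finset.coe_orderIsoOfFin_apply]
    exact (congrArg Subtype.val ((Finset.orderIsoOfFin _ hcard).apply_symm_apply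
      ⟨v i, Finset.mem_image_of_mem v (Finset.mem_univ i)⟩)).symm
  exact ⟨⟨Finset.image v Finset.univ, hcard⟩, σ, funext hσ⟩

theorem ιMulti_comp_perm {A V : Type} [CommRing A] [AddCommGroup V] [Module A V] {n k : ℕ}
    (a : Module.Basis (Fin n) A V) (I : Set.powersetCard (Fin n) k) (σ : Equiv.Perm (Fin k)) :
    exteriorPower.ιMulti A k (a ∘ Set.powersetCard.ofFinEmbEquiv.symm I ∘ σ) =
      Equiv.Perm.sign σ • a.exteriorPower k I := by
  rw [exteriorPower.basis_apply, exteriorPower.ιMulti_family, ← AlternatingMap.map_perm]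
  rfl

theorem restrictForm_ιMulti_castSucc (φ : B →+ B') (k : ℕ) (c : B) (w : Fin k → Fin m) :
    restrictForm b b' φ k (c • exteriorPower.ιMulti B k (b ∘ Fin.castSucc ∘ w)) =
      φ c • exteriorPower.ιMulti B' k (b' ∘ w) := by
  by_cases hw : Function.Injective w
  · obtain ⟨J, σ, rfl⟩ := exists_eq_ofFinEmbEquiv_symm_comp_perm w hw
    have h : b ∘ Fin.castSucc ∘ Set.powersetCard.ofFinEmbEquiv.symm J ∘ σ =
        b ∘ Set.powersetCard.ofFinEmbEquiv.symm (powersetCardCastSucc J) ∘ σ := by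
      rw [powersetCardCastSucc_symm]
      rfl
    rw [h, ιMulti_comp_perm, ιMulti_comp_perm, smul_comm, smul_comm (φ c),
      ← restrictForm_basis_castSucc b b']
    rcases Int.units_eq_one_or (Equiv.Perm.sign σ) with h | h <;> rw [h]
    · rw [one_smul, one_smul]
    · rw [Units.neg_smul, Units.neg_smul, one_smul, one_smul, map_neg]
  · rw [AlternatingMap.map_eq_zero_of_not_injective, AlternatingMap.map_eq_zero_of_not_injective,
      smul_zero, smul_zero, map_zero]
    · exact fun h => hw (.of_comp h)
    · exact fun h => hw (.of_comp (f := b ∘ Fin.castSucc) h)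

theorem restrictForm_ιMulti_of_mem (φ : B →+ B') (k : ℕ) (c : B) (v : Fin k → Fin (m + 1))
    (hv : Fin.last m ∈ Set.range v) :
    restrictForm b b' φ k (c • exteriorPower.ιMulti B k (b ∘ v)) = 0 := by
  by_cases hv' : Function.Injective v
  · obtain ⟨I, σ, rfl⟩ := exists_eq_ofFinEmbEquiv_symm_comp_perm v hv'
    have hI : Fin.last m ∈ I.1 := by
      obtain ⟨i, hi⟩ := hv
      exact (Set.powersetCard.mem_range_ofFinEmbEquiv_symm_iff_mem I _).mp ⟨_, hi⟩
    have h := restrictForm_basis_of_mem b b' φ k c I hI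
    rw [ιMulti_comp_perm, smul_comm]
    rcases Int.units_eq_one_or (Equiv.Perm.sign σ) with h' | h' <;> rw [h']
    · rw [one_smul, h]
    · rw [Units.neg_smul, one_smul, map_neg, h, neg_zero]
  · rw [AlternatingMap.map_eq_zero_of_not_injective, smul_zero, map_zero]
    exact fun h => hv' (.of_comp h)

theorem wedge_exteriorPower_basis {A V : Type} [CommRing A] [AddCommGroup V] [Module A V] {n k : ℕ}
    (a : Module.Basis (Fin n) A V) (j : Fin n) (I : Set.powersetCard (Fin n) k) :
    wedge k (a j) (a.exteriorPower k I) = exteriorPower.ιMulti A (k + 1)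
      (a ∘ (Fin.cons j (Set.powersetCard.ofFinEmbEquiv.symm I) : Fin (k + 1) → Fin n)) := by
  rw [exteriorPower.basis_apply, exteriorPower.ιMulti_family, wedge_ιMulti]
  congr 1
  funext i
  refine Fin.cases ?_ (fun i => ?_) i <;> simp

theorem restrictForm_wedge_last (φ : B →+ B') (k : ℕ) (x : ⋀[B]^k M) :
    restrictForm b b' φ (k + 1) (wedge k (b (Fin.last m)) x) = 0 := by
  rw [← (b.exteriorPower k).sum_repr x]
  simp only [map_sum, map_smul]
  refine Finset.sum_eq_zero fun I _ => ?_
  rw [wedge_exteriorPower_basis]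
  exact restrictForm_ιMulti_of_mem b b' φ _ _ _ ⟨0, rfl⟩

theorem restrictForm_wedge_castSucc (φ : B →+ B') (k : ℕ) (j : Fin m) (x : ⋀[B]^k M) :
    restrictForm b b' φ (k + 1) (wedge k (b j.castSucc) x) =
      wedge k (b' j) (restrictForm b b' φ k x) := by
  rw [← (b.exteriorPower k).sum_repr x]
  generalize (b.exteriorPower k).repr x = c
  simp only [map_sum, map_smul]
  refine Finset.sum_congr rfl fun I _ => ?_
  rw [wedge_exteriorPower_basis]
  by_cases hI : Fin.last m ∈ I.1
  · rw [restrictForm_basis_of_mem _ _ _ _ _ _ hI, map_zero]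
    obtain ⟨i, hi⟩ := (Set.powersetCard.mem_range_ofFinEmbEquiv_symm_iff_mem I _).mpr hI
    exact restrictForm_ιMulti_of_mem b b' φ _ _ _ ⟨i.succ, hi⟩
  · obtain ⟨J, rfl⟩ := exists_powersetCardCastSucc I hI
    rw [restrictForm_basis_castSucc, LinearMap.map_smul (wedge k (b' j)),
      wedge_exteriorPower_basis, ← restrictForm_ιMulti_castSucc b]
    congr 4
    funext i
    refine Fin.cases ?_ (fun i => ?_) i
    · rfl
    · exact congrFun (powersetCardCastSucc_symm J) i

theorem restrictForm_avoidPart (φ : B →+ B') (k : ℕ) (x : ⋀[B]^k M) :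
    restrictForm b b' φ k (avoidPart b (Fin.last m) k x) = restrictForm b b' φ k x := by
  cases k with
  | zero => rw [avoidPart_zero]
  | succ k => rw [avoidPart_succ, map_sub, restrictForm_wedge_last, sub_zero]

variable {q : B →+ B} {φ : B →+ B'}

theorem restrictForm_coeffMap {k : ℕ} {S : B →+ B} {S' : B' →+ B'}
    (h : ∀ c, q c = 0 → φ (S c) = S' (φ c)) {x : ⋀[B]^k M} (hx : coeffMap b k q x = 0) :
    restrictForm b b' φ k (coeffMap b k S x) = coeffMap b' k S' (restrictForm b b' φ k x) := by
  rw [coeffMap_eq_zero_iff] at hx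
  refine (b'.exteriorPower k).ext_elem fun J => ?_
  rw [repr_restrictForm, repr_coeffMap, repr_coeffMap, repr_restrictForm]
  exact h _ (hx _)

theorem exists_restrictForm_eq (hsurj : ∀ c', ∃ c, q c = 0 ∧ φ c = c') (k : ℕ) (y : ⋀[B']^k M') :
    ∃ x : ⋀[B]^k M, coeffMap b k q x = 0 ∧ restrictForm b b' φ k x = y := by
  choose s hs hs' using hsurj
  refine ⟨∑ J, s ((b'.exteriorPower k).repr y J) • b.exteriorPower k (powersetCardCastSucc J),
    ?_, ?_⟩
  · rw [coeffMap_sum]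
    refine Finset.sum_eq_zero fun J _ => ?_
    rw [coeffMap_basis, hs, zero_smul]
  · rw [map_sum]
    conv_rhs => rw [← (b'.exteriorPower k).sum_repr y]
    refine Finset.sum_congr rfl fun J _ => ?_
    rw [restrictForm_basis_castSucc, hs']

/-- The restriction sees only the coefficients at index sets without the last index. Its vanishing
therefore lets `S` be inverted on those coefficients, and `avoidPart` discards the others. -/
theorem exists_coeffMap_eq_avoidPart {S : B →+ B}
    (hex : ∀ c, q c = 0 → φ c = 0 → ∃ c', q c' = 0 ∧ S c' = c) (k : ℕ) (x : ⋀[B]^k M)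
    (hx : coeffMap b k q x = 0) (hx' : restrictForm b b' φ k x = 0) :
    ∃ y, coeffMap b k q (avoidPart b (Fin.last m) k y) = 0 ∧
      coeffMap b k S (avoidPart b (Fin.last m) k y) = avoidPart b (Fin.last m) k x := by
  have hex' (I : Set.powersetCard (Fin (m + 1)) k) : ∃ c', q c' = 0 ∧
      (Fin.last m ∉ I.1 → S c' = (b.exteriorPower k).repr x I) := by
    by_cases hI : Fin.last m ∈ I.1
    · exact ⟨0, map_zero _, fun h => absurd hI h⟩
    · obtain ⟨J, rfl⟩ := exists_powersetCardCastSucc I hI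
      obtain ⟨c', h1, h2⟩ := hex _ ((coeffMap_eq_zero_iff b k q x).mp hx _)
        (by rw [← repr_restrictForm b b' φ k x J, hx', map_zero, Finsupp.zero_apply])
      exact ⟨c', h1, fun _ => h2⟩
  choose c hc hc' using hex'
  refine ⟨∑ I, c I • b.exteriorPower k I, ?_, ?_⟩
  · rw [coeffMap_avoidPart, coeffMap_sum, Finset.sum_eq_zero, map_zero]
    intro I _
    rw [coeffMap_basis, hc, zero_smul]
  · rw [coeffMap_avoidPart, coeffMap_sum, map_sum]
    conv_rhs => rw [← (b.exteriorPower k).sum_repr x, map_sum]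
    refine Finset.sum_congr rfl fun I _ => ?_
    rw [coeffMap_basis, map_smul, map_smul]
    by_cases hI : Fin.last m ∈ I.1
    · rw [avoidPart_apply, wedge_exteriorPower_basis_of_mem _ _ _ _ hI, map_zero, smul_zero,
        smul_zero]
    · rw [hc' I hI]

/-- Additive operators on `B` and `B'` such that the last of the operators on `B` has kernel `0`
and cokernel `B'` on the subgroup `ker q`, compatibly with the other operators. -/
structure IsCokernelOfLast (T : Fin (m + 1) → B →+ B) (T' : Fin m → B' →+ B') (q : B →+ B)
    (φ : B →+ B') : Prop where
  stable : ∀ i c, q c = 0 → q (T i c) = 0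
  compat : ∀ i c, q c = 0 → φ (T (Fin.castSucc i) c) = T' i (φ c)
  compat_last : ∀ c, q c = 0 → φ (T (Fin.last m) c) = 0
  surj : ∀ c', ∃ c, q c = 0 ∧ φ c = c'
  exact_last : ∀ c, q c = 0 → φ c = 0 → ∃ c', q c' = 0 ∧ T (Fin.last m) c' = c
  inj_last : ∀ c, q c = 0 → T (Fin.last m) c = 0 → c = 0

variable {b b'} {T : Fin (m + 1) → B →+ B} {T' : Fin m → B' →+ B'}

namespace IsCokernelOfLast

theorem restrictForm_koszul (h : IsCokernelOfLast T T' q φ) {k : ℕ} {x : ⋀[B]^k M}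
    (hx : coeffMap b k q x = 0) :
    restrictForm b b' φ (k + 1) (koszul b T k x) = koszul b' T' k (restrictForm b b' φ k x) := by
  rw [koszul, Fin.sum_univ_castSucc, map_add, restrictForm_wedge_last, add_zero, map_sum, koszul]
  refine Finset.sum_congr rfl fun i _ => ?_
  rw [restrictForm_wedge_castSucc, restrictForm_coeffMap b b' (h.compat i) hx]

theorem restrictForm_coeffMap_last (h : IsCokernelOfLast T T' q φ) {k : ℕ} {x : ⋀[B]^k M}
    (hx : coeffMap b k q x = 0) :
    restrictForm b b' φ k (coeffMap b k (T (Fin.last m)) x) = 0 := by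
  rw [restrictForm_coeffMap (S' := 0) b b' h.compat_last hx, coeffMap_eq_zero_iff]
  exact fun _ => rfl

/-- Contraction with the last basis vector followed by restriction. -/
def residue (b : Module.Basis (Fin (m + 1)) B M) (b' : Module.Basis (Fin m) B' M') (φ : B →+ B')
    (k : ℕ) : ⋀[B]^(k + 1) M →+ ⋀[B']^k M' :=
  (restrictForm b b' φ k).comp (contr (b.coord (Fin.last m)) k).toAddMonoidHom

theorem residue_apply (k : ℕ) (x : ⋀[B]^(k + 1) M) : residue b b' φ k x =
    restrictForm b b' φ k (contr (b.coord (Fin.last m)) k x) := rfl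

theorem coeffMap_contr_eq_zero {i : Fin (m + 1)} {k : ℕ} {x : ⋀[B]^(k + 1) M}
    (hx : coeffMap b (k + 1) q x = 0) : coeffMap b k q (contr (b.coord i) k x) = 0 := by
  rw [coeffMap_contr, hx, map_zero]

theorem residue_koszul_zero (h : IsCokernelOfLast T T' q φ) {x : ⋀[B]^0 M}
    (hx : coeffMap b 0 q x = 0) : residue b b' φ 0 (koszul b T 0 x) = 0 := by
  rw [residue_apply, contr_koszul_zero, h.restrictForm_coeffMap_last hx]

/-- In Cartan's formula the term with the last operator dies in the cokernel. The remaining sign is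
harmless for kernels and images. -/
theorem residue_koszul (h : IsCokernelOfLast T T' q φ) {k : ℕ} {x : ⋀[B]^(k + 1) M}
    (hx : coeffMap b (k + 1) q x = 0) :
    residue b b' φ (k + 1) (koszul b T (k + 1) x) = -koszul b' T' k (residue b b' φ k x) := by
  rw [residue_apply, contr_koszul, map_sub, h.restrictForm_coeffMap_last hx, zero_sub,
    h.restrictForm_koszul (coeffMap_contr_eq_zero hx), residue_apply]

theorem residue_wedge_last (k : ℕ) (x : ⋀[B]^k M) :
    residue b b' φ k (wedge k (b (Fin.last m)) x) = restrictForm b b' φ k x :=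
  restrictForm_avoidPart b b' φ k x

theorem eq_zero_of_coeffMap_last (h : IsCokernelOfLast T T' q φ) {k : ℕ} {x : ⋀[B]^k M}
    (hx : coeffMap b k q x = 0) (hx' : coeffMap b k (T (Fin.last m)) x = 0) : x = 0 := by
  rw [coeffMap_eq_zero_iff] at hx hx'
  refine (b.exteriorPower k).ext_elem fun I => ?_
  rw [h.inj_last _ (hx I) (hx' I), map_zero, Finsupp.zero_apply]

theorem eq_zero_of_koszul_zero (h : IsCokernelOfLast T T' q φ) {x : ⋀[B]^0 M}
    (hx : coeffMap b 0 q x = 0) (hx' : koszul b T 0 x = 0) : x = 0 := by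
  refine h.eq_zero_of_coeffMap_last hx ?_
  rw [← contr_koszul_zero, hx', map_zero]

/-- A closed form with zero contraction is killed by the last operator, by Cartan's formula, and
that operator is injective on `ker q`. -/
theorem eq_zero_of_contr (h : IsCokernelOfLast T T' q φ) {k : ℕ} {x : ⋀[B]^(k + 1) M}
    (hx : coeffMap b (k + 1) q x = 0) (hx' : koszul b T (k + 1) x = 0)
    (hc : contr (b.coord (Fin.last m)) k x = 0) : x = 0 := by
  refine h.eq_zero_of_coeffMap_last hx ?_
  have := contr_koszul b T (Fin.last m) k x
  rwa [hx', hc, map_zero, koszul_zero, sub_zero, eq_comm] at this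

/-- Closed forms lift along the residue. -/
theorem exists_closed_residue_eq (h : IsCokernelOfLast T T' q φ)
    (hTT : ∀ k x, koszul b T (k + 1) (koszul b T k x) = 0) {k : ℕ} {y : ⋀[B']^k M'}
    (hy : koszul b' T' k y = 0) :
    ∃ x, coeffMap b (k + 1) q x = 0 ∧ koszul b T (k + 1) x = 0 ∧ residue b b' φ k x = y := by
  obtain ⟨x₀, hx₀, rfl⟩ := exists_restrictForm_eq b b' h.surj k y
  set l := Fin.last m with hl
  set x := avoidPart b l k x₀ with hx
  have hxq : coeffMap b k q x = 0 := by rw [hx, coeffMap_avoidPart, hx₀, map_zero]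
  have hkq := coeffMap_koszul_eq_zero b h.stable hxq
  obtain ⟨c, hc, hc'⟩ := exists_coeffMap_eq_avoidPart b b' h.exact_last (k + 1) (koszul b T k x)
    hkq (by rw [h.restrictForm_koszul hxq, hx, restrictForm_avoidPart, hy])
  rw [← hl] at hc hc'
  -- The first summand has residue `y`. The second, with `T_l c` equal to the part of the
  -- differential of `x` that avoids `b l`, corrects the failure to be closed without changing the
  -- contraction.
  set z := wedge k (b l) x + avoidPart b l (k + 1) c with hz
  have hzq : coeffMap b (k + 1) q z = 0 := by
    rw [hz, coeffMap_add, coeffMap_wedge_basis, hxq, hc, map_zero, add_zero]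
  have hzc : contr (b.coord l) k z = x := by
    rw [hz, map_add, contr_avoidPart, add_zero, ← avoidPart_apply, hx, avoidPart_avoidPart]
  have hkz : contr (b.coord l) (k + 1) (koszul b T (k + 1) z) = 0 := by
    rw [contr_koszul, hzc, hz, coeffMap_add, coeffMap_wedge_basis, hc', avoidPart_succ, hx,
      contr_koszul_avoidPart]
    abel
  refine ⟨z, hzq, ?_, ?_⟩
  -- The differential of `z` is itself closed and has zero contraction, hence vanishes.
  · exact h.eq_zero_of_contr (coeffMap_koszul_eq_zero b h.stable hzq) (hTT _ _) hkz
  · rw [residue_apply, hzc, hx, restrictForm_avoidPart]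

/-- Zero residue makes the contraction of `x` equal to `T_l c` with `c` free of `b l`. Then `x`
minus the differential of `c` is closed with zero contraction, hence zero. -/
theorem exists_koszul_eq_of_residue_eq_zero (h : IsCokernelOfLast T T' q φ)
    (hTT : ∀ k x, koszul b T (k + 1) (koszul b T k x) = 0) {k : ℕ} {x : ⋀[B]^(k + 1) M}
    (hx : coeffMap b (k + 1) q x = 0) (hx' : koszul b T (k + 1) x = 0)
    (hr : residue b b' φ k x = 0) : ∃ y, coeffMap b k q y = 0 ∧ koszul b T k y = x := by
  obtain ⟨c, hc, hc'⟩ := exists_coeffMap_eq_avoidPart b b' h.exact_last k _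
    (coeffMap_contr_eq_zero hx) hr
  refine ⟨_, hc, (sub_eq_zero.mp ?_).symm⟩
  refine h.eq_zero_of_contr (b := b) ?_ ?_ ?_
  · rw [coeffMap_sub, hx, coeffMap_koszul_eq_zero b h.stable hc, sub_zero]
  · rw [koszul_sub, hx', hTT, sub_zero]
  · rw [map_sub, contr_koszul_avoidPart, hc', avoidPart_contr, sub_self]

/-- Lift `y` to high coefficients and add the differential of `b l ∧ y`. Its residue is minus the
differential of `y`, so this reduces to residue zero. -/
theorem exists_koszul_eq_of_residue_eq_koszul (h : IsCokernelOfLast T T' q φ)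
    (hTT : ∀ k x, koszul b T (k + 1) (koszul b T k x) = 0) {k : ℕ} {x : ⋀[B]^(k + 2) M}
    (hx : coeffMap b (k + 2) q x = 0) (hx' : koszul b T (k + 2) x = 0) {y : ⋀[B']^k M'}
    (hr : residue b b' φ (k + 1) x = koszul b' T' k y) :
    ∃ z, coeffMap b (k + 1) q z = 0 ∧ koszul b T (k + 1) z = x := by
  obtain ⟨y, hy, rfl⟩ := exists_restrictForm_eq b b' h.surj k y
  have hw : coeffMap b (k + 1) q (wedge k (b (Fin.last m)) y) = 0 := by
    rw [coeffMap_wedge_basis, hy, map_zero]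
  have hkw := coeffMap_koszul_eq_zero b h.stable hw
  obtain ⟨z, hz, hz'⟩ := h.exists_koszul_eq_of_residue_eq_zero hTT (b' := b')
    (x := x + koszul b T (k + 1) (wedge k (b (Fin.last m)) y))
    (by rw [coeffMap_add, hx, hkw, add_zero]) (by rw [koszul_add, hx', hTT, add_zero])
    (by rw [map_add, hr, h.residue_koszul hw, residue_wedge_last, add_neg_cancel])
  exact ⟨z - wedge k (b (Fin.last m)) y, by rw [coeffMap_sub, hz, hw, sub_zero],
    by rw [koszul_sub, hz', add_sub_cancel_right]⟩

end IsCokernelOfLast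

end Restrict

/-! ### The grading of Laurent polynomials by the degree in the last variable. -/

namespace Laurent

variable {N n m : ℕ}

/-- The coefficient of `x^u`. -/
def coeffAt (u : Fin n → ℤ) : Laurent N n →ₗ[LambdaRing N] LambdaRing N :=
  Finsupp.lapply u ∘ₗ (AddMonoidAlgebra.coeffLinearEquiv (LambdaRing N)).toLinearMap

theorem coeffAt_single (u v : Fin n → ℤ) (c : LambdaRing N) :
    coeffAt u (single v c) = if v = u then c else 0 := by
  change (Finsupp.single v c : (Fin n → ℤ) →₀ LambdaRing N) u = _
  rw [Finsupp.single_apply]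

theorem ext_coeffAt {p p' : Laurent N n} (h : ∀ u, coeffAt u p = coeffAt u p') : p = p' :=
  (AddMonoidAlgebra.coeffLinearEquiv (LambdaRing N) (M := Fin n → ℤ)).injective
    (Finsupp.ext h)

/-- The operator which multiplies the coefficient of `x^u` by `s u`. -/
def diag (s : (Fin n → ℤ) → ℂ) : Laurent N n →ₗ[LambdaRing N] Laurent N n :=
  (Finsupp.lsum (LambdaRing N) fun u : Fin n → ℤ =>
    s u • AddMonoidAlgebra.lsingle (R := LambdaRing N) (S := LambdaRing N) u) ∘ₗ
    (AddMonoidAlgebra.coeffLinearEquiv (LambdaRing N)).toLinearMap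

theorem diag_single (s : (Fin n → ℤ) → ℂ) (u : Fin n → ℤ) (c : LambdaRing N) :
    diag s (single u c) = s u • single u c := by
  change Finsupp.lsum (LambdaRing N) (fun u : Fin n → ℤ =>
    s u • AddMonoidAlgebra.lsingle (R := LambdaRing N) (S := LambdaRing N) u)
      (Finsupp.single u c) = _
  rw [Finsupp.lsum_single]
  rfl

theorem coeffAt_csmul (u : Fin n → ℤ) (a : ℂ) (p : Laurent N n) :
    coeffAt u (a • p) = a • coeffAt u p := by
  rw [← algebraMap_smul (LambdaRing N) a p, map_smul, algebraMap_smul]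

theorem coeffAt_diag (s : (Fin n → ℤ) → ℂ) (u : Fin n → ℤ) (p : Laurent N n) :
    coeffAt u (diag s p) = s u • coeffAt u p := by
  induction p using Laurent.single_induction with
  | zero => simp
  | add p q hp hq => simp only [map_add, hp, hq, smul_add]
  | single v c =>
    rw [diag_single, coeffAt_csmul, coeffAt_single]
    split_ifs with h
    · rw [h]
    · rw [smul_zero, smul_zero]

theorem diag_diag (s t : (Fin n → ℤ) → ℂ) (p : Laurent N n) :
    diag s (diag t p) = diag (fun u => s u * t u) p :=
  ext_coeffAt fun u => by simp only [coeffAt_diag, mul_smul]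

theorem theta_eq_diag (i : Fin n) (p : Laurent N n) : theta i p = diag (fun u => (u i : ℂ)) p := by
  induction p using Laurent.single_induction with
  | zero => simp
  | add p q hp hq => simp only [map_add, hp, hq]
  | single v c => rw [diag_single, theta_single, Int.cast_smul_eq_zsmul]

theorem diag_add_const (s : (Fin n → ℤ) → ℂ) (a : ℂ) (p : Laurent N n) :
    diag (fun u => s u + a) p = diag s p + a • p :=
  ext_coeffAt fun u => by simp only [map_add, coeffAt_diag, coeffAt_csmul, add_smul]

/-- The part of a Laurent polynomial which has degree less than `K` in the last variable. -/
def lowPart (K : ℤ) : Laurent N (m + 1) →+ Laurent N (m + 1) :=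
  (diag fun u => if u (Fin.last m) < K then 1 else 0).toAddMonoidHom

theorem lowPart_apply (K : ℤ) (p : Laurent N (m + 1)) :
    lowPart K p = diag (fun u => if u (Fin.last m) < K then 1 else 0) p := rfl

theorem lowPart_eq_zero_iff (K : ℤ) (p : Laurent N (m + 1)) :
    lowPart K p = 0 ↔ ∀ u : Fin (m + 1) → ℤ, u (Fin.last m) < K → coeffAt u p = 0 := by
  refine ⟨fun h u hu => ?_, fun h => ext_coeffAt fun u => ?_⟩
  · have := congrArg (coeffAt u) h
    simpa [lowPart_apply, coeffAt_diag, hu] using this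
  · rw [lowPart_apply, coeffAt_diag, map_zero]
    split_ifs with hu
    · rw [h u hu, smul_zero]
    · rw [zero_smul]

theorem lowPart_diag {K : ℤ} {p : Laurent N (m + 1)} (s : (Fin (m + 1) → ℤ) → ℂ)
    (hp : lowPart K p = 0) : lowPart K (diag s p) = 0 := by
  rw [lowPart_eq_zero_iff] at hp ⊢
  intro u hu
  rw [coeffAt_diag, hp u hu, smul_zero]

theorem lowPart_csmul {K : ℤ} {p : Laurent N (m + 1)} (a : ℂ) (hp : lowPart K p = 0) :
    lowPart K (a • p) = 0 := by
  rw [lowPart_eq_zero_iff] at hp ⊢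
  intro u hu
  rw [coeffAt_csmul, hp u hu, smul_zero]

theorem lowPart_smul {K : ℤ} {p : Laurent N (m + 1)} (a : LambdaRing N) (hp : lowPart K p = 0) :
    lowPart K (a • p) = 0 := by
  rw [lowPart_apply, map_smul, ← lowPart_apply, hp, smul_zero]

theorem lowPart_mono {K K' : ℤ} (h : K' ≤ K) {p : Laurent N (m + 1)} (hp : lowPart K p = 0) :
    lowPart K' p = 0 := by
  rw [lowPart_eq_zero_iff] at hp ⊢
  exact fun u hu => hp u (hu.trans_le h)

/-- A Laurent polynomial has finitely many terms; this lower bound on degrees starts every induction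
on the degree below. -/
theorem exists_lowPart_eq_zero (p : Laurent N (m + 1)) : ∃ K, lowPart K p = 0 := by
  induction p using Laurent.single_induction with
  | zero => exact ⟨0, map_zero _⟩
  | add p q hp hq =>
    obtain ⟨K, hK⟩ := hp
    obtain ⟨K', hK'⟩ := hq
    refine ⟨min K K', ?_⟩
    rw [map_add, lowPart_mono (min_le_left _ _) hK, lowPart_mono (min_le_right _ _) hK', add_zero]
  | single v c =>
    refine ⟨v (Fin.last m), ?_⟩
    rw [lowPart_apply, diag_single, if_neg (lt_irrefl _), zero_smul]

/-- The Laurent polynomial `x_{m+1}^k η(x₁, …, x_m)`. -/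
def homog (k : ℤ) : Laurent N m →ₗ[LambdaRing N] Laurent N (m + 1) :=
  LinearMap.mulLeft (LambdaRing N) (mono (Pi.single (Fin.last m) k)) ∘ₗ incl.toLinearMap

theorem incl_single (u : Fin m → ℤ) (c : LambdaRing N) :
    incl (single u c) = single (Fin.snoc u 0 : Fin (m + 1) → ℤ) c :=
  AddMonoidAlgebra.mapDomain_single

theorem homog_apply (k : ℤ) (η : Laurent N m) :
    homog k η = mono (Pi.single (Fin.last m) k) * incl η := rfl

theorem homog_single (k : ℤ) (u : Fin m → ℤ) (c : LambdaRing N) :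
    homog k (single u c) = single (Fin.snoc u k : Fin (m + 1) → ℤ) c := by
  rw [homog_apply, incl_single, mono, single_mul_single, one_mul]
  congr 1
  funext i
  refine Fin.lastCases ?_ (fun i => ?_) i
  · simp
  · simp [Fin.castSucc_ne_last]

theorem single_eq_homog (u : Fin (m + 1) → ℤ) (c : LambdaRing N) :
    single u c = homog (u (Fin.last m)) (single (Fin.init u) c) := by
  rw [homog_single, Fin.snoc_init_self]

theorem homog_mul_homog (k l : ℤ) (η ξ : Laurent N m) :
    homog k η * homog l ξ = homog (k + l) (η * ξ) := by
  rw [homog_apply, homog_apply, homog_apply, map_mul, Pi.single_add, mono_add]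
  ring

theorem homog_csmul (k : ℤ) (a : ℂ) (η : Laurent N m) : homog k (a • η) = a • homog k η := by
  rw [← algebraMap_smul (LambdaRing N) a η, map_smul, algebraMap_smul]

theorem theta_homog_castSucc (i : Fin m) (k : ℤ) (η : Laurent N m) :
    theta i.castSucc (homog k η) = homog k (theta i η) := by
  induction η using Laurent.single_induction with
  | zero => simp
  | add p q hp hq => simp only [map_add, hp, hq]
  | single v c => rw [homog_single, theta_single, theta_single, map_zsmul, homog_single,
      Fin.snoc_castSucc]

theorem theta_homog_last (k : ℤ) (η : Laurent N m) :
    theta (Fin.last m) (homog k η) = (k : ℂ) • homog k η := by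
  induction η using Laurent.single_induction with
  | zero => simp
  | add p q hp hq => simp only [map_add, hp, hq, smul_add]
  | single v c => rw [homog_single, theta_single, Fin.snoc_last, Int.cast_smul_eq_zsmul]

theorem delta_homog (j : Fin N) (k : ℤ) (η : Laurent N m) :
    delta j (homog k η) = homog k (delta j η) := by
  induction η using Laurent.single_induction with
  | zero => simp
  | add p q hp hq => simp only [map_add, hp, hq]
  | single v c => rw [homog_single, delta_single, delta_single, homog_single]

theorem lowPart_homog {K k : ℤ} (h : K ≤ k) (η : Laurent N m) : lowPart K (homog k η) = 0 := by
  induction η using Laurent.single_induction with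
  | zero => simp
  | add p q hp hq => simp only [map_add, hp, hq, add_zero]
  | single v c => rw [homog_single, lowPart_apply, diag_single, Fin.snoc_last,
      if_neg h.not_gt, zero_smul]

/-- Induction on terms does not preserve the degree bound. It is therefore run on `p - lowPart K p`,
which equals `p` under the hypothesis. -/
theorem homog_induction {K : ℤ} {P : Laurent N (m + 1) → Prop} (h0 : P 0)
    (hadd : ∀ p q, P p → P q → P (p + q)) (hhomog : ∀ k, K ≤ k → ∀ η, P (homog k η))
    {p : Laurent N (m + 1)} (hp : lowPart K p = 0) : P p := by
  have h (p : Laurent N (m + 1)) : P (p - lowPart K p) := by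
    induction p using Laurent.single_induction with
    | zero => simpa using h0
    | add p q hp hq => rw [map_add, add_sub_add_comm]; exact hadd _ _ hp hq
    | single v c =>
      rw [lowPart_apply, diag_single]
      split_ifs with hv
      · rw [one_smul, sub_self]; exact h0
      · rw [zero_smul, sub_zero, single_eq_homog]
        exact hhomog _ (not_lt.mp hv) _
  simpa [hp] using h p

theorem lowPart_homog_mul {K k : ℤ} (g : Laurent N m) {p : Laurent N (m + 1)}
    (hp : lowPart K p = 0) : lowPart (K + k) (homog k g * p) = 0 := by
  refine homog_induction (P := fun p => lowPart (K + k) (homog k g * p) = 0) ?_ ?_ ?_ hp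
  · rw [mul_zero, map_zero]
  · intro p q hp hq
    rw [mul_add, map_add, hp, hq, add_zero]
  · intro l hl η
    rw [homog_mul_homog]
    exact lowPart_homog (by omega) _

end Laurent

/-! ### Bijectivity in low degrees, injectivity in high degrees. -/

namespace Laurent

variable {N m : ℕ} (g : Laurent N m)

/-- If `a` is not an integer, the operator `x_i ∂/∂x_i + a + x_{m+1} h` is surjective modulo Laurent
polynomials of degree at least `K` in the last variable. -/
theorem exists_lowPart_theta_sub {a : ℂ} (ha : ∀ k : ℤ, (k : ℂ) + a ≠ 0) (i : Fin (m + 1))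
    (h : Laurent N m) (K : ℤ) (c : Laurent N (m + 1)) :
    ∃ c', lowPart K (theta i c' + a • c' + homog 1 h * c' - c) = 0 := by
  have key (d : ℕ) : ∀ c : Laurent N (m + 1), lowPart (K - d) c = 0 →
      ∃ c', lowPart K (theta i c' + a • c' + homog 1 h * c' - c) = 0 := by
    induction d with
    | zero =>
      intro c hc
      refine ⟨0, ?_⟩
      simpa using hc
    | succ d ih =>
      intro c hc
      -- Invert the diagonal part; the error `homog 1 h * e` starts one degree higher and is left to
      -- the induction.
      obtain ⟨e, he⟩ : ∃ e, e = diag (fun u => ((u i : ℂ) + a)⁻¹) c := ⟨_, rfl⟩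
      have h1 : theta i e + a • e = c := by
        rw [theta_eq_diag, ← diag_add_const, he, diag_diag]
        refine ext_coeffAt fun u => ?_
        rw [coeffAt_diag, mul_inv_cancel₀ (ha _), one_smul]
      have h2 := lowPart_homog_mul (k := 1) h (lowPart_diag (fun u => ((u i : ℂ) + a)⁻¹) hc)
      rw [← he] at h2
      obtain ⟨c', hc'⟩ := ih (-(homog 1 h * e)) (by
        rw [map_neg, neg_eq_zero]
        exact lowPart_mono (by push_cast; omega) h2)
      have h3 : theta i (c' + e) + a • (c' + e) + homog 1 h * (c' + e) - c =
          theta i c' + a • c' + homog 1 h * c' - -(homog 1 h * e) := by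
        rw [map_add, smul_add, mul_add, ← h1]
        abel
      exact ⟨c' + e, by rw [h3, hc']⟩
  obtain ⟨M, hM⟩ := exists_lowPart_eq_zero c
  -- If `M` already exceeds `K`, then `toNat` truncates to `0` and the weaker bound `K` is used.
  exact key (K - M).toNat c (lowPart_mono (by omega) hM)

/-- The term with `homog 1 h` contributes only in degrees above `K`. In degree `K` the operator is
the scalar `u_i + a`, so the lowest terms of `c` vanish. -/
theorem lowPart_eq_zero_of_theta {a : ℂ} {K : ℤ} (i : Fin (m + 1)) (h : Laurent N m)
    {c : Laurent N (m + 1)} (hc : lowPart K c = 0)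
    (ha : ∀ u : Fin (m + 1) → ℤ, K ≤ u (Fin.last m) → (u i : ℂ) + a ≠ 0)
    (hT : lowPart (K + 1) (theta i c + a • c + homog 1 h * c) = 0) : lowPart (K + 1) c = 0 := by
  rw [map_add, lowPart_homog_mul h hc, add_zero, theta_eq_diag, ← diag_add_const,
    lowPart_eq_zero_iff] at hT
  rw [lowPart_eq_zero_iff] at hc ⊢
  intro u hu
  by_cases hu' : u (Fin.last m) < K
  · exact hc u hu'
  · have := hT u hu
    rw [coeffAt_diag] at this
    exact (smul_eq_zero_iff_right (ha u (not_lt.mp hu'))).mp this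

theorem lowPart_eq_zero_of_lowPart_theta {a : ℂ} (ha : ∀ k : ℤ, (k : ℂ) + a ≠ 0)
    (i : Fin (m + 1)) (h : Laurent N m) (K : ℤ) (c : Laurent N (m + 1))
    (hc : lowPart K (theta i c + a • c + homog 1 h * c) = 0) : lowPart K c = 0 := by
  obtain ⟨M, hM⟩ := exists_lowPart_eq_zero c
  have key (d : ℕ) : M + d ≤ K → lowPart (M + d) c = 0 := by
    induction d with
    | zero => intro _; simpa using hM
    | succ d ih =>
      intro hd
      have := lowPart_eq_zero_of_theta i h (ih (by push_cast at hd; omega)) (fun u _ => ha _)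
        (lowPart_mono (by push_cast at hd; omega) hc)
      rwa [add_assoc] at this
  by_cases hMK : M ≤ K
  · have := key (K - M).toNat (by omega)
    rwa [Int.toNat_of_nonneg (by omega), add_sub_cancel] at this
  · exact lowPart_mono (by omega) hM

/-- On degree `k` the diagonal part of the last operator is the scalar `k + a`, so only `k ≥ K`
matters and `a` itself may be an integer. The lowest term can be removed again and again. -/
theorem eq_zero_of_theta_last {a : ℂ} {K : ℤ} (ha : ∀ k : ℤ, K ≤ k → (k : ℂ) + a ≠ 0)
    (h : Laurent N m) {c : Laurent N (m + 1)} (hc : lowPart K c = 0)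
    (hT : theta (Fin.last m) c + a • c + homog 1 h * c = 0) : c = 0 := by
  have key (d : ℕ) : lowPart (K + d) c = 0 := by
    induction d with
    | zero => simpa using hc
    | succ d ih =>
      have := lowPart_eq_zero_of_theta (Fin.last m) h ih (fun u hu => ha _ (by omega))
        (by rw [hT, map_zero])
      rwa [add_assoc] at this
  refine ext_coeffAt fun u => ?_
  rw [map_zero]
  exact (lowPart_eq_zero_iff _ c).mp (key (u (Fin.last m) - K + 1).toNat) u (by omega)

end Laurent

/-! ### The cokernel of the last operator is the ring of functions on `g ≠ 0`. -/

section PowerMap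

open Laurent

/-- The product of the numbers `-(j + a)`, `K ≤ j < k`. -/
def negPoch (a : ℂ) (K k : ℕ) : ℂ := ∏ j ∈ Finset.Ico K k, -((j : ℂ) + a)

/-- This recursion mirrors the cokernel relation `(k + a) x^k η = -x^{k+1} g η`, where `x` is the
last variable. -/
theorem negPoch_succ (a : ℂ) {K k : ℕ} (h : K ≤ k) :
    negPoch a K (k + 1) = negPoch a K k * -((k : ℂ) + a) := Finset.prod_Ico_succ_top h _

theorem negPoch_ne_zero {a : ℂ} {K : ℕ} (ha : ∀ k : ℕ, K ≤ k → (k : ℂ) + a ≠ 0) (k : ℕ) :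
    negPoch a K k ≠ 0 :=
  Finset.prod_ne_zero_iff.mpr fun j hj => neg_ne_zero.mpr (ha j (Finset.mem_Ico.mp hj).1)

variable {N m : ℕ} (g : Laurent N m)

/-- The map which sends `x_{m+1}^k η` to a multiple of `η / g^k` for `k ≥ K` and to `0` for
`k < K`. -/
def powerMap (a : ℂ) (K : ℕ) : Laurent N (m + 1) →ₗ[LambdaRing N] Localization.Away g :=
  (Finsupp.lsum (LambdaRing N) fun u : Fin (m + 1) → ℤ =>
    (if (K : ℤ) ≤ u (Fin.last m) then negPoch a K (u (Fin.last m)).toNat else 0) •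
      (LinearMap.mulRight (LambdaRing N) (awayInv g ^ (u (Fin.last m)).toNat) ∘ₗ
        (IsScalarTower.toAlgHom (LambdaRing N) (Laurent N m) (Localization.Away g)).toLinearMap ∘ₗ
          AddMonoidAlgebra.lsingle (R := LambdaRing N) (S := LambdaRing N)
            (Fin.init u : Fin m → ℤ))) ∘ₗ
    (AddMonoidAlgebra.coeffLinearEquiv (LambdaRing N)).toLinearMap

theorem powerMap_homog (a : ℂ) {K k : ℕ} (h : K ≤ k) (η : Laurent N m) :
    powerMap g a K (homog k η) =
      negPoch a K k • (algebraMap _ (Localization.Away g) η * awayInv g ^ k) := by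
  induction η using Laurent.single_induction with
  | zero => simp
  | add p q hp hq => rw [map_add, map_add, hp, hq, map_add, add_mul, smul_add]
  | single u c =>
    rw [homog_single]
    refine (Finsupp.lsum_single (LambdaRing N) _ _ _).trans ?_
    have h' : (K : ℤ) ≤ (Fin.snoc u (k : ℤ) : Fin (m + 1) → ℤ) (Fin.last m) := by
      rw [Fin.snoc_last]; exact_mod_cast h
    rw [if_pos h', Fin.snoc_last, Fin.init_snoc, Int.toNat_natCast]
    rfl

theorem deriv_awayInv_pow (D : Derivation ℂ (Localization.Away g) (Localization.Away g)) (k : ℕ) :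
    D (awayInv g ^ k) = -(k * awayInv g ^ (k + 1) * D (awaySelf g)) := by
  induction k with
  | zero => simp
  | succ k ih =>
    rw [pow_succ, Derivation.leibniz, ih, smul_eq_mul, smul_eq_mul,
      Derivation.leibniz_of_mul_eq_one _ (awayInv_mul_awaySelf g), smul_eq_mul]
    push_cast
    ring

theorem exists_homog_induction {K : ℕ} {P : Laurent N (m + 1) → Prop} (h0 : P 0)
    (hadd : ∀ p q, P p → P q → P (p + q)) (hhomog : ∀ k : ℕ, K ≤ k → ∀ η, P (homog k η))
    {p : Laurent N (m + 1)} (hp : lowPart K p = 0) : P p := by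
  refine homog_induction h0 hadd (fun k hk η => ?_) hp
  lift k to ℕ using by omega
  exact hhomog k (by exact_mod_cast hk) η

/-- `powerMap` intertwines twisted derivations. -/
theorem powerMap_deriv {a : ℂ} {K : ℕ} (s : ℂ) (D : Laurent N (m + 1) → Laurent N (m + 1))
    (D₀ : Derivation ℂ (Laurent N m) (Laurent N m))
    (D' : Derivation ℂ (Localization.Away g) (Localization.Away g))
    (hD : ∀ k η, D (homog k η) = homog k (D₀ η)) (hDadd : ∀ p q, D (p + q) = D p + D q)
    (hD' : ∀ η, D' (algebraMap _ _ η) = algebraMap _ _ (D₀ η)) {p : Laurent N (m + 1)}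
    (hp : lowPart K p = 0) :
    powerMap g a K (D p + s • p + homog 1 (D₀ g) * p) = D' (powerMap g a K p) +
      s • powerMap g a K p - a • (awayInv g * D' (awaySelf g)) * powerMap g a K p := by
  refine exists_homog_induction (P := fun p => powerMap g a K (D p + s • p + homog 1 (D₀ g) * p) =
    D' (powerMap g a K p) + s • powerMap g a K p -
      a • (awayInv g * D' (awaySelf g)) * powerMap g a K p) ?_ ?_ ?_ hp
  · have : D 0 = 0 := by simpa using hDadd 0 0
    simp [this]
  · intro p q hp hq
    have : D (p + q) + s • (p + q) + homog 1 (D₀ g) * (p + q) =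
        (D p + s • p + homog 1 (D₀ g) * p) + (D q + s • q + homog 1 (D₀ g) * q) := by
      rw [hDadd, smul_add, mul_add]
      abel
    rw [this, map_add, hp, hq, map_add, map_add, smul_add, mul_add]
    abel
  -- Multiplication by `homog 1 (D₀ g)` produces the factor `-(k + a)`. The part `-k` is the
  -- derivative of `g^{-k}`, and the part `-a` is the twist by `dg/g`.
  · intro k hk η
    have h1 : (1 + (k : ℤ)) = ((k + 1 : ℕ) : ℤ) := by push_cast; ring
    rw [hD, ← homog_csmul, homog_mul_homog, h1, ← map_add, map_add (powerMap g a K),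
      powerMap_homog g a hk, powerMap_homog g a hk, powerMap_homog g a (Nat.le_succ_of_le hk),
      negPoch_succ a hk, Derivation.map_smul, Derivation.leibniz, deriv_awayInv_pow, hD', map_add,
      map_mul, awaySelf, hD', smul_eq_mul, smul_eq_mul, Nat.succ_eq_add_one, pow_succ]
    rw [← algebraMap_smul (Laurent N m) s η]
    simp only [Algebra.smul_def, map_mul, map_neg, map_add, map_natCast,
      ← IsScalarTower.algebraMap_apply]
    ring

theorem exists_awayInv_pow (w : Localization.Away g) :
    ∃ (η : Laurent N m) (k : ℕ), w = algebraMap _ _ η * awayInv g ^ k := by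
  obtain ⟨η, ⟨_, k, rfl⟩, rfl⟩ := IsLocalization.exists_mk'_eq (Submonoid.powers g) w
  refine ⟨η, k, ?_⟩
  rw [IsLocalization.mk'_eq_iff_eq_mul]
  have : awayInv g ^ k * algebraMap _ (Localization.Away g) g ^ k = 1 := by
    rw [← mul_pow]
    exact (congrArg (· ^ k) (awayInv_mul_awaySelf g)).trans (one_pow k)
  simp only [map_pow]
  rw [mul_assoc, this, mul_one]

theorem powerMap_surjective {a : ℂ} {K : ℕ} (ha : ∀ k : ℕ, K ≤ k → (k : ℂ) + a ≠ 0)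
    (w : Localization.Away g) : ∃ p, lowPart K p = 0 ∧ powerMap g a K p = w := by
  obtain ⟨η, k, rfl⟩ := exists_awayInv_pow g w
  -- Writing `η/g^k` as `η g^K/g^{K+k}` puts a preimage in degree at least `K`; the constant is
  -- invertible by the choice of `K`.
  refine ⟨homog (K + k : ℕ) ((negPoch a K (K + k))⁻¹ • (η * g ^ K)),
    lowPart_homog (by push_cast; omega) _, ?_⟩
  have : awayInv g ^ K * algebraMap _ (Localization.Away g) g ^ K = 1 := by
    rw [← mul_pow]
    exact (congrArg (· ^ K) (awayInv_mul_awaySelf g)).trans (one_pow K)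
  rw [homog_csmul, ← algebraMap_smul (LambdaRing N), map_smul, algebraMap_smul,
    powerMap_homog g a (Nat.le_add_right _ _), inv_smul_smul₀ (negPoch_ne_zero ha _), map_mul,
    map_pow]
  linear_combination (algebraMap _ (Localization.Away g) η * awayInv g ^ k) * this

/-- The operator `x_{m+1} ∂/∂x_{m+1} + a + x_{m+1} g`. -/
def thetaLast (a : ℂ) : Laurent N (m + 1) →+ Laurent N (m + 1) :=
  AddMonoidHom.mk' (fun p => theta (Fin.last m) p + a • p + homog 1 g * p) fun p q => by
    rw [map_add, smul_add, mul_add]; abel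

theorem thetaLast_apply (a : ℂ) (p : Laurent N (m + 1)) :
    thetaLast g a p = theta (Fin.last m) p + a • p + homog 1 g * p := rfl

theorem thetaLast_csmul (a s : ℂ) (p : Laurent N (m + 1)) :
    thetaLast g a (s • p) = s • thetaLast g a p := by
  rw [thetaLast_apply, thetaLast_apply, smul_add, smul_add, mul_smul_comm, smul_comm a s,
    ← algebraMap_smul (LambdaRing N) s p, Derivation.map_smul, algebraMap_smul]

theorem thetaLast_homog (a : ℂ) (k : ℕ) (η : Laurent N m) :
    thetaLast g a (homog k η) = ((k : ℂ) + a) • homog k η + homog (k + 1 : ℕ) (g * η) := by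
  rw [thetaLast_apply, theta_homog_last, homog_mul_homog, add_smul, add_comm 1 (k : ℤ)]
  push_cast
  rfl

/-- On `x^k η` the two homogeneous terms of the image receive opposite values, by `negPoch_succ` and
cancellation of one factor `g`. -/
theorem powerMap_thetaLast (a : ℂ) {K : ℕ} {p : Laurent N (m + 1)} (hp : lowPart K p = 0) :
    powerMap g a K (thetaLast g a p) = 0 := by
  refine exists_homog_induction (P := fun p => powerMap g a K (thetaLast g a p) = 0) ?_ ?_ ?_ hp
  · simp
  · intro p q hp hq
    rw [map_add, map_add, hp, hq, add_zero]
  · intro k hk η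
    have : algebraMap _ (Localization.Away g) g * awayInv g = 1 :=
      (mul_comm _ _).trans (awayInv_mul_awaySelf g)
    rw [thetaLast_homog, ← homog_csmul, map_add, powerMap_homog g a hk,
      powerMap_homog g a (Nat.le_succ_of_le hk), negPoch_succ a hk,
      ← algebraMap_smul (Laurent N m) _ η]
    simp only [Algebra.smul_def, map_mul, map_neg, map_add, map_natCast,
      ← IsScalarTower.algebraMap_apply]
    rw [pow_succ]
    linear_combination (-(algebraMap ℂ (Localization.Away g) (negPoch a K k)) *
      ((k : Localization.Away g) + algebraMap ℂ (Localization.Away g) a) *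
      algebraMap _ (Localization.Away g) η * awayInv g ^ k) * this

/-- Modulo the image of `thetaLast`, a term can be moved up one degree at the price of a factor `g`
and a scalar, since `k + a` is invertible. -/
theorem exists_thetaLast_add_homog {a : ℂ} {K : ℕ} (ha : ∀ k : ℕ, K ≤ k → (k : ℂ) + a ≠ 0)
    {k : ℕ} (hk : K ≤ k) (η : Laurent N m) (s : ℕ) : ∃ z, lowPart K z = 0 ∧ ∃ b : ℂ,
      homog k η = thetaLast g a z + homog (k + s : ℕ) (b • (g ^ s * η)) := by
  induction s with
  | zero => exact ⟨0, map_zero _, 1, by simp⟩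
  | succ s ih =>
    obtain ⟨z, hz, b, h⟩ := ih
    have hks := ha (k + s) (by omega)
    refine ⟨z + (((k + s : ℕ) : ℂ) + a)⁻¹ • homog (k + s : ℕ) (b • (g ^ s * η)), ?_,
      -((((k + s : ℕ) : ℂ) + a)⁻¹ * b), ?_⟩
    · rw [map_add, hz, zero_add]
      exact lowPart_csmul _ (lowPart_homog (by push_cast; omega) _)
    · rw [h, map_add, thetaLast_csmul, thetaLast_homog, smul_add, inv_smul_smul₀ hks,
        ← homog_csmul, neg_smul, map_neg, mul_smul_comm, smul_smul, pow_succ', mul_assoc]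
      simp only [← add_assoc, add_neg_cancel_right]

/-- Allowing every sufficiently large `M` lets all terms of a sum be moved into one common degree.
-/
theorem exists_eq_thetaLast_add_homog {a : ℂ} {K : ℕ}
    (ha : ∀ k : ℕ, K ≤ k → (k : ℂ) + a ≠ 0) {p : Laurent N (m + 1)} (hp : lowPart K p = 0) :
    ∃ M₀, K ≤ M₀ ∧ ∀ M, M₀ ≤ M → ∃ z, lowPart K z = 0 ∧ ∃ η, p = thetaLast g a z + homog M η := by
  refine exists_homog_induction (P := fun p => ∃ M₀ : ℕ, K ≤ M₀ ∧ ∀ M : ℕ, M₀ ≤ M → ∃ z,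
    lowPart K z = 0 ∧ ∃ η, p = thetaLast g a z + homog M η) ?_ ?_ ?_ hp
  · exact ⟨K, le_rfl, fun M _ => ⟨0, map_zero _, 0, by simp⟩⟩
  · rintro p q ⟨M₁, h₁, h₁'⟩ ⟨M₂, h₂, h₂'⟩
    refine ⟨max M₁ M₂, le_max_of_le_left h₁, fun M hM => ?_⟩
    obtain ⟨z₁, hz₁, η₁, rfl⟩ := h₁' M ((le_max_left _ _).trans hM)
    obtain ⟨z₂, hz₂, η₂, rfl⟩ := h₂' M ((le_max_right _ _).trans hM)
    exact ⟨z₁ + z₂, by rw [map_add, hz₁, hz₂, add_zero], η₁ + η₂, by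
      rw [map_add, map_add]; abel⟩
  · intro k hk η
    refine ⟨k, hk, fun M hM => ?_⟩
    obtain ⟨s, rfl⟩ := Nat.exists_eq_add_of_le hM
    obtain ⟨z, hz, b, h⟩ := exists_thetaLast_add_homog g ha hk η s
    exact ⟨z, hz, _, h⟩

theorem exists_thetaLast_eq {a : ℂ} {K : ℕ} (ha : ∀ k : ℕ, K ≤ k → (k : ℂ) + a ≠ 0)
    {p : Laurent N (m + 1)} (hp : lowPart K p = 0) (hp' : powerMap g a K p = 0) :
    ∃ z, lowPart K z = 0 ∧ thetaLast g a z = p := by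
  obtain ⟨M, hKM, hM⟩ := exists_eq_thetaLast_add_homog g ha hp
  obtain ⟨z, hz, η, rfl⟩ := hM M le_rfl
  rw [map_add, powerMap_thetaLast g a hz, zero_add, powerMap_homog g a hKM,
    smul_eq_zero_iff_right (negPoch_ne_zero ha M)] at hp'
  have hu : IsUnit (awayInv g) := IsUnit.of_mul_eq_one _ (awayInv_mul_awaySelf g)
  rw [(hu.pow M).mul_left_eq_zero, IsLocalization.map_eq_zero_iff (Submonoid.powers g)] at hp'
  -- Vanishing of `η` in the localization means `g^s η = 0`; moving up `s` more degrees then leaves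
  -- nothing but the image of `thetaLast`.
  obtain ⟨⟨_, s, rfl⟩, hs⟩ := hp'
  obtain ⟨z', hz', b, h⟩ := exists_thetaLast_add_homog g ha hKM η s
  refine ⟨z + z', by rw [map_add, hz, hz', add_zero], ?_⟩
  have hs' : g ^ s * η = 0 := hs
  rw [h, hs', smul_zero, map_zero, add_zero, map_add]

end PowerMap

/-! ### Tilting a supporting linear form to a facet. -/

section Facet

variable {K V ι : Type*} [Field K] [LinearOrder K] [IsStrictOrderedRing K] [AddCommGroup V]
  [Module K V] [FiniteDimensional K V] [Finite ι] (a : ι → V)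

/-- A nonzero linear form which is nonnegative on a finite spanning family and whose zero set in
this family spans a space of codimension at least two can be replaced by one with a larger zero
set. -/
theorem exists_finrank_zeros_lt (ha : ∀ l : Module.Dual K V, (∀ j, l (a j) = 0) → l = 0)
    (l : Module.Dual K V) (hl : l ≠ 0) (hpos : ∀ j, 0 ≤ l (a j))
    (hr : Module.finrank K (Submodule.span K (a '' {j | l (a j) = 0})) + 1 <
      Module.finrank K V) :
    ∃ l' : Module.Dual K V, l' ≠ 0 ∧ (∀ j, 0 ≤ l' (a j)) ∧
      Module.finrank K (Submodule.span K (a '' {j | l (a j) = 0})) <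
        Module.finrank K (Submodule.span K (a '' {j | l' (a j) = 0})) := by
  set W := Submodule.span K (a '' {j | l (a j) = 0}) with hW
  have hann := Subspace.finrank_add_finrank_dualAnnihilator_eq W
  -- The annihilator of `W` has dimension at least two, so it is not contained in the line of `l`.
  obtain ⟨l₁, h₁, h₁'⟩ : ∃ l₁ ∈ W.dualAnnihilator, l₁ ∉ Submodule.span K {l} := by
    by_contra! h
    have h1 := Submodule.finrank_mono (show W.dualAnnihilator ≤ Submodule.span K {l} from h)
    have h2 := finrank_span_singleton (K := K) hl
    omega
  -- The spanning hypothesis makes `l₁` nonzero at some `a j`; a change of sign makes it negative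
  -- there.
  obtain ⟨l₂, h₂, h₂', j₁, hj₁⟩ : ∃ l₂ ∈ W.dualAnnihilator, l₂ ∉ Submodule.span K {l} ∧
      ∃ j, l₂ (a j) < 0 := by
    have hne : ∃ j, l₁ (a j) ≠ 0 := by
      by_contra! h
      exact h₁' (ha l₁ h ▸ Submodule.zero_mem _)
    obtain ⟨j, hj⟩ := hne
    rcases lt_or_gt_of_ne hj with hj | hj
    · exact ⟨l₁, h₁, h₁', j, hj⟩
    · exact ⟨-l₁, Submodule.neg_mem _ h₁, fun h => h₁' (by simpa using Submodule.neg_mem _ h), j,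
        by simpa using hj⟩
  rw [Submodule.mem_dualAnnihilator] at h₂
  -- The least ratio is the largest `t` for which `l + t • l₂` stays nonnegative on the family. At
  -- that value `a j₀` becomes a new zero, and it lies outside `W` because `l₂` is negative there.
  obtain ⟨j₀, hj₀, hmin⟩ := Set.exists_min_image {j | l₂ (a j) < 0}
    (fun j => l (a j) / -l₂ (a j)) (Set.toFinite _) ⟨j₁, hj₁⟩
  have hj₀' : 0 < -l₂ (a j₀) := neg_pos.mpr hj₀
  set t := l (a j₀) / -l₂ (a j₀) with ht
  have ht0 : 0 ≤ t := div_nonneg (hpos j₀) hj₀'.le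
  have htj : l (a j₀) = t * -l₂ (a j₀) := by rw [ht, div_mul_cancel₀ _ hj₀'.ne']
  refine ⟨l + t • l₂, fun h => ?_, fun j => ?_, ?_⟩
  · by_cases ht' : t = 0
    · rw [ht', zero_smul, add_zero] at h
      exact hl h
    · refine h₂' (Submodule.mem_span_singleton.mpr ⟨-t⁻¹, ?_⟩)
      rw [eq_neg_of_add_eq_zero_left h, neg_smul_neg, inv_smul_smul₀ ht']
  · rw [LinearMap.add_apply, LinearMap.smul_apply, smul_eq_mul]
    rcases le_or_gt 0 (l₂ (a j)) with hj | hj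
    · exact add_nonneg (hpos j) (mul_nonneg ht0 hj)
    · have := (le_div_iff₀ (neg_pos.mpr hj)).mp (hmin j hj)
      linarith
  · refine Submodule.finrank_lt_finrank_of_lt (lt_of_le_of_ne ?_ fun h => ?_)
    · refine Submodule.span_mono (Set.image_mono fun j hj => ?_)
      have h3 := h₂ (a j) (Submodule.subset_span (Set.mem_image_of_mem a hj))
      have h4 : l (a j) = 0 := hj
      simp [h3, h4]
    · have h5 : a j₀ ∈ W := by
        rw [h]
        refine Submodule.subset_span (Set.mem_image_of_mem a ?_)
        simp only [Set.mem_ofPred_eq, LinearMap.add_apply, LinearMap.smul_apply, smul_eq_mul]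
        linarith
      exact hj₀.ne (h₂ _ h5)

/-- Each tilt strictly enlarges the span of the zeros, so induction on its codimension terminates.
-/
theorem exists_facet_dual (ha : ∀ l : Module.Dual K V, (∀ j, l (a j) = 0) → l = 0)
    (l : Module.Dual K V) (hl : l ≠ 0) (hpos : ∀ j, 0 ≤ l (a j)) :
    ∃ l' : Module.Dual K V, l' ≠ 0 ∧ (∀ j, 0 ≤ l' (a j)) ∧
      Module.finrank K V ≤
        Module.finrank K (Submodule.span K (a '' {j | l' (a j) = 0})) + 1 := by
  induction hd : Module.finrank K V -
    Module.finrank K (Submodule.span K (a '' {j | l (a j) = 0})) using Nat.strong_induction_on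
    generalizing l with
  | _ d ih =>
    by_cases hr : Module.finrank K (Submodule.span K (a '' {j | l (a j) = 0})) + 1 <
      Module.finrank K V
    · obtain ⟨l', hl', hpos', hlt⟩ := exists_finrank_zeros_lt a ha l hl hpos hr
      exact ih _ (by omega) l' hl' hpos' rfl
    · exact ⟨l, hl, hpos, not_lt.mp hr⟩

end Facet

/-! ### Primitive integral facet forms of `C(A)`. -/

section FacetForm

variable {N n : ℕ} (A : Fin N → Fin n → ℤ)

/-- The tilting is carried out over `ℚ`, so that the resulting form can be rescaled to coprime
integer coefficients. -/
theorem exists_primitive_facet (hA : AddSubgroup.closure (Set.range A) = ⊤) (c₀ : Fin n → ℤ)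
    (hc₀ : c₀ ≠ 0) (hpos : ∀ j, 0 ≤ c₀ ⬝ᵥ A j) : ∃ c : Fin n → ℤ, Finset.univ.gcd c = 1 ∧
      (∀ j, 0 ≤ c ⬝ᵥ A j) ∧ n ≤ Module.finrank ℚ (Submodule.span ℚ
        ((fun j i => (A j i : ℚ)) '' {j | c ⬝ᵥ A j = 0})) + 1 := by
  have hn : (Finset.univ : Finset (Fin n)).Nonempty := by
    obtain ⟨i, -⟩ := Function.ne_iff.mp hc₀
    exact ⟨i, Finset.mem_univ i⟩
  let a : Fin N → Fin n → ℚ := fun j i => (A j i : ℚ)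
  have ha (l : Module.Dual ℚ (Fin n → ℚ)) (h : ∀ j, l (a j) = 0) : l = 0 := by
    have h' (u : Fin n → ℤ) : l (fun i => (u i : ℚ)) = 0 := by
      have hu : u ∈ AddSubgroup.closure (Set.range A) := hA ▸ AddSubgroup.mem_top u
      let ψ : (Fin n → ℤ) →+ ℚ :=
        l.toAddMonoidHom.comp (AddMonoidHom.compLeft (Int.castAddHom ℚ) (Fin n))
      have : AddSubgroup.closure (Set.range A) ≤ ψ.ker := by
        rw [AddSubgroup.closure_le]
        rintro _ ⟨j, rfl⟩
        exact h j
      exact this hu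
    refine LinearMap.pi_ext' fun i => LinearMap.ext_ring ?_
    have := h' (Pi.single i 1)
    simp only [LinearMap.comp_apply, LinearMap.zero_apply, LinearMap.single_apply]
    convert this using 2
    funext k
    simp [Pi.single_apply]
  let form (c : Fin n → ℤ) : Module.Dual ℚ (Fin n → ℚ) :=
    dotProductBilin ℚ ℚ (fun i => (c i : ℚ))
  have hform (c : Fin n → ℤ) (j : Fin N) : form c (a j) = ((c ⬝ᵥ A j : ℤ) : ℚ) := by
    simp [form, a, dotProduct]
  obtain ⟨l, hl, hlpos, hlr⟩ := exists_facet_dual a ha (form c₀) (by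
    intro h
    refine hc₀ (funext fun i => ?_)
    have := LinearMap.congr_fun h (Pi.single i 1)
    simpa [form] using this) (fun j => by rw [hform]; exact_mod_cast hpos j)
  obtain ⟨d, hd⟩ := IsLocalization.exist_integer_multiples_of_finite (nonZeroDivisors ℤ)
    (fun i : Fin n => l (Pi.single i 1))
  choose e he using hd
  have hd0 : (d : ℤ) ≠ 0 := nonZeroDivisors.coe_ne_zero d
  -- The denominator `d` may be negative. The additional factor `d` makes the total scaling `d²`,
  -- which preserves nonnegativity.
  obtain ⟨c, hc, hgcd⟩ := Finset.extract_gcd (fun i => (d : ℤ) * e i) hn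
  set G := Finset.univ.gcd fun i => (d : ℤ) * e i with hG
  have hcl (u : Fin n → ℚ) : (G : ℚ) * ((fun i => (c i : ℚ)) ⬝ᵥ u) = (d : ℚ) ^ 2 * l u := by
    have hu : u = ∑ i, u i • (Pi.single i 1 : Fin n → ℚ) := by
      simpa [Pi.single_apply] using pi_eq_sum_univ' u
    conv_rhs => rw [hu]
    rw [map_sum, dotProduct, Finset.mul_sum, Finset.mul_sum]
    refine Finset.sum_congr rfl fun i hi => ?_
    have h1 : (d : ℚ) * (e i : ℚ) = (G : ℚ) * c i := by exact_mod_cast hc i hi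
    have h2 : (e i : ℚ) = (d : ℚ) * l (Pi.single i 1) := by simpa using he i
    rw [map_smul, smul_eq_mul]
    linear_combination -(u i) * h1 + (d : ℚ) * u i * h2
  have hd2 : (0 : ℚ) < (d : ℚ) ^ 2 := by positivity
  have hG0 : (0 : ℚ) < G := by
    have h1 : 0 ≤ G := by
      rw [hG, ← Finset.normalize_gcd]
      exact Int.nonneg_of_normalize_eq_self (by simp)
    refine lt_of_le_of_ne (by exact_mod_cast h1) fun h => hl ?_
    refine LinearMap.ext fun u => ?_
    have := hcl u
    rw [← h, zero_mul, zero_eq_mul] at this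
    exact this.resolve_left hd2.ne'
  have hcA (j : Fin N) : (G : ℚ) * ((c ⬝ᵥ A j : ℤ) : ℚ) = (d : ℚ) ^ 2 * l (a j) := by
    rw [← hcl]
    simp [dotProduct, a]
  refine ⟨c, hgcd, fun j => ?_, ?_⟩
  · have h1 : 0 ≤ (G : ℚ) * ((c ⬝ᵥ A j : ℤ) : ℚ) := by
      rw [hcA]
      exact mul_nonneg hd2.le (hlpos j)
    exact_mod_cast nonneg_of_mul_nonneg_right h1 hG0
  · have h1 : {j | c ⬝ᵥ A j = 0} = {j | l (a j) = 0} := by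
      ext j
      have := hcA j
      simp only [Set.mem_ofPred_eq]
      refine ⟨fun h => ?_, fun h => ?_⟩
      · rw [h, Int.cast_zero, mul_zero, zero_eq_mul] at this
        exact this.resolve_left hd2.ne'
      · rw [h, mul_zero, mul_eq_zero] at this
        exact_mod_cast this.resolve_left hG0.ne'
    rw [h1]
    simpa using hlr

theorem exists_isFacetForm (hA : AddSubgroup.closure (Set.range A) = ⊤) (c₀ : Fin n → ℤ)
    (hc₀ : c₀ ≠ 0) (hpos : ∀ j, 0 ≤ c₀ ⬝ᵥ A j) : ∃ c, IsFacetForm A c := by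
  obtain ⟨c, hgcd, hc, hr⟩ := exists_primitive_facet A hA c₀ hc₀ hpos
  have hcast (j : Fin N) : ∑ i, (c i : ℝ) * (A j i : ℝ) = ((c ⬝ᵥ A j : ℤ) : ℝ) := by
    simp [dotProduct]
  refine ⟨c, hgcd, fun u hu => ?_, le_antisymm ?_ (hr.trans ?_)⟩
  · induction hu using Submodule.span_induction with
    | mem u hu =>
      obtain ⟨j, rfl⟩ := hu
      rw [hcast]
      exact_mod_cast hc j
    | zero => simp
    | add u v _ _ hu hv =>
      simp only [Pi.add_apply, mul_add, Finset.sum_add_distrib]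
      exact add_nonneg hu hv
    | smul r u _ hu =>
      have : ∑ i, (c i : ℝ) * (r • u) i = (r : ℝ) * ∑ i, (c i : ℝ) * u i := by
        rw [Finset.mul_sum]
        refine Finset.sum_congr rfl fun i _ => ?_
        change (c i : ℝ) * ((r : ℝ) * u i) = _
        ring
      rw [this]
      exact mul_nonneg r.2 hu
  -- The face lies in the kernel of a form that is nonzero because its coefficients have gcd 1. This
  -- gives the upper bound on the dimension.
  · have hlt : Submodule.span ℝ {u | u ∈ realCone A ∧ ∑ i, (c i : ℝ) * u i = 0} ≠ ⊤ := by
      intro h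
      have hle : Submodule.span ℝ {u | u ∈ realCone A ∧ ∑ i, (c i : ℝ) * u i = 0} ≤
          LinearMap.ker (dotProductBilin ℝ ℝ (fun i => (c i : ℝ))) :=
        Submodule.span_le.mpr fun u hu => hu.2
      rw [h] at hle
      have hc0 (i : Fin n) : c i = 0 := by
        have := hle (Submodule.mem_top (x := Pi.single i 1))
        simpa using this
      have : Finset.univ.gcd c = 0 := Finset.gcd_eq_zero_iff.mpr fun i _ => hc0 i
      omega
    have := Submodule.finrank_lt hlt
    rw [Module.finrank_fin_fun] at this
    omega
  · refine Nat.add_le_add_right ?_ 1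
    -- Lower bound: a rational basis chosen among the integral vectors `A j` remains independent
    -- over `ℤ`, hence over `ℝ`.
    obtain ⟨b, hb, hspan, hli⟩ := exists_linearIndependent ℚ
      ((fun j i => (A j i : ℚ)) '' {j | c ⬝ᵥ A j = 0})
    have hbfin : Finite b := (Set.toFinite _).subset hb
    have : Fintype b := Fintype.ofFinite b
    have hj (x : b) : ∃ j, c ⬝ᵥ A j = 0 ∧ (fun i => (A j i : ℚ)) = x := by
      obtain ⟨j, hj, hj'⟩ := hb x.2
      exact ⟨j, hj, hj'⟩
    choose j hj hj' using hj
    have hliZ : LinearIndependent ℤ fun x : b => A (j x) := by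
      have hval : (fun x : b => algebraMap ℤ ℚ ∘ A (j x)) = Subtype.val := funext hj'
      rw [← linearIndependent_algebraMap_comp_iff (S := ℚ), hval]
      exact hli
    have hliR := (linearIndependent_algebraMap_comp_iff (S := ℝ)).mpr hliZ
    rw [← hspan, finrank_span_set_eq_card hli, Set.toFinset_card, ← finrank_span_eq_card hliR]
    refine Submodule.finrank_mono (Submodule.span_mono ?_)
    rintro _ ⟨x, rfl⟩
    refine ⟨Submodule.subset_span ⟨j x, rfl⟩, ?_⟩
    exact (hcast (j x)).trans (by rw [hj x, Int.cast_zero])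

end FacetForm

/-! ### The operators of the two de Rham complexes. -/

section Operators

open Laurent

variable {N m : ℕ}

/-- The operators `x_i ∂/∂x_i + α_i + x_i ∂f/∂x_i` on Laurent polynomials. -/
def torusOp {n : ℕ} (f : Laurent N n) (α : Fin n → ℂ) (i : Fin n) : Laurent N n →+ Laurent N n :=
  (torusData f α).thetaEta i

theorem torusOp_apply {n : ℕ} (f : Laurent N n) (α : Fin n → ℂ) (i : Fin n) (c : Laurent N n) :
    torusOp f α i c = theta i c + α i • c + theta i f * c := by
  have h : torusOp f α i c = frame.coord i (KaehlerDifferential.D (LambdaRing N) (Laurent N n) c) +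
    frame.coord i (∑ i, α i • dlog i + KaehlerDifferential.D (LambdaRing N) (Laurent N n) f) * c :=
      rfl
  rw [h, frame_coord_D, frame_coord_eta, add_mul, ← Algebra.smul_def, add_assoc]

theorem nabla_torusData {n : ℕ} (f : Laurent N n) (α : Fin n → ℂ) (k : ℕ)
    (x : (torusData f α).Form k) :
    (torusData f α).nabla k x = koszul Laurent.frame (torusOp f α) k x :=
  (torusData f α).nablaFun_eq k x

/-- The operators `x_i ∂/∂x_i + α_i - α_{m+1} (x_i ∂g/∂x_i) / g` on the functions on the open set
`g ≠ 0` of the torus. -/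
def awayOp (g : Laurent N m) (α : Fin (m + 1) → ℂ) (i : Fin m) :
    Localization.Away g →+ Localization.Away g :=
  (complementData g α).thetaEta i

theorem awayOp_apply (g : Laurent N m) (α : Fin (m + 1) → ℂ) (i : Fin m)
    (c : Localization.Away g) : awayOp g α i c = awayTheta g i c + α i.castSucc • c -
      α (Fin.last m) • (awayInv g * awayTheta g i (awaySelf g)) * c := by
  have h : awayOp g α i c = awayTheta g i c +
    (awayFrame g).coord i (∑ i : Fin m, α i.castSucc • awayDlog g i - α (Fin.last m) •
      (awayInv g • KaehlerDifferential.D (LambdaRing N) (Localization.Away g) (awaySelf g))) * c :=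
      rfl
  rw [h, awayFrame_coord_eta, sub_mul, ← Algebra.smul_def, add_sub_assoc]

theorem nabla_complementData (g : Laurent N m) (α : Fin (m + 1) → ℂ) (k : ℕ)
    (x : (complementData g α).Form k) :
    (complementData g α).nabla k x = koszul (awayFrame g) (awayOp g α) k x :=
  (complementData g α).nablaFun_eq k x

variable (g : Laurent N m) (α : Fin (m + 1) → ℂ)

theorem torusOp_last (c : Laurent N (m + 1)) :
    torusOp (homog 1 g) α (Fin.last m) c = thetaLast g (α (Fin.last m)) c := by
  rw [torusOp_apply, theta_homog_last, Int.cast_one, one_smul, thetaLast_apply]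

/-- The degree one part of `torusOp`. -/
def torusOpCoeff (i : Fin (m + 1)) : Laurent N m :=
  Fin.lastCases (motive := fun _ => Laurent N m) g (fun i => theta i g) i

/-- Treating all indices alike matters because the non-integral coordinate `i₀` may or may not be
the last one. -/
theorem torusOp_eq (i : Fin (m + 1)) (c : Laurent N (m + 1)) :
    torusOp (homog 1 g) α i c = theta i c + α i • c + homog 1 (torusOpCoeff g i) * c := by
  rw [torusOp_apply]
  congr 2
  refine Fin.lastCases ?_ (fun i => ?_) i
  · rw [theta_homog_last, Int.cast_one, one_smul, torusOpCoeff, Fin.lastCases_last]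
  · rw [theta_homog_castSucc, torusOpCoeff, Fin.lastCases_castSucc]

theorem lowPart_torusOp {K : ℤ} (i : Fin (m + 1)) {c : Laurent N (m + 1)} (hc : lowPart K c = 0) :
    lowPart K (torusOp (homog 1 g) α i c) = 0 := by
  rw [torusOp_eq, map_add, map_add, lowPart_csmul _ hc, theta_eq_diag, lowPart_diag _ hc,
    lowPart_mono (by omega) (lowPart_homog_mul (k := 1) _ hc), add_zero, add_zero]

/-- Here `K` only has to lie beyond a possible root `k = -α_n`; nonresonance plays no role. -/
theorem isCokernelOfLast {K : ℕ} (hK : ∀ k : ℕ, K ≤ k → (k : ℂ) + α (Fin.last m) ≠ 0) :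
    IsCokernelOfLast (torusOp (homog 1 g) α) (awayOp g α) (lowPart K)
      (powerMap g (α (Fin.last m)) K).toAddMonoidHom where
  stable i c hc := lowPart_torusOp g α i hc
  compat i c hc := by
    refine Eq.trans ?_ (awayOp_apply g α i _).symm
    rw [torusOp_apply, theta_homog_castSucc]
    exact powerMap_deriv g (α i.castSucc) (theta i.castSucc) ((theta i).restrictScalars ℂ)
      (awayTheta g i) (fun k η => theta_homog_castSucc i k η) (map_add _)
      (fun η => awayTheta_algebraMap g i η) hc
  compat_last c hc := by
    rw [torusOp_last]
    exact powerMap_thetaLast g _ hc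
  surj := powerMap_surjective g hK
  exact_last c hc hc' := by
    obtain ⟨z, hz, hz'⟩ := exists_thetaLast_eq g hK hc hc'
    exact ⟨z, hz, by rw [torusOp_last, hz']⟩
  inj_last c hc hc' := by
    rw [torusOp_last] at hc'
    refine eq_zero_of_theta_last (fun k hk => ?_) g hc hc'
    lift k to ℕ using by omega
    exact_mod_cast hK k (by exact_mod_cast hk)

end Operators

/-! ### Linearity over the Weyl algebra, and submodules cut out by conditions on coefficients. -/

section Coefficients

variable {N : ℕ}

/-- An additive map which commutes with the generators of the Weyl algebra is linear over it. -/
theorem map_weyl_smul {V V' : Type*} [AddCommGroup V] [AddCommGroup V'] [Module (Weyl N) V]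
    [Module (Weyl N) V'] (F : V →+ V')
    (hc : ∀ (c : ℂ) x, F (algebraMap ℂ (Weyl N) c • x) = algebraMap ℂ (Weyl N) c • F x)
    (hl : ∀ j x, F (Weyl.coord j • x) = (Weyl.coord j : Weyl N) • F x)
    (hp : ∀ j x, F (Weyl.del j • x) = (Weyl.del j : Weyl N) • F x) (w : Weyl N) (x : V) :
    F (w • x) = w • F x := by
  induction w using Weyl.induction generalizing x with
  | hc c => exact hc c x
  | hl j => exact hl j x
  | hp j => exact hp j x
  | hadd a b ha hb => rw [add_smul, add_smul, map_add, ha, hb]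
  | hmul a b ha hb => rw [mul_smul, mul_smul, ha, hb]

/-- Two quotients of a module with the same kernel are isomorphic. -/
theorem nonempty_linearEquiv_of_ker_eq {R Z X Y : Type*} [Ring R] [AddCommGroup Z]
    [AddCommGroup X] [AddCommGroup Y] [Module R Z] [Module R X] [Module R Y] (F : Z →ₗ[R] X)
    (G : Z →ₗ[R] Y) (hF : Function.Surjective F) (hG : Function.Surjective G)
    (h : ∀ z, F z = 0 ↔ G z = 0) : Nonempty (X ≃ₗ[R] Y) :=
  ⟨(F.quotKerEquivOfSurjective hF).symm ≪≫ₗ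
    Submodule.quotEquivOfEq _ _ (Submodule.ext fun z => by
      rw [LinearMap.mem_ker, LinearMap.mem_ker, h]) ≪≫ₗ G.quotKerEquivOfSurjective hG⟩

namespace TwistedData

variable (S : TwistedData N)

theorem algebraMap_weyl_smul_eq (k : ℕ) (c : ℂ) (x : S.Form k) : algebraMap ℂ (Weyl N) c • x =
    algebraMap (LambdaRing N) S.B (algebraMap ℂ _ c) • x := by
  rw [algebraMap_weyl_smul, ← algebraMap_smul S.B c,
    IsScalarTower.algebraMap_apply ℂ (LambdaRing N)]

/-- The forms all of whose coefficients are killed by `q`. -/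
def coeffKer (q : S.B →+ S.B)
    (hq : ∀ a c, q c = 0 → q (algebraMap (LambdaRing N) S.B a * c) = 0)
    (hδ : ∀ j c, q c = 0 → q (S.deltaPot j c) = 0) (k : ℕ) : Submodule (Weyl N) (S.Form k) where
  carrier := {x | coeffMap S.frame k q x = 0}
  add_mem' {x y} hx hy := (coeffMap_add _ _ _ _ _).trans (by rw [hx, hy, add_zero])
  zero_mem' := coeffMap_zero _ _ _
  smul_mem' w x hx := by
    have hmul (a : LambdaRing N) {x : S.Form k} (hx : coeffMap S.frame k q x = 0) :
        coeffMap S.frame k q (algebraMap (LambdaRing N) S.B a • x : S.Form k) = 0 := by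
      refine (coeffMap_eq_zero_iff S.frame k q _).mpr fun I => ?_
      have hx := (coeffMap_eq_zero_iff S.frame k q _).mp hx
      exact (congrArg (fun r => q (r I)) (map_smul (S.formBasis k).repr _ x)).trans (hq _ _ (hx I))
    change coeffMap S.frame k q (w • x : S.Form k) = 0
    induction w using Weyl.induction generalizing x with
    | hc c => rw [algebraMap_weyl_smul_eq]; exact hmul _ hx
    | hl j => rw [coord_smul]; exact hmul _ hx
    | hp j =>
      rw [del_smul, delFun_eq]
      exact coeffMap_coeffMap_eq_zero S.frame (hδ j) hx
    | hadd a b ha hb =>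
      rw [add_smul]
      exact (coeffMap_add _ _ _ _ _).trans (by rw [ha x hx, hb x hx, add_zero])
    | hmul a b ha hb => rw [mul_smul]; exact ha _ (hb _ hx)

end TwistedData

end Coefficients

/-! ### The residue as a `𝓓`-linear map, and the comparison of cohomology. -/

section Comparison

open Laurent

variable {N m : ℕ} (g : Laurent N m) (α : Fin (m + 1) → ℂ)

theorem deltaPot_torusData (j : Fin N) (c : Laurent N (m + 1)) :
    (torusData (homog 1 g) α).deltaPot j c = delta j c + homog 1 (delta j g) * c := by
  rw [← delta_homog]
  rfl

theorem lowPart_delta {K : ℤ} (j : Fin N) {c : Laurent N (m + 1)} (hc : lowPart K c = 0) :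
    lowPart K (delta j c) = 0 := by
  refine homog_induction (P := fun c => lowPart K (delta j c) = 0) ?_ ?_ ?_ hc
  · simp
  · intro p q hp hq
    rw [map_add, map_add, hp, hq, add_zero]
  · intro k hk η
    rw [delta_homog]
    exact lowPart_homog hk _

theorem lowPart_algebraMap_mul {K : ℤ} (a : LambdaRing N) {c : Laurent N (m + 1)}
    (hc : lowPart K c = 0) : lowPart K (algebraMap _ (Laurent N (m + 1)) a * c) = 0 := by
  rw [← Algebra.smul_def]
  exact lowPart_smul a hc

theorem lowPart_deltaPot {K : ℤ} (j : Fin N) {c : Laurent N (m + 1)} (hc : lowPart K c = 0) :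
    lowPart K (delta j c + homog 1 (delta j g) * c) = 0 := by
  rw [map_add, lowPart_delta j hc,
    lowPart_mono (by omega) (lowPart_homog_mul (k := 1) (delta j g) hc), add_zero]

/-- The forms whose coefficients have degree at least `K` in the last variable. -/
def highForms (K : ℕ) (k : ℕ) : Submodule (Weyl N) ((torusData (homog 1 g) α).Form k) :=
  (torusData (homog 1 g) α).coeffKer (lowPart (K : ℤ)) (fun a _ hc => lowPart_algebraMap_mul a hc)
    (fun j c hc => (congrArg _ (deltaPot_torusData g α j c)).trans (lowPart_deltaPot g j hc)) k

/-- This is `powerMap_deriv` with `s = 0`: the potential `∂_j(f)` turns into the twist `-α_n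
∂_j(g)/g`. -/
theorem powerMap_deltaPot (a : ℂ) (ha : a = α (Fin.last m)) (K : ℕ) (j : Fin N)
    (c : Laurent N (m + 1)) (hc : lowPart K c = 0) :
    powerMap g a K ((torusData (homog 1 g) α).deltaPot j c) =
      (complementData g α).deltaPot j (powerMap g a K c) := by
  subst ha
  rw [deltaPot_torusData]
  have h := powerMap_deriv g (a := α (Fin.last m)) (K := K) 0 (delta j) (delta j) (awayDelta g j)
    (fun k η => delta_homog j k η) (map_add _) (fun η => awayDelta_algebraMap g j η) hc
  rw [zero_smul, add_zero, zero_smul, add_zero] at h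
  rw [h, sub_eq_add_neg, ← neg_mul]
  rfl

/-- The residue of forms on the torus with values in the forms on the open set `g ≠ 0`. -/
def residueMap (a : ℂ) (K k : ℕ) :
    ⋀[Laurent N (m + 1)]^(k + 1) (Ω[Laurent N (m + 1)⁄LambdaRing N]) →+
    ⋀[Localization.Away g]^k (Ω[Localization.Away g⁄LambdaRing N]) :=
  IsCokernelOfLast.residue Laurent.frame (awayFrame g) (powerMap g a K).toAddMonoidHom k

theorem residueMap_apply (a : ℂ) (K k : ℕ)
    (x : ⋀[Laurent N (m + 1)]^(k + 1) (Ω[Laurent N (m + 1)⁄LambdaRing N])) : residueMap g a K k x =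
    restrictForm Laurent.frame (awayFrame g) (powerMap g a K).toAddMonoidHom k
      (contr (Laurent.frame.coord (Fin.last m)) k x) := rfl

theorem residueMap_smul (a : ℂ) (K k : ℕ) (r : LambdaRing N)
    (x : ⋀[Laurent N (m + 1)]^(k + 1) (Ω[Laurent N (m + 1)⁄LambdaRing N])) :
    residueMap g a K k (algebraMap _ (Laurent N (m + 1)) r • x) =
      algebraMap _ (Localization.Away g) r • residueMap g a K k x := by
  refine ((awayFrame g).exteriorPower k).ext_elem fun I => ?_
  rw [residueMap_apply, residueMap_apply, LinearMap.map_smul, repr_restrictForm,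
    LinearEquiv.map_smul, LinearEquiv.map_smul, Finsupp.smul_apply, Finsupp.smul_apply,
    repr_restrictForm, algebraMap_smul, algebraMap_smul]
  exact (powerMap g a K).map_smul r _

/-- `residueMap` as a map of `𝓓`-modules. -/
def residueLin (K k : ℕ) :
    highForms g α K (k + 1) →ₗ[Weyl N] (complementData g α).Form k where
  toFun x := residueMap g (α (Fin.last m)) K k x.1
  map_add' x y := map_add (residueMap g (α (Fin.last m)) K k) x.1 y.1
  map_smul' w x := by
    let F : highForms g α K (k + 1) →+ (complementData g α).Form k :=
      (residueMap g (α (Fin.last m)) K k).comp (highForms g α K (k + 1)).subtype.toAddMonoidHom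
    refine map_weyl_smul F (fun c x => ?_) (fun j x => ?_) (fun j x => ?_) w x
    · exact (congrArg (residueMap g _ K k)
        ((torusData (homog 1 g) α).algebraMap_weyl_smul_eq _ c x.1)).trans
        ((residueMap_smul g _ K k _ _).trans
          ((complementData g α).algebraMap_weyl_smul_eq _ c (F x)).symm)
    · exact (congrArg (residueMap g _ K k) ((torusData (homog 1 g) α).coord_smul _ j x.1)).trans
        ((residueMap_smul g _ K k _ _).trans ((complementData g α).coord_smul _ j (F x)).symm)
    -- Only on coefficients of degree at least `K` does `powerMap` intertwine the actions of `∂_j`;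
    -- this is why the domain is `highForms`.
    · have hx : coeffMap Laurent.frame (k + 1) (lowPart (K : ℤ)) x.1 = 0 := x.2
      have h1 : (Weyl.del j : Weyl N) • F x = coeffMap (awayFrame g) k
          ((complementData g α).deltaPot j) (residueMap g (α (Fin.last m)) K k x.1) :=
        ((complementData g α).del_smul _ j (F x)).trans ((complementData g α).delFun_eq _ _ _)
      have h2 : (Weyl.del j : Weyl N) • x.1 = coeffMap Laurent.frame (k + 1)
          ((torusData (homog 1 g) α).deltaPot j) x.1 :=
        ((torusData (homog 1 g) α).del_smul _ j x.1).trans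
          ((torusData (homog 1 g) α).delFun_eq _ _ _)
      refine (congrArg (residueMap g _ K k) h2).trans (Eq.trans ?_ h1.symm)
      refine (congrArg (restrictForm Laurent.frame (awayFrame g) _ k)
        (coeffMap_contr Laurent.frame (Fin.last m) k _ _).symm).trans ?_
      exact restrictForm_coeffMap Laurent.frame (awayFrame g)
        (fun c hc => powerMap_deltaPot g α _ rfl K j c hc)
        (IsCokernelOfLast.coeffMap_contr_eq_zero hx)

theorem koszul_torusOp_koszul_torusOp {n : ℕ} (f : Laurent N n) (β : Fin n → ℂ) (k : ℕ)
    (x : ⋀[Laurent N n]^k (Ω[Laurent N n⁄LambdaRing N])) :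
    koszul Laurent.frame (torusOp f β) (k + 1) (koszul Laurent.frame (torusOp f β) k x) = 0 := by
  refine ((nabla_torusData f β (k + 1) _).symm.trans ?_)
  refine (congrArg ((torusData f β).nabla (k + 1)) (nabla_torusData f β k x).symm).trans ?_
  exact (torusData f β).nabla_nabla k x

theorem mem_ker_torusData {f : Laurent N (m + 1)} {k : ℕ} {x : (torusData f α).Form k} :
    x ∈ LinearMap.ker ((torusData f α).nabla k) ↔
      koszul Laurent.frame (torusOp f α) k x = 0 := by
  rw [LinearMap.mem_ker, nabla_torusData]
  rfl

theorem mem_ker_complementData {k : ℕ} {x : (complementData g α).Form k} :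
    x ∈ LinearMap.ker ((complementData g α).nabla k) ↔
      koszul (awayFrame g) (awayOp g α) k x = 0 := by
  rw [LinearMap.mem_ker, nabla_complementData]
  rfl

/-- Closed forms whose coefficients have degree at least `K` in the last variable. -/
def closedHighForms (K k : ℕ) : Submodule (Weyl N) ((torusData (homog 1 g) α).Form k) :=
  highForms g α K k ⊓ LinearMap.ker ((torusData (homog 1 g) α).nabla k)

variable {α}

theorem exists_nat_add_ne_zero (a : ℂ) : ∃ K : ℕ, ∀ k : ℕ, K ≤ k → (k : ℂ) + a ≠ 0 := by
  obtain ⟨K, hK⟩ := exists_nat_gt (-a.re)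
  refine ⟨K, fun k hk h => ?_⟩
  have h1 : (k : ℝ) + a.re = 0 := by simpa using congrArg Complex.re h
  have h2 : (K : ℝ) ≤ k := by exact_mod_cast hk
  linarith

theorem torus_exact_mod {i₀ : Fin (m + 1)} (hi₀ : ∀ k : ℤ, (k : ℂ) + α i₀ ≠ 0) {K : ℤ} (k : ℕ)
    (x : ⋀[Laurent N (m + 1)]^(k + 1) (Ω[Laurent N (m + 1)⁄LambdaRing N]))
    (hx : coeffMap Laurent.frame (k + 2) (lowPart K)
      (koszul Laurent.frame (torusOp (homog 1 g) α) (k + 1) x) = 0) :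
    ∃ y, coeffMap Laurent.frame (k + 1) (lowPart K)
      (x - koszul Laurent.frame (torusOp (homog 1 g) α) k y) = 0 := by
  refine koszul_exact_mod Laurent.frame i₀ (fun i c hc => lowPart_torusOp g α i hc)
    (koszul_torusOp_koszul_torusOp _ _) (fun c hc => ?_) (fun c => ?_) k x hx
  · rw [torusOp_eq] at hc
    exact lowPart_eq_zero_of_lowPart_theta hi₀ i₀ _ K c hc
  · simp only [torusOp_eq]
    exact exists_lowPart_theta_sub hi₀ i₀ _ K c

theorem torus_zero_mod {i₀ : Fin (m + 1)} (hi₀ : ∀ k : ℤ, (k : ℂ) + α i₀ ≠ 0) {K : ℤ}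
    (x : ⋀[Laurent N (m + 1)]^0 (Ω[Laurent N (m + 1)⁄LambdaRing N]))
    (hx : coeffMap Laurent.frame 1 (lowPart K)
      (koszul Laurent.frame (torusOp (homog 1 g) α) 0 x) = 0) :
    coeffMap Laurent.frame 0 (lowPart K) x = 0 := by
  refine koszul_zero_mod Laurent.frame i₀ (fun c hc => ?_) x hx
  rw [torusOp_eq] at hc
  exact lowPart_eq_zero_of_lowPart_theta hi₀ i₀ _ K c hc

/-- A closed function has no terms of degree below `K`, by injectivity of the operator at `i₀`. What
remains is killed by the last operator, which is injective in high degrees. -/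
theorem subsingleton_H_zero {i₀ : Fin (m + 1)} (hi₀ : ∀ k : ℤ, (k : ℂ) + α i₀ ≠ 0) :
    Subsingleton ((torusData (homog 1 g) α).H 0) := by
  refine ⟨fun x y => ?_⟩
  obtain ⟨x, rfl⟩ := Submodule.Quotient.mk_surjective _ x
  obtain ⟨y, rfl⟩ := Submodule.Quotient.mk_surjective _ y
  obtain ⟨K, hK⟩ := exists_nat_add_ne_zero (α (Fin.last m))
  have h₀ (x : ⋀[Laurent N (m + 1)]^0 (Ω[Laurent N (m + 1)⁄LambdaRing N]))
      (hx : koszul Laurent.frame (torusOp (homog 1 g) α) 0 x = 0) : x = 0 := by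
    refine (isCokernelOfLast g α hK).eq_zero_of_koszul_zero
      (torus_zero_mod g hi₀ (K := K) x ?_) hx
    rw [hx, coeffMap_zero]
  have h (x : LinearMap.ker ((torusData (homog 1 g) α).nabla 0)) : x = 0 :=
    Subtype.ext (h₀ x.1 ((mem_ker_torusData α).mp x.2))
  rw [h x, h y]

theorem mem_boundaries_complement_zero {x : (complementData g α).Form 0} :
    x ∈ (complementData g α).boundaries 0 ↔ x = 0 := Submodule.mem_bot _

theorem mem_boundaries_complement_succ {k : ℕ} {x : (complementData g α).Form (k + 1)} :
    x ∈ (complementData g α).boundaries (k + 1) ↔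
      ∃ y, koszul (awayFrame g) (awayOp g α) k y = x := by
  refine exists_congr fun y => ?_
  rw [nabla_complementData]
  rfl

theorem mem_boundaries_torus_succ {f : Laurent N (m + 1)} {k : ℕ}
    {x : (torusData f α).Form (k + 1)} :
    x ∈ (torusData f α).boundaries (k + 1) ↔
      ∃ y, koszul Laurent.frame (torusOp f α) k y = x := by
  refine exists_congr fun y => ?_
  rw [nabla_torusData]
  rfl

/-- If `α` is not integral, the residue induces isomorphisms of the cohomology of the torus with the
cohomology of the complement of the hypersurface `g = 0`. -/
theorem nonempty_H_equiv {i₀ : Fin (m + 1)} (hi₀ : ∀ k : ℤ, (k : ℂ) + α i₀ ≠ 0) (k : ℕ) :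
    Nonempty ((torusData (homog 1 g) α).H (k + 1) ≃ₗ[Weyl N] (complementData g α).H k) := by
  obtain ⟨K, hK⟩ := exists_nat_add_ne_zero (α (Fin.last m))
  have hcok := isCokernelOfLast g α hK
  have hTT := koszul_torusOp_koszul_torusOp (homog 1 g) α
  -- The apex of the roof: `F` takes cohomology classes on the torus, `G` takes classes of residues.
  let Z := closedHighForms g α K (k + 1)
  have hZ (x : Z) : coeffMap Laurent.frame (k + 1) (lowPart (K : ℤ)) x.1 = 0 ∧
      koszul Laurent.frame (torusOp (homog 1 g) α) (k + 1) x.1 = 0 :=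
    ⟨x.2.1, (mem_ker_torusData α).mp x.2.2⟩
  let F : Z →ₗ[Weyl N] (torusData (homog 1 g) α).H (k + 1) :=
    Submodule.mkQ _ ∘ₗ Submodule.inclusion inf_le_right
  have hclosed (x : Z) : residueLin g α K k (Submodule.inclusion inf_le_left x) ∈
      LinearMap.ker ((complementData g α).nabla k) := by
    rw [mem_ker_complementData]
    have h := hcok.residue_koszul (b := Laurent.frame) (b' := awayFrame g) (hZ x).1
    rw [(hZ x).2, map_zero, zero_eq_neg] at h
    exact h
  let G : Z →ₗ[Weyl N] (complementData g α).H k :=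
    Submodule.mkQ _ ∘ₗ LinearMap.codRestrict _
      (residueLin g α K k ∘ₗ Submodule.inclusion inf_le_left) hclosed
  have hF0 (x : Z) : F x = 0 ↔
      ∃ y, koszul Laurent.frame (torusOp (homog 1 g) α) k y = x.1 :=
    (Submodule.Quotient.mk_eq_zero _).trans (mem_boundaries_torus_succ (x := x.1))
  have hG0 (x : Z) : G x = 0 ↔
      residueMap g (α (Fin.last m)) K k x.1 ∈ (complementData g α).boundaries k :=
    Submodule.Quotient.mk_eq_zero _
  refine nonempty_linearEquiv_of_ker_eq F G (fun c => ?_) (fun c => ?_) fun x => ?_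
  -- Surjectivity of `F`: acyclicity modulo high degrees makes every closed form cohomologous to a
  -- high one.
  · obtain ⟨⟨x, hx⟩, rfl⟩ := Submodule.Quotient.mk_surjective _ c
    have hx' : koszul Laurent.frame (torusOp (homog 1 g) α) (k + 1) x = 0 :=
      (mem_ker_torusData α).mp hx
    obtain ⟨y, hy⟩ := torus_exact_mod g hi₀ (K := K) k x
      ((congrArg _ hx').trans (coeffMap_zero _ _ _))
    have hxy := koszul_sub Laurent.frame (torusOp (homog 1 g) α) (k + 1) x
      (koszul Laurent.frame (torusOp (homog 1 g) α) k y)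
    rw [hx', hTT, sub_zero] at hxy
    refine ⟨⟨_, hy, (mem_ker_torusData α).mpr hxy⟩, (Submodule.Quotient.eq _).mpr ?_⟩
    refine (mem_boundaries_torus_succ (α := α)).mpr ⟨-y, ?_⟩
    exact (koszul_neg _ _ _ _).trans (sub_sub_cancel_left x _).symm
  · obtain ⟨⟨y, hy⟩, rfl⟩ := Submodule.Quotient.mk_surjective _ c
    obtain ⟨x, hx, hx', hxy⟩ := hcok.exists_closed_residue_eq (b := Laurent.frame)
      (b' := awayFrame g) hTT ((mem_ker_complementData g α).mp hy)
    refine ⟨⟨x, hx, (mem_ker_torusData α).mpr hx'⟩, ?_⟩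
    exact congrArg (Submodule.mkQ (((complementData g α).boundaries k).submoduleOf
      (LinearMap.ker ((complementData g α).nabla k)))) (Subtype.ext hxy)
  · rw [hF0, hG0]
    obtain ⟨hx, hx'⟩ := hZ x
    refine ⟨fun ⟨y, hy⟩ => ?_, fun h => ?_⟩
    · cases k with
      | zero =>
        have hy0 := torus_zero_mod g hi₀ (K := K) y (by rw [hy]; exact hx)
        refine (mem_boundaries_complement_zero g).mpr ?_
        rw [← hy]
        exact hcok.residue_koszul_zero hy0
      | succ k =>
        -- The primitive `y` need not be high, but its differential `x` is. So `y` becomes high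
        -- after subtracting a coboundary, which does not change its differential.
        obtain ⟨z, hz⟩ := torus_exact_mod g hi₀ (K := K) k y (by rw [hy]; exact hx)
        have hr := hcok.residue_koszul (b' := awayFrame g) hz
        rw [koszul_sub, hTT, sub_zero, hy, ← koszul_neg] at hr
        exact (mem_boundaries_complement_succ g).mpr ⟨_, hr.symm⟩
    · cases k with
      | zero =>
        obtain ⟨y, -, hy⟩ := hcok.exists_koszul_eq_of_residue_eq_zero (b := Laurent.frame)
          (b' := awayFrame g) hTT hx hx' (mem_boundaries_complement_zero g |>.mp h)
        exact ⟨y, hy⟩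
      | succ k =>
        obtain ⟨y, hy⟩ := (mem_boundaries_complement_succ g).mp h
        obtain ⟨z, -, hz⟩ := hcok.exists_koszul_eq_of_residue_eq_koszul (b := Laurent.frame)
          (b' := awayFrame g) hTT hx hx' hy.symm
        exact ⟨z, hz⟩

end Comparison

/-! ### From nonresonance to a non-integral coordinate, and the conclusion. -/

theorem last_eq_one_of_genericLaurent {N m : ℕ} (A : Fin N → Fin (m + 1) → ℤ) (g : Laurent N m)
    (hg : genericLaurent A = Laurent.homog 1 g) (j : Fin N) : A j (Fin.last m) = 1 := by
  have h1 : Laurent.coeffAt (A j) (genericLaurent A) ≠ 0 := by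
    rw [genericLaurent, map_sum]
    simp only [Laurent.coeffAt_single]
    intro h
    -- The `A j` need not be distinct: the coefficient is the sum of `λ_i` over all `i` with `A i =
    -- A j`. At `λ = 1` it counts these indices, including `j` itself.
    have := congrArg (MvPolynomial.eval fun _ => (1 : ℂ)) h
    simp only [map_sum, apply_ite (MvPolynomial.eval fun _ => (1 : ℂ)), MvPolynomial.eval_X,
      map_zero, Finset.sum_boole, Nat.cast_eq_zero, Finset.card_eq_zero] at this
    exact Finset.notMem_empty j (this ▸ by simp)
  have h2 : ∀ g : Laurent N m, ∀ u : Fin (m + 1) → ℤ, u (Fin.last m) ≠ 1 →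
      Laurent.coeffAt u (Laurent.homog 1 g) = 0 := by
    intro g u hu
    induction g using Laurent.single_induction with
    | zero => simp
    | add p q hp hq => rw [map_add, map_add, hp, hq, add_zero]
    | single v c =>
      rw [Laurent.homog_single, Laurent.coeffAt_single, if_neg]
      rintro rfl
      exact hu (by simp)
  by_contra h
  exact h1 (hg ▸ h2 g _ h)

/-- The last coordinate form supports the cone, so a facet form exists; an integral `α` would give
it an integral value. -/
theorem exists_not_int_of_isNonresonant {N m : ℕ} (A : Fin N → Fin (m + 1) → ℤ)
    (hA : AddSubgroup.closure (Set.range A) = ⊤) (hlast : ∀ j, A j (Fin.last m) = 1)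
    (α : Fin (m + 1) → ℂ) (hα : IsNonresonant A α) : ∃ i, ∀ k : ℤ, (k : ℂ) + α i ≠ 0 := by
  by_contra! h
  choose k hk using h
  obtain ⟨c, hc⟩ := exists_isFacetForm A hA (Pi.single (Fin.last m) 1) (by simp) fun j => by
    rw [single_one_dotProduct, hlast]
    exact zero_le_one
  refine hα c hc (∑ i, c i * -k i) ?_
  push_cast
  refine Finset.sum_congr rfl fun i _ => ?_
  rw [← eq_neg_of_add_eq_zero_right (hk i)]

end

theorem theorem1p5 {N m : ℕ} (A : Fin N → Fin (m + 1) → ℤ)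
    (hA : AddSubgroup.closure (Set.range A) = ⊤)
    (g : Laurent N m)
    (hg : genericLaurent A = Laurent.var (Fin.last m) * Laurent.incl g)
    (α : Fin (m + 1) → ℂ) (hα : IsNonresonant A α) :
    Subsingleton ((torusData (genericLaurent A) α).H 0) ∧
      ∀ i : ℕ, Nonempty ((torusData (genericLaurent A) α).H (i + 1) ≃ₗ[Weyl N]
        (complementData g α).H i) := by
  -- `homog 1 g` unfolds to the product of the last variable with the included `g`.
  have hf : genericLaurent A = Laurent.homog 1 g := hg
  obtain ⟨i₀, hi₀⟩ := exists_not_int_of_isNonresonant A hA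
    (last_eq_one_of_genericLaurent A g hf) α hα
  rw [hf]
  exact ⟨subsingleton_H_zero g hi₀, nonempty_H_equiv g hi₀⟩
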